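/- Let $\mathcal X,\mathcal Y,\mathcal Z$ be finite sets, let $P_{X,Y,Z}$ be a probability distribution on $\mathcal X\times\mathcal Y\times\mathcal Z$, and let $(X^n,Y^n,Z^n)$ be i.i.d. according to $P_{X,Y,Z}$. All logarithms and information quantities are to base $2$. A code of length $n$ consists of finite sets $\mathcal M^{(n)},\mathcal S^{(n)}$, encoders $f_m^{(n)}:\mathcal X^n\to\mathcal M^{(n)}$ and $f_s^{(n)}:\mathcal X^n\to\mathcal S^{(n)}$, and a decoder $g^{(n)}:\mathcal M^{(n)}\times\mathcal Y^n\to\mathcal S^{(n)}$; put $M=f_m^{(n)}(X^n)$, $S=f_s^{(n)}(X^n)$ and $\hat S=g^{(n)}(M,Y^n)$. A triple $(R,L,R_s)$ of non-negative reals is achievable if for every $\delta>0$ and all sufficiently large $n$ there is a code of length $n$ such that $$\Pr(\hat S\ne S)\le\delta,\qquad \tfrac1n\log|\mathcal M^{(n)}|\le R+\delta,\qquad \tfrac1n I(X^n;M,Z^n)\le L+\delta,$$ $$\tfrac1n H(S)\ge R_s-\delta,\qquad \tfrac1n I(S;M,Z^n)\le\delta .$$ The compression–leakage–key-rate region $\mathcal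 R_2$ is the set of all achievable triples. Theorem. $\mathcal R_2$ is the set of all triples $(R,L,R_s)$ of non-negative reals such that $$R\ge I(X;V|Y),\qquad L\ge I(X;V,Y)-I(X;Y|U)+I(X;Z|U),\qquad R_s\le I(V;Y|U)-I(V;Z|U)$$ for some joint distribution of the form $P_{X,Y,Z}P_{V|X}P_{U|V}$ on $\mathcal X\times\mathcal Y\times\mathcal Z\times\mathcal V\times\mathcal U$ with $|\mathcal U|\le|\mathcal X|+3$ and $|\mathcal V|\le(|\mathcal X|+3)(|\mathcal X|+2)$. -/

import Mathlib

namespace SecretKey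

/-! ### Shannon information measures of finite random variables

A random variable is a function `f : Ω → A` on a finite outcome space whose probability mass
function is `p : Ω → ℝ`. All information quantities are in bits. -/

section Information

variable {Ω A B C : Type*} [Fintype Ω] [Fintype A] [Fintype B] [Fintype C]

open Classical in
/-- The probability of the event `E` under the probability mass function `p`. -/
noncomputable def prob (p : Ω → ℝ) (E : Set Ω) : ℝ :=
  ∑ ω, if ω ∈ E then p ω else 0

/-- The probability mass function of the random variable `f`. -/
noncomputable def law (p : Ω → ℝ) (f : Ω → A) (a : A) : ℝ :=
  prob p {ω | f ω = a}

/-- The entropy `H(f) = - ∑ₐ Pr(f = a) log₂ Pr(f = a)`, with `0 log 0 = 0`. -/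
noncomputable def entropy (p : Ω → ℝ) (f : Ω → A) : ℝ :=
  (∑ a, Real.negMulLog (law p f a)) / Real.log 2

/-- The mutual information `I(f; g) = H(f) + H(g) - H(f, g)`. -/
noncomputable def mutualInfo (p : Ω → ℝ) (f : Ω → A) (g : Ω → B) : ℝ :=
  entropy p f + entropy p g - entropy p (fun ω => (f ω, g ω))

/-- The conditional mutual information
`I(f; g | h) = H(f, h) + H(g, h) - H(f, g, h) - H(h)`. -/
noncomputable def condMutualInfo (p : Ω → ℝ) (f : Ω → A) (g : Ω → B) (h : Ω → C) : ℝ :=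
  entropy p (fun ω => (f ω, h ω)) + entropy p (fun ω => (g ω, h ω))
    - entropy p (fun ω => (f ω, g ω, h ω)) - entropy p h

end Information

/-! ### Codes and the operational region -/

section Operational

variable {X Y Z : Type*} [Fintype X] [Fintype Y] [Fintype Z]

/-- The probability mass function of `(Xⁿ, Yⁿ, Zⁿ)`, i.i.d. according to `P`. -/
noncomputable def iidLaw (P : X × Y × Z → ℝ) (n : ℕ) (ω : Fin n → X × Y × Z) : ℝ :=
  ∏ i, P (ω i)

/-- The source sequence `Xⁿ`. -/
def seqX {n : ℕ} (ω : Fin n → X × Y × Z) : Fin n → X := fun i => (ω i).1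

/-- The authentication sequence `Yⁿ`. -/
def seqY {n : ℕ} (ω : Fin n → X × Y × Z) : Fin n → Y := fun i => (ω i).2.1

/-- The side information `Zⁿ` of the adversary. -/
def seqZ {n : ℕ} (ω : Fin n → X × Y × Z) : Fin n → Z := fun i => (ω i).2.2

/-- A code of block length `n`: two (deterministic) encoders and a decoder. The finite sets of
descriptions and of keys are labelled as `Fin numM` and `Fin numS`. -/
structure Code (X Y : Type*) (n : ℕ) where
  /-- the number of descriptions -/
  numM : ℕ
  /-- the number of keys -/
  numS : ℕ
  /-- the encoder generating the description -/
  encM : (Fin n → X) → Fin numM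
  /-- the encoder generating the secret key -/
  encS : (Fin n → X) → Fin numS
  /-- the decoder estimating the secret key -/
  dec : Fin numM × (Fin n → Y) → Fin numS

namespace Code

variable {n : ℕ} (c : Code X Y n)

/-- The description `M`. -/
def descr (ω : Fin n → X × Y × Z) : Fin c.numM := c.encM (seqX ω)

/-- The secret key `S`. -/
def key (ω : Fin n → X × Y × Z) : Fin c.numS := c.encS (seqX ω)

/-- The decoder's estimate of the secret key. -/
def keyEst (ω : Fin n → X × Y × Z) : Fin c.numS := c.dec (c.descr ω, seqY ω)

/-- The code meets, with slack `δ`, the constraints on false rejection, compression rate,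
source leakage rate, key rate and key leakage rate at the tuple `(R, L, Rs)`. -/
structure Meets (P : X × Y × Z → ℝ) (δ R L Rs : ℝ) : Prop where
  falseRejection : prob (iidLaw P n) {ω | c.keyEst ω ≠ c.key ω} ≤ δ
  compression : 1 / (n : ℝ) * Real.logb 2 (c.numM : ℝ) ≤ R + δ
  leakage :
    1 / (n : ℝ) * mutualInfo (iidLaw P n) seqX (fun ω => (c.descr ω, seqZ ω)) ≤ L + δ
  keyRate : Rs - δ ≤ 1 / (n : ℝ) * entropy (iidLaw P n) c.key
  keyLeakage :
    1 / (n : ℝ) * mutualInfo (iidLaw P n) c.key (fun ω => (c.descr ω, seqZ ω)) ≤ δ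

end Code

/-- The compression-leakage-key rate region: the set of all achievable tuples
`(R, L, Rs)` of non-negative reals. -/
def keyRateRegion (P : X × Y × Z → ℝ) : Set (ℝ × ℝ × ℝ) :=
  {t | 0 ≤ t.1 ∧ 0 ≤ t.2.1 ∧ 0 ≤ t.2.2 ∧
    ∀ δ : ℝ, 0 < δ → ∀ᶠ n : ℕ in Filter.atTop,
      ∃ c : Code X Y n, c.Meets P δ t.1 t.2.1 t.2.2}

end Operational

/-! ### The single-letter region -/

section SingleLetter

variable {X Y Z : Type*} [Fintype X] [Fintype Y] [Fintype Z]

/-- The joint probability mass function `P_{X,Y,Z} P_{V|X} P_{U|V}` of `(X, Y, Z, V, U)`. -/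
def jointLaw {V U : Type*} (P : X × Y × Z → ℝ) (PV : X → V → ℝ) (PU : V → U → ℝ)
    (ω : X × Y × Z × V × U) : ℝ :=
  match ω with
  | (x, y, z, v, u) => P (x, y, z) * PV x v * PU v u

/-- The random variable `X` on the outcome space of `(X, Y, Z, V, U)`. -/
def rvX {V U : Type*} (ω : X × Y × Z × V × U) : X := ω.1

/-- The random variable `Y`. -/
def rvY {V U : Type*} (ω : X × Y × Z × V × U) : Y := ω.2.1

/-- The random variable `Z`. -/
def rvZ {V U : Type*} (ω : X × Y × Z × V × U) : Z := ω.2.2.1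

/-- The random variable `V`. -/
def rvV {V U : Type*} (ω : X × Y × Z × V × U) : V := ω.2.2.2.1

/-- The random variable `U`. -/
def rvU {V U : Type*} (ω : X × Y × Z × V × U) : U := ω.2.2.2.2

/-- The set of all tuples `(R, L, Rs)` of non-negative reals with `R ≥ I(X;V|Y)`,
`L ≥ I(X;V,Y) - I(X;Y|U) + I(X;Z|U)` and `Rs ≤ I(V;Y|U) - I(V;Z|U)` for some joint law
`P_{X,Y,Z} P_{V|X} P_{U|V}` with `|𝒰| ≤ |𝒳| + 3` and `|𝒱| ≤ (|𝒳| + 3)(|𝒳| + 2)`.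
The alphabets `𝒰` and `𝒱` are labelled as `Fin k` and `Fin l`. -/
def singleLetterRegion (P : X × Y × Z → ℝ) : Set (ℝ × ℝ × ℝ) :=
  {t | 0 ≤ t.1 ∧ 0 ≤ t.2.1 ∧ 0 ≤ t.2.2 ∧
    ∃ k l : ℕ, k ≤ Fintype.card X + 3 ∧
      l ≤ (Fintype.card X + 3) * (Fintype.card X + 2) ∧
      ∃ (PV : X → Fin l → ℝ) (PU : Fin l → Fin k → ℝ),
        (∀ x, PV x ∈ stdSimplex ℝ (Fin l)) ∧ (∀ v, PU v ∈ stdSimplex ℝ (Fin k)) ∧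
        condMutualInfo (jointLaw P PV PU) rvX rvV rvY ≤ t.1 ∧
        mutualInfo (jointLaw P PV PU) rvX (fun ω => (rvV ω, rvY ω))
            - condMutualInfo (jointLaw P PV PU) rvX rvY rvU
            + condMutualInfo (jointLaw P PV PU) rvX rvZ rvU ≤ t.2.1 ∧
        t.2.2 ≤ condMutualInfo (jointLaw P PV PU) rvV rvY rvU
            - condMutualInfo (jointLaw P PV PU) rvV rvZ rvU}

end SingleLetter

end SecretKey

/-! Both inclusions use the same reduction (`single_letter_rates`). The Markov chains U - V - X -
(Y, Z) turn the three rate expressions into combinations of source entropies with the differences a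
= H(X,V) - H(Y,V), b = H(Y,U) - H(Z,U) and c = H(Y,V) - H(Z,V): up to source terms the rates are -a,
-a - b and b - c.

Converse. For a code put U = (I, M, Z before I, Y after I) and V = (S, U), with I a uniform time
index. Csiszár's sum identity (`csiszar_sum`) evaluates n b and n c exactly as H(M,Yⁿ) - H(M,Zⁿ) and
H(S,M,Yⁿ) - H(S,M,Zⁿ), while memorylessness gives n a ≥ n H(X) - H(S,M,Yⁿ) (`sum_nent_ge`). Fano's
inequality makes H(S | M,Yⁿ) negligible, and the single-letter bounds follow up to ε. The alphabets
are cut down by Carathéodory's theorem: a, b and c are sums, over the values of the auxiliary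
variables, of homogeneous functionals of the unnormalised law of X (`chanEnt`), so conic
combinations suffice. A reduction over S inside each value of U keeps |X| + 2 coordinates, one over
U keeps |X| + 3 (`exists_reduction`). With the alphabets fixed, the test channels form a compact set
on which entropies are continuous, so ε can tend to 0.

Achievability. Encoders are deterministic, so the test channel is first simulated by a quantizer of
blocks Xᵏ whose outputs are jointly typical with the block; greedy covering constructs it
(`eventually_exists_quantizer`). Gibbs' inequality against the single-letter conditional laws shows
that the joint entropies of the quantized superletters with Yᵏ or Zᵏ are close to k times their
single-letter values (`exists_superletter`).

The superletters U, V of successive blocks form an i.i.d. source, to which random hashing applies.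
Hashes of U at rate H(U|Y) and of V at rate H(V|U,Y) form the description; a further hash of V, at
rate H(V|U,Z) - H(V|U,Y), is the key. Description and key together let V be recovered from (U, Z),
so by Fano the key, the second hash and (U, Z) have joint entropy almost H(V,U,Z). Counting rates,
this forces the key to have almost maximal entropy and to be almost independent, per letter, of
everything the adversary sees, even if U is revealed in full (`exists_block_code`). -/

namespace SecretKey

open Finset
open scoped Classical

set_option linter.unusedSectionVars false

/-! ### Laws and entropies in nats -/

section Toolbox

variable {Ω Ω' A B C D : Type*} [Fintype Ω] [Fintype Ω'] [Fintype A] [Fintype B] [Fintype C]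
  [Fintype D] {p : Ω → ℝ}

theorem law_eq (p : Ω → ℝ) (f : Ω → A) (a : A) :
    law p f a = ∑ ω, if f ω = a then p ω else 0 := rfl

theorem prob_eq (p : Ω → ℝ) (E : Set Ω) : prob p E = ∑ ω, if ω ∈ E then p ω else 0 := rfl

theorem prob_nonneg (hp : ∀ ω, 0 ≤ p ω) (E : Set Ω) : 0 ≤ prob p E :=
  sum_nonneg fun ω _ => by split_ifs <;> simp [hp]

theorem prob_mono (hp : ∀ ω, 0 ≤ p ω) {E F : Set Ω} (h : ∀ ω, 0 < p ω → ω ∈ E → ω ∈ F) :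
    prob p E ≤ prob p F := by
  refine sum_le_sum fun ω _ => ?_
  by_cases hE : ω ∈ E <;> by_cases hF : ω ∈ F <;> simp [hE, hF, hp]
  by_contra hlt
  exact hF (h ω (not_le.1 hlt) hE)

theorem prob_le_add (hp : ∀ ω, 0 ≤ p ω) {E F G : Set Ω}
    (h : ∀ ω, 0 < p ω → ω ∈ E → ω ∈ F ∨ ω ∈ G) : prob p E ≤ prob p F + prob p G := by
  rw [prob_eq, prob_eq, prob_eq, ← sum_add_distrib]
  refine sum_le_sum fun ω _ => ?_
  rcases (hp ω).eq_or_lt with h0 | h0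
  · simp [← h0]
  · have := h ω h0
    split_ifs <;> simp_all

theorem prob_le_one (hp : p ∈ stdSimplex ℝ Ω) (E : Set Ω) : prob p E ≤ 1 := by
  rw [← hp.2]
  exact sum_le_sum fun ω _ => by split_ifs <;> simp [hp.1]

theorem prob_add_compl (hp : p ∈ stdSimplex ℝ Ω) (E : Set Ω) : prob p E + prob p Eᶜ = 1 := by
  rw [← hp.2, prob_eq, prob_eq, ← sum_add_distrib]
  exact sum_congr rfl fun ω _ => by by_cases h : ω ∈ E <;> simp [h]

theorem law_nonneg (hp : ∀ ω, 0 ≤ p ω) (f : Ω → A) (a : A) : 0 ≤ law p f a :=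
  prob_nonneg hp _

theorem sum_law_mul (p : Ω → ℝ) (f : Ω → A) (φ : A → ℝ) :
    ∑ a, law p f a * φ a = ∑ ω, p ω * φ (f ω) := by
  simp only [law_eq, sum_mul]
  rw [sum_comm]
  refine sum_congr rfl fun ω _ => ?_
  simp [ite_mul]

theorem sum_law (p : Ω → ℝ) (f : Ω → A) : ∑ a, law p f a = ∑ ω, p ω := by
  simpa using sum_law_mul p f (fun _ => 1)

theorem law_mem (hp : p ∈ stdSimplex ℝ Ω) (f : Ω → A) : law p f ∈ stdSimplex ℝ A :=
  ⟨law_nonneg hp.1 f, by rw [sum_law, hp.2]⟩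

theorem prob_law (p : Ω → ℝ) (f : Ω → A) (E : Set A) :
    prob (law p f) E = prob p {ω | f ω ∈ E} := by
  have := sum_law_mul p f (fun a => if a ∈ E then 1 else 0)
  simpa [prob_eq] using this

theorem law_law (p : Ω → ℝ) (f : Ω → A) (g : A → B) :
    law (law p f) g = law p (fun ω => g (f ω)) := by
  funext b
  exact prob_law p f _

theorem le_law (hp : ∀ ω, 0 ≤ p ω) (f : Ω → A) (ω : Ω) : p ω ≤ law p f (f ω) := by
  have := single_le_sum (f := fun ω' => if f ω' = f ω then p ω' else 0)
    (fun ω' _ => by split_ifs <;> simp [hp]) (mem_univ ω)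
  simpa [law_eq] using this

theorem law_le_law (hp : ∀ ω, 0 ≤ p ω) (f : Ω → A) (g : Ω → B) (ω : Ω)
    (h : ∀ ω', g ω' = g ω → f ω' = f ω) : law p g (g ω) ≤ law p f (f ω) :=
  prob_mono hp fun ω' _ h' => h ω' h'

/-- Entropy in nats. -/
noncomputable def nent (p : Ω → ℝ) (f : Ω → A) : ℝ := ∑ a, Real.negMulLog (law p f a)

theorem entropy_eq (p : Ω → ℝ) (f : Ω → A) : entropy p f = nent p f / Real.log 2 := rfl

theorem mutualInfo_eq (p : Ω → ℝ) (f : Ω → A) (g : Ω → B) : mutualInfo p f g =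
    (nent p f + nent p g - nent p (fun ω => (f ω, g ω))) / Real.log 2 := by
  simp only [mutualInfo, entropy_eq]; ring

theorem condMutualInfo_eq (p : Ω → ℝ) (f : Ω → A) (g : Ω → B) (h : Ω → C) :
    condMutualInfo p f g h = (nent p (fun ω => (f ω, h ω)) + nent p (fun ω => (g ω, h ω))
      - nent p (fun ω => (f ω, g ω, h ω)) - nent p h) / Real.log 2 := by
  simp only [condMutualInfo, entropy_eq]; ring

/-- Averaging over outcomes instead of values lets entropies of different variables be compared
pointwise, with null outcomes dropping out. -/
theorem nent_eq (p : Ω → ℝ) (f : Ω → A) :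
    nent p f = ∑ ω, p ω * -Real.log (law p f (f ω)) := by
  rw [← sum_law_mul p f (fun a => -Real.log (law p f a))]
  exact sum_congr rfl fun a _ => by rw [Real.negMulLog]; ring

theorem nent_law (p : Ω → ℝ) (π : Ω → B) (f : B → A) :
    nent (law p π) f = nent p (fun ω => f (π ω)) := by
  rw [nent, law_law]; rfl

theorem nent_mono (hp : ∀ ω, 0 ≤ p ω) {f : Ω → A} {g : Ω → B}
    (h : ∀ ω ω', g ω = g ω' → f ω = f ω') : nent p f ≤ nent p g := by
  rw [nent_eq, nent_eq]
  refine sum_le_sum fun ω _ => ?_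
  rcases (hp ω).eq_or_lt with h0 | h0
  · simp [← h0]
  · refine mul_le_mul_of_nonneg_left (neg_le_neg ?_) (hp ω)
    exact Real.log_le_log (h0.trans_le (le_law hp g ω))
      (law_le_law hp f g ω fun ω' h' => h _ _ h')

theorem nent_congr (hp : ∀ ω, 0 ≤ p ω) {f : Ω → A} {g : Ω → B}
    (h : ∀ ω ω', g ω = g ω' ↔ f ω = f ω') : nent p f = nent p g :=
  le_antisymm (nent_mono hp fun ω ω' => (h ω ω').1) (nent_mono hp fun ω ω' => (h ω ω').2)

theorem nent_const (hp : p ∈ stdSimplex ℝ Ω) : nent p (fun _ => ()) = 0 := by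
  simp [nent, law_eq, hp.2]

/-- Gibbs' inequality: a conditional entropy is at most a conditional cross entropy. -/
theorem nent_gibbs (hp : ∀ ω, 0 ≤ p ω) (f : Ω → A) (g : Ω → B) (q : B → A → ℝ)
    (hq0 : ∀ b a, 0 ≤ q b a) (hq1 : ∀ b, ∑ a, q b a ≤ 1)
    (hpos : ∀ ω, 0 < p ω → 0 < q (g ω) (f ω)) :
    nent p (fun ω => (f ω, g ω)) - nent p g ≤ ∑ ω, p ω * -Real.log (q (g ω) (f ω)) := by
  set k : Ω → A × B := fun ω => (f ω, g ω) with hk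
  -- The likelihood ratio of the proposed joint law to the true one. Its mean is at most the total
  -- mass of `p`, and `log r ≤ r - 1` does the rest.
  set r : A × B → ℝ := fun c => law p g c.2 * q c.2 c.1 / law p k c with hr
  have h1 : ∑ ω, p ω * r (k ω) ≤ ∑ ω, p ω := by
    rw [← sum_law_mul p k r, ← sum_law p g, Fintype.sum_prod_type_right]
    refine sum_le_sum fun b _ => ?_
    calc ∑ a, law p k (a, b) * r (a, b) ≤ ∑ a, law p g b * q b a := by
          refine sum_le_sum fun a _ => ?_
          by_cases h0 : law p k (a, b) = 0
          · rw [h0, zero_mul]; exact mul_nonneg (law_nonneg hp g b) (hq0 b a)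
          · rw [hr]; simp only; rw [mul_div_cancel₀ _ h0]
      _ = law p g b * ∑ a, q b a := by rw [mul_sum]
      _ ≤ law p g b * 1 := mul_le_mul_of_nonneg_left (hq1 b) (law_nonneg hp g b)
      _ = _ := mul_one _
  have h2 : ∀ ω, p ω * (-Real.log (law p k (k ω)) + Real.log (law p g (g ω))
      + Real.log (q (g ω) (f ω))) ≤ p ω * r (k ω) - p ω := by
    intro ω
    rcases (hp ω).eq_or_lt with h0 | h0
    · simp [← h0]
    · have hk0 := h0.trans_le (le_law hp k ω)
      have hg0 := h0.trans_le (le_law hp g ω)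
      have hq := hpos ω h0
      have := Real.log_le_sub_one_of_pos (x := r (k ω)) (by positivity)
      rw [hr] at this
      simp only at this
      rw [Real.log_div (by positivity) hk0.ne', Real.log_mul hg0.ne' hq.ne'] at this
      rw [← mul_sub_one]
      refine mul_le_mul_of_nonneg_left ?_ (hp ω)
      simp only [hr]
      linarith
  rw [nent_eq, nent_eq, ← sum_sub_distrib]
  have h3 := sum_le_sum fun ω (_ : ω ∈ univ) => h2 ω
  rw [sum_sub_distrib] at h3
  have h4 : ∑ ω, p ω * (-Real.log (law p k (k ω)) + Real.log (law p g (g ω))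
      + Real.log (q (g ω) (f ω))) = ∑ ω, (p ω * -Real.log (law p k (k ω)) -
        p ω * -Real.log (law p g (g ω))) - ∑ ω, p ω * -Real.log (q (g ω) (f ω)) := by
    rw [← sum_sub_distrib]; exact sum_congr rfl fun ω _ => by ring
  linarith

/-- Gibbs' inequality with the conditional law of `f` given `h` alone, offered as a prediction of
`f` from `(g, h)`. -/
theorem nent_submod_aux (hp : ∀ ω, 0 ≤ p ω) (f : Ω → A) (g : Ω → B) (h : Ω → C) :
    nent p (fun ω => (f ω, g ω, h ω)) + nent p h ≤
      nent p (fun ω => (f ω, h ω)) + nent p (fun ω => (g ω, h ω)) := by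
  have := nent_gibbs hp f (fun ω => (g ω, h ω))
    (fun b a => law p (fun ω => (f ω, h ω)) (a, b.2) / law p h b.2)
    (fun b a => div_nonneg (law_nonneg hp _ _) (law_nonneg hp _ _))
    (fun b => by
      rw [← sum_div]
      refine div_le_one_of_le₀ (le_of_eq ?_) (law_nonneg hp _ _)
      have := sum_law_mul p (fun ω => (f ω, h ω)) (fun c => if c.2 = b.2 then 1 else 0)
      rw [Fintype.sum_prod_type_right] at this
      simpa [law_eq] using this)
    (fun ω h0 => div_pos (h0.trans_le (le_law hp (fun ω => (f ω, h ω)) ω))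
      (h0.trans_le (le_law hp h ω)))
  have h2 : ∑ ω, p ω * -Real.log (law p (fun ω => (f ω, h ω)) (f ω, h ω) / law p h (h ω))
      = nent p (fun ω => (f ω, h ω)) - nent p h := by
    rw [nent_eq, nent_eq, ← sum_sub_distrib]
    refine sum_congr rfl fun ω _ => ?_
    rcases (hp ω).eq_or_lt with h0 | h0
    · simp [← h0]
    · rw [Real.log_div (h0.trans_le (le_law hp (fun ω => (f ω, h ω)) ω)).ne'
        (h0.trans_le (le_law hp h ω)).ne']
      ring
  simp only at this
  rw [h2] at this
  linarith

/-- Submodularity of entropy: `j` is determined by `(a, b)`, and `m` is determined by `a` as well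
as by `b`. -/
theorem nent_submod (hp : ∀ ω, 0 ≤ p ω) {j : Ω → A} {m : Ω → B} {a : Ω → C} {b : Ω → D}
    (hj : ∀ ω ω', a ω = a ω' → b ω = b ω' → j ω = j ω')
    (ha : ∀ ω ω', a ω = a ω' → m ω = m ω') (hb : ∀ ω ω', b ω = b ω' → m ω = m ω') :
    nent p j + nent p m ≤ nent p a + nent p b := by
  have h1 := nent_submod_aux hp a b m
  have h2 : nent p j ≤ nent p (fun ω => (a ω, b ω, m ω)) :=
    nent_mono hp fun ω ω' h => by
      simp only [Prod.mk.injEq] at h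
      exact hj _ _ h.1 h.2.1
  have h3 : nent p (fun ω => (a ω, m ω)) ≤ nent p a :=
    nent_mono hp fun ω ω' h => by rw [h, ha _ _ h]
  have h4 : nent p (fun ω => (b ω, m ω)) ≤ nent p b :=
    nent_mono hp fun ω ω' h => by rw [h, hb _ _ h]
  linarith

theorem nent_subadd (hp : p ∈ stdSimplex ℝ Ω) {j : Ω → A} {a : Ω → C} {b : Ω → D}
    (hj : ∀ ω ω', a ω = a ω' → b ω = b ω' → j ω = j ω') :
    nent p j ≤ nent p a + nent p b := by
  have := nent_submod hp.1 (m := fun _ => ()) hj (by simp) (by simp)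
  rw [nent_const hp] at this
  linarith

theorem nent_le_log_card (hp : p ∈ stdSimplex ℝ Ω) (f : Ω → A) (T : Finset A)
    (hT : ∀ ω, f ω ∈ T) : nent p f ≤ Real.log (T.card : ℝ) := by
  have hc : ∀ ω, 0 < p ω → (0 : ℝ) < (T.card : ℝ) := fun ω _ => by
    exact_mod_cast card_pos.2 ⟨_, hT ω⟩
  have := nent_gibbs hp.1 f (fun _ => ()) (fun _ a => if a ∈ T then 1 / (T.card : ℝ) else 0)
    (fun _ a => by split_ifs <;> positivity)
    (fun _ => by
      simp only [sum_ite_mem, univ_inter, sum_const, nsmul_eq_mul]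
      rw [mul_one_div]; exact div_self_le_one _)
    (fun ω h0 => by simp only [hT ω, if_true]; have := hc ω h0; positivity)
  rw [nent_const hp] at this
  have h2 : nent p (fun ω => (f ω, ())) = nent p f := nent_congr hp.1 (by simp)
  simp only [hT, if_true, ← sum_mul, hp.2] at this
  rw [h2] at this
  simpa using this

theorem nent_le_log_card_univ (hp : p ∈ stdSimplex ℝ Ω) (f : Ω → A) :
    nent p f ≤ Real.log (Fintype.card A : ℝ) := nent_le_log_card hp f univ (by simp)

/-- Fano's inequality. -/
theorem nent_fano (hp : p ∈ stdSimplex ℝ Ω) (f : Ω → A) (g : Ω → B) (est : B → A) (T : Finset A)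
    (hT : ∀ ω, f ω ∈ T) :
    nent p (fun ω => (f ω, g ω)) - nent p g ≤
      Real.log 2 + prob p {ω | est (g ω) ≠ f ω} * Real.log (T.card : ℝ) := by
  have hc : ∀ ω : Ω, (1 : ℝ) ≤ (T.card : ℝ) := fun ω => by
    exact_mod_cast card_pos.2 ⟨_, hT ω⟩
  -- The predictive law mixes, with weights one half, the point mass at the estimate and the uniform
  -- law on `T`. A correct estimate costs at most `log 2`, a wrong one at most `log 2 + log |T|`.
  refine (nent_gibbs hp.1 f g (fun b a => (1 / 2) * (if a = est b then 1 else 0) +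
    (1 / 2) * (if a ∈ T then 1 / (T.card : ℝ) else 0))
    (fun _ a => by split_ifs <;> positivity)
    (fun _ => by
      rw [sum_add_distrib, ← mul_sum, ← mul_sum]
      simp only [sum_ite_mem, univ_inter, sum_const, nsmul_eq_mul, sum_ite_eq', mem_univ, if_true]
      rw [mul_one_div]
      have := div_self_le_one (T.card : ℝ)
      linarith)
    (fun ω h0 => by
      have := hc ω
      simp only [hT ω, if_true]; positivity)).trans ?_
  have : Real.log 2 + prob p {ω | est (g ω) ≠ f ω} * Real.log (T.card : ℝ) =
      ∑ ω, p ω * (Real.log 2 + (if est (g ω) ≠ f ω then 1 else 0) * Real.log (T.card : ℝ)) := by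
    simp only [mul_add, sum_add_distrib, ← sum_mul, hp.2, one_mul, prob_eq, ← mul_assoc]
    congr 2
    refine sum_congr rfl fun ω _ => ?_
    by_cases he : est (g ω) = f ω <;> simp [he]
  rw [this]
  refine sum_le_sum fun ω _ => mul_le_mul_of_nonneg_left ?_ (hp.1 ω)
  have h1 := hc ω
  simp only [hT ω, if_true]
  rw [← Real.log_inv]
  by_cases he : est (g ω) = f ω
  · simp only [he, if_true, ne_eq, not_true, if_false, zero_mul, add_zero]
    refine Real.log_le_log (by positivity) ?_
    rw [inv_le_comm₀ (by positivity) (by norm_num)]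
    have : (0 : ℝ) ≤ 1 / (T.card : ℝ) := by positivity
    linarith
  · simp only [Ne.symm he, he, if_false, ne_eq, not_false_iff, if_true, one_mul]
    rw [← Real.log_mul (by norm_num) (by positivity)]
    apply le_of_eq; congr 1; field_simp; ring

end Toolbox

/-! ### Product laws -/

section Product

variable {ι Ω A : Type*} [Fintype ι] [DecidableEq ι] [Fintype Ω] [Fintype A]
  {p : ι → Ω → ℝ}

/-- The probability mass function of independent coordinates with laws `p i`. -/
noncomputable def piLaw (p : ι → Ω → ℝ) (ω : ι → Ω) : ℝ := ∏ i, p i (ω i)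

theorem iidLaw_eq {X Y Z : Type*} (P : X × Y × Z → ℝ) (n : ℕ) :
    iidLaw P n = piLaw (fun _ : Fin n => P) := rfl

theorem sum_prod_apply (F : ι → Ω → ℝ) : ∑ ω : ι → Ω, ∏ i, F i (ω i) = ∏ i, ∑ a, F i a := by
  rw [prod_univ_sum, Fintype.piFinset_univ]

theorem sum_piLaw_mul_prod (p : ι → Ω → ℝ) (φ : ι → Ω → ℝ) :
    ∑ ω, piLaw p ω * ∏ i, φ i (ω i) = ∏ i, ∑ a, p i a * φ i a := by
  rw [← sum_prod_apply]
  exact sum_congr rfl fun ω _ => by rw [piLaw, prod_mul_distrib]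

theorem piLaw_nonneg (hp : ∀ i ω, 0 ≤ p i ω) (ω : ι → Ω) : 0 ≤ piLaw p ω :=
  prod_nonneg fun i _ => hp i _

theorem piLaw_pos_iff (hp : ∀ i ω, 0 ≤ p i ω) (ω : ι → Ω) :
    0 < piLaw p ω ↔ ∀ i, 0 < p i (ω i) := by
  refine ⟨fun h i => (hp i _).lt_of_ne' fun h0 => ?_, fun h => prod_pos fun i _ => h i⟩
  rw [piLaw, prod_eq_zero (mem_univ i) h0] at h
  exact h.false

theorem piLaw_mem (hp : ∀ i, p i ∈ stdSimplex ℝ Ω) : piLaw p ∈ stdSimplex ℝ (ι → Ω) :=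
  ⟨piLaw_nonneg fun i => (hp i).1, by
    have := sum_prod_apply p
    simp only [piLaw, this, (hp _).2, prod_const_one]⟩

theorem sum_piLaw_apply (hp : ∀ i, p i ∈ stdSimplex ℝ Ω) (i : ι) (φ : Ω → ℝ) :
    ∑ ω, piLaw p ω * φ (ω i) = ∑ a, p i a * φ a := by
  have := sum_piLaw_mul_prod p (fun j a => if j = i then φ a else 1)
  simp only [prod_ite_eq', mem_univ, if_true] at this
  rw [this, prod_eq_single i]
  · simp
  · intro j _ hj; simp [hj, (hp j).2]
  · simp

theorem sum_piLaw_apply₂ (hp : ∀ i, p i ∈ stdSimplex ℝ Ω) {i j : ι} (hij : i ≠ j) (φ ψ : Ω → ℝ) :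
    ∑ ω, piLaw p ω * (φ (ω i) * ψ (ω j)) = (∑ a, p i a * φ a) * ∑ a, p j a * ψ a := by
  have := sum_piLaw_mul_prod p (fun k a => (if k = i then φ a else 1) * if k = j then ψ a else 1)
  simp only [prod_mul_distrib, prod_ite_eq', mem_univ, if_true] at this
  rw [this, ← mul_prod_erase univ _ (mem_univ i),
    ← mul_prod_erase _ _ (mem_erase.2 ⟨hij.symm, mem_univ j⟩), prod_eq_one]
  · simp [hij, hij.symm]
  · intro k hk
    simp only [mem_erase, mem_univ, and_true] at hk
    simp [hk.1, hk.2, (hp k).2]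

theorem law_piLaw (p : ι → Ω → ℝ) (f : ι → Ω → A) :
    law (piLaw p) (fun ω i => f i (ω i)) = piLaw fun i => law (p i) (f i) := by
  funext b
  have := sum_piLaw_mul_prod p (fun i a => if f i a = b i then 1 else 0)
  simp only [prod_boole, mul_boole, mem_univ, true_implies] at this
  simp only [law_eq, piLaw, funext_iff] at this ⊢
  exact this

theorem nent_piLaw (hp : ∀ i, p i ∈ stdSimplex ℝ Ω) (f : ι → Ω → A) :
    nent (piLaw p) (fun ω i => f i (ω i)) = ∑ i, nent (p i) (f i) := by
  simp only [nent_eq, law_piLaw]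
  have h : ∀ ω, piLaw p ω * -Real.log (piLaw (fun i => law (p i) (f i)) fun i => f i (ω i)) =
      ∑ i, piLaw p ω * -Real.log (law (p i) (f i) (f i (ω i))) := by
    intro ω
    rcases (piLaw_nonneg (fun i => (hp i).1) ω).eq_or_lt with h0 | h0
    · simp [← h0]
    · rw [piLaw_pos_iff fun i => (hp i).1] at h0
      conv_lhs => rw [piLaw.eq_def fun i => law (p i) (f i)]
      rw [Real.log_prod fun i _ => ((h0 i).trans_le (le_law (hp i).1 (f i) (ω i))).ne',
        ← mul_sum, sum_neg_distrib]
  rw [sum_congr rfl fun ω _ => h ω, sum_comm]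
  exact sum_congr rfl fun i _ => sum_piLaw_apply hp i fun a => -Real.log (law (p i) (f i) (f i a))

/-- The law of a family of distinct coordinates. -/
theorem law_piLaw_comp {κ : Type*} [Fintype κ] (hp : ∀ i, p i ∈ stdSimplex ℝ Ω) (e : κ → ι)
    (he : Function.Injective e) :
    law (piLaw p) (fun ω k => ω (e k)) = piLaw fun k => p (e k) := by
  funext b
  have := sum_piLaw_mul_prod p (fun i a => if ∀ k, e k = i → a = b k then 1 else 0)
  simp only [prod_boole, mul_boole, mem_univ, true_implies] at this
  have h1 : law (piLaw p) (fun ω k => ω (e k)) b = ∏ i, ∑ a, if ∀ k, e k = i → a = b k then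
      p i a else 0 := by
    rw [← this, law_eq]
    refine sum_congr rfl fun ω _ => ?_
    have hiff : (fun k => ω (e k)) = b ↔ ∀ i k, e k = i → ω i = b k :=
      ⟨fun h i k hk => by rw [← h, ← hk], fun h => funext fun k => h _ k rfl⟩
    simp only [hiff]
  rw [h1, piLaw, ← prod_subset (subset_univ (univ.image e)), prod_image fun x _ y _ h => he h]
  · refine prod_congr rfl fun k _ => ?_
    simp [he.eq_iff]
  · intro i _ hi
    have : ∀ k, e k ≠ i := fun k hk => hi (mem_image.2 ⟨k, mem_univ _, hk⟩)
    simp [this, (hp i).2]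

/-- Chebyshev's inequality for a sum of functions of independent coordinates. -/
theorem prob_chebyshev (hp : ∀ i, p i ∈ stdSimplex ℝ Ω) (φ : ι → Ω → ℝ) {t : ℝ} (ht : 0 < t) :
    prob (piLaw p) {ω | t ≤ |∑ i, φ i (ω i) - ∑ i, ∑ a, p i a * φ i a|} ≤
      (∑ i, ∑ a, p i a * φ i a ^ 2) / t ^ 2 := by
  set μ : ι → ℝ := fun i => ∑ a, p i a * φ i a with hμ
  set ψ : ι → Ω → ℝ := fun i a => φ i a - μ i with hψ
  have hψ0 : ∀ i, ∑ a, p i a * ψ i a = 0 := fun i => by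
    simp only [hψ, mul_sub, sum_sub_distrib, ← sum_mul, (hp i).2, hμ]; ring
  have hψ2 : ∀ i, ∑ a, p i a * (ψ i a * ψ i a) ≤ ∑ a, p i a * φ i a ^ 2 := fun i => by
    have h : ∀ a, p i a * (ψ i a * ψ i a) = p i a * φ i a ^ 2 - μ i * (2 * (p i a * φ i a))
        + p i a * μ i ^ 2 := fun a => by simp only [hψ]; ring
    simp only [h, sum_add_distrib, sum_sub_distrib, ← mul_sum, ← sum_mul, (hp i).2]
    have : ∑ a, p i a * φ i a = μ i := rfl
    rw [this]; nlinarith [sq_nonneg (μ i)]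
  have hvar : ∑ ω, piLaw p ω * (∑ i, ψ i (ω i)) ^ 2 ≤ ∑ i, ∑ a, p i a * φ i a ^ 2 := by
    have h : ∀ ω, piLaw p ω * (∑ i, ψ i (ω i)) ^ 2 =
        ∑ i, ∑ j, piLaw p ω * (ψ i (ω i) * ψ j (ω j)) := fun ω => by
      rw [sq, sum_mul_sum, mul_sum]
      exact sum_congr rfl fun i _ => by rw [mul_sum]
    rw [sum_congr rfl fun ω _ => h ω, sum_comm]
    refine sum_le_sum fun i _ => ?_
    rw [sum_comm, sum_eq_single i]
    · rw [sum_piLaw_apply hp i fun a => ψ i a * ψ i a]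
      exact hψ2 i
    · intro j _ hj
      rw [sum_piLaw_apply₂ hp hj.symm, hψ0, zero_mul]
    · simp
  rw [le_div_iff₀ (by positivity), prob_eq, sum_mul]
  refine (sum_le_sum fun ω _ => ?_).trans hvar
  have h0 := piLaw_nonneg (fun i => (hp i).1) ω
  split_ifs with h
  · refine mul_le_mul_of_nonneg_left ?_ h0
    rw [Set.mem_ofPred_eq, ← sum_sub_distrib] at h
    rw [← sq_abs (∑ i, ψ i (ω i))]
    exact pow_le_pow_left₀ ht.le h 2
  · rw [zero_mul]; positivity

end Product

/-! ### Conditional laws and stochastic extensions -/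

section Kernel

variable {Ω A B C V : Type*} [Fintype Ω] [Fintype A] [Fintype B] [Fintype C] [Fintype V]
  {p : Ω → ℝ}

/-- The conditional law of `g` given `f`, completed by the law of `g` on null events. -/
noncomputable def condLaw (p : Ω → ℝ) (f : Ω → A) (g : Ω → B) (a : A) (b : B) : ℝ :=
  if law p f a = 0 then law p g b else law p (fun ω => (f ω, g ω)) (a, b) / law p f a

theorem sum_law_pair_right (p : Ω → ℝ) (f : Ω → A) (g : Ω → B) (a : A) :
    ∑ b, law p (fun ω => (f ω, g ω)) (a, b) = law p f a := by
  have := sum_law_mul p (fun ω => (f ω, g ω)) (fun c => if c.1 = a then 1 else 0)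
  rw [Fintype.sum_prod_type_right] at this
  simp only [mul_boole, sum_ite_eq', mem_univ, if_true] at this
  rw [this]; rfl

theorem condLaw_mem (hp : p ∈ stdSimplex ℝ Ω) (f : Ω → A) (g : Ω → B) (a : A) :
    condLaw p f g a ∈ stdSimplex ℝ B := by
  constructor
  · intro b
    unfold condLaw
    split_ifs
    · exact law_nonneg hp.1 _ _
    · exact div_nonneg (law_nonneg hp.1 _ _) (law_nonneg hp.1 _ _)
  · unfold condLaw
    split_ifs with h
    · exact (law_mem hp g).2
    · rw [← sum_div, sum_law_pair_right, div_self h]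

theorem law_mul_condLaw (hp : p ∈ stdSimplex ℝ Ω) (f : Ω → A) (g : Ω → B) (a : A) (b : B) :
    law p f a * condLaw p f g a b = law p (fun ω => (f ω, g ω)) (a, b) := by
  unfold condLaw
  split_ifs with h
  · rw [h, zero_mul]
    refine le_antisymm (law_nonneg hp.1 _ _) ?_
    rw [← h, ← sum_law_pair_right p f g a]
    exact single_le_sum (f := fun b => law p (fun ω => (f ω, g ω)) (a, b))
      (fun b _ => law_nonneg hp.1 _ _) (mem_univ b)
  · rw [mul_div_cancel₀ _ h]

/-- The joint law of `ω` and of the output of the channel `K` with input `ω`. -/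
noncomputable def extLaw (p : Ω → ℝ) (K : Ω → V → ℝ) (w : Ω × V) : ℝ := p w.1 * K w.1 w.2

theorem extLaw_mem (hp : p ∈ stdSimplex ℝ Ω) {K : Ω → V → ℝ} (hK : ∀ ω, K ω ∈ stdSimplex ℝ V) :
    extLaw p K ∈ stdSimplex ℝ (Ω × V) :=
  ⟨fun w => mul_nonneg (hp.1 _) ((hK _).1 _), by
    simp only [extLaw, Fintype.sum_prod_type, ← mul_sum, (hK _).2, mul_one, hp.2]⟩

theorem law_extLaw_fst {K : Ω → V → ℝ} (hK : ∀ ω, K ω ∈ stdSimplex ℝ V) (f : Ω → A) :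
    law (extLaw p K) (fun w => f w.1) = law p f := by
  funext a
  simp only [law_eq, extLaw, Fintype.sum_prod_type]
  refine sum_congr rfl fun ω _ => ?_
  by_cases h : f ω = a <;> simp [h, ← mul_sum, (hK _).2]

theorem nent_extLaw_fst {K : Ω → V → ℝ} (hK : ∀ ω, K ω ∈ stdSimplex ℝ V) (f : Ω → A) :
    nent (extLaw p K) (fun w => f w.1) = nent p f := by
  rw [nent, law_extLaw_fst hK]; rfl

theorem law_extLaw (b : Ω → B) (K : B → V → ℝ) (a : Ω → A) (α : A) (v : V) :
    law (extLaw p fun ω => K (b ω)) (fun w => (a w.1, w.2)) (α, v) =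
      ∑ β, law p (fun ω => (b ω, a ω)) (β, α) * K β v := by
  have h1 : law (extLaw p fun ω => K (b ω)) (fun w => (a w.1, w.2)) (α, v) =
      ∑ ω, p ω * (if a ω = α then K (b ω) v else 0) := by
    simp only [law_eq, extLaw, Fintype.sum_prod_type, Prod.mk.injEq]
    refine sum_congr rfl fun ω _ => ?_
    by_cases h : a ω = α <;> simp [h]
  rw [h1, ← sum_law_mul p (fun ω => (b ω, a ω)) (fun c => if c.2 = α then K c.1 v else 0),
    Fintype.sum_prod_type]
  simp

/-- The law factorises through the channel, and the entropy of a product splits. The added term does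
not involve `a`, so it cancels when two choices of `a` are compared; this is how Markov chains enter
the entropy calculus. -/
theorem nent_extLaw {b : Ω → B} {K : B → V → ℝ} (hK : ∀ b, K b ∈ stdSimplex ℝ V) (a : Ω → A) :
    nent (extLaw p fun ω => K (b ω)) (fun w => (a w.1, b w.1, w.2)) =
      nent p (fun ω => (a ω, b ω)) + ∑ ω, p ω * ∑ v, Real.negMulLog (K (b ω) v) := by
  have h1 : ∀ α β v, law (extLaw p fun ω => K (b ω)) (fun w => (a w.1, b w.1, w.2)) (α, β, v) =
      law p (fun ω => (a ω, b ω)) (α, β) * K β v := fun α β v => by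
    simp only [law_eq, extLaw, Fintype.sum_prod_type, Prod.mk.injEq, sum_mul]
    refine sum_congr rfl fun ω _ => ?_
    by_cases h : a ω = α <;> by_cases h' : b ω = β <;> simp [h, h']
  rw [← sum_law_mul p (fun ω => (a ω, b ω)) (fun c => ∑ v, Real.negMulLog (K c.2 v)), nent, nent,
    ← sum_add_distrib]
  simp only [Fintype.sum_prod_type]
  refine sum_congr rfl fun α _ => sum_congr rfl fun β _ => ?_
  simp only [h1, Real.negMulLog_mul, sum_add_distrib, ← sum_mul, ← mul_sum, (hK _).2, one_mul]

/-- The conditional entropy of the output of the channel `K`, as a functional of the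
(unnormalised) input law. -/
noncomputable def chanEnt (K : A → B → ℝ) (μ : A → ℝ) : ℝ :=
  ∑ b, Real.negMulLog (∑ a, μ a * K a b) - Real.negMulLog (∑ a, μ a)

/-- Homogeneity of degree one, which allows work with unnormalised conditional laws: a value of an
auxiliary variable is a measure, its probability being the total mass. -/
theorem chanEnt_smul {K : A → B → ℝ} (hK : ∀ a, K a ∈ stdSimplex ℝ B) (c : ℝ) (μ : A → ℝ) :
    chanEnt K (c • μ) = c * chanEnt K μ := by
  have h1 : ∑ b, ∑ a, μ a * K a b = ∑ a, μ a := by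
    rw [sum_comm]
    simp only [← mul_sum, (hK _).2, mul_one]
  simp only [chanEnt, Pi.smul_apply, smul_eq_mul, mul_assoc, ← mul_sum, Real.negMulLog_mul,
    sum_add_distrib, ← sum_mul, h1]
  ring

theorem nent_sub_nent_eq_chanEnt {a : Ω → A} {b : Ω → B} {v : Ω → V} {K : A → B → ℝ}
    (h : ∀ β ν, law p (fun ω => (b ω, v ω)) (β, ν) =
      ∑ α, law p (fun ω => (a ω, v ω)) (α, ν) * K α β) :
    nent p (fun ω => (b ω, v ω)) - nent p v =
      ∑ ν, chanEnt K (fun α => law p (fun ω => (a ω, v ω)) (α, ν)) := by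
  have h1 : ∀ ν, ∑ α, law p (fun ω => (a ω, v ω)) (α, ν) = law p v ν := fun ν => by
    have := sum_law_mul p (fun ω => (a ω, v ω)) (fun c => if c.2 = ν then 1 else 0)
    rw [Fintype.sum_prod_type] at this
    simp only [mul_boole, sum_ite_eq', mem_univ, if_true] at this
    rw [this]; rfl
  simp only [chanEnt, h1, sum_sub_distrib, ← h]
  rw [nent, nent, Fintype.sum_prod_type_right]

end Kernel

/-! ### Conic Carathéodory theorem -/

section Caratheodory

variable {I E : Type*} [Fintype I] [AddCommGroup E] [Module ℝ E] [FiniteDimensional ℝ E]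

/-- Among all nonnegative coefficient vectors giving the same sum, one with minimal support is
taken. A linear dependence among its vectors would allow one more coefficient to be removed. -/
theorem exists_conic_support (F : I → E) : ∃ c : I → ℝ, (∀ i, 0 ≤ c i) ∧
    ∑ i, c i • F i = ∑ i, F i ∧ #{i | c i ≠ 0} ≤ Module.finrank ℝ E := by
  have hne : ∃ n, ∃ c : I → ℝ, (∀ i, 0 ≤ c i) ∧ ∑ i, c i • F i = ∑ i, F i ∧ #{i | c i ≠ 0} = n :=
    ⟨_, fun _ => 1, by simp, by simp, rfl⟩
  obtain ⟨c, hc0, hcs, hcn⟩ := Nat.find_spec hne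
  refine ⟨c, hc0, hcs, ?_⟩
  by_contra hlt
  push Not at hlt
  set T : Finset I := {i | c i ≠ 0} with hT
  have hdep : ¬ LinearIndependent ℝ (fun i : T => F i) := fun hli => by
    have := hli.fintype_card_le_finrank
    rw [Fintype.card_coe] at this
    omega
  rw [Fintype.not_linearIndependent_iff] at hdep
  obtain ⟨g0, hg0, i0, hi0⟩ := hdep
  obtain ⟨g, hgT, hg, i1, hi1⟩ : ∃ g : I → ℝ, (∀ i, i ∉ T → g i = 0) ∧ ∑ i, g i • F i = 0 ∧
      ∃ i, 0 < g i := by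
    have key : ∀ s : ℝ, ∑ i, (if h : i ∈ T then s * g0 ⟨i, h⟩ else 0) • F i = 0 := fun s => by
      have : ∑ i, (if h : i ∈ T then s * g0 ⟨i, h⟩ else 0) • F i =
          ∑ i ∈ T, (if h : i ∈ T then s * g0 ⟨i, h⟩ else 0) • F i :=
        (sum_subset (subset_univ T) fun i _ hi => by simp [hi]).symm
      rw [this, ← sum_coe_sort T]
      simp only [coe_mem, dite_true, mul_smul, ← smul_sum, Subtype.coe_eta, hg0, smul_zero]
    rcases lt_or_gt_of_ne hi0 with h | h
    · exact ⟨fun i => if h : i ∈ T then -1 * g0 ⟨i, h⟩ else 0, fun i hi => by simp [hi], key _,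
        i0, by simpa using h⟩
    · exact ⟨fun i => if h : i ∈ T then 1 * g0 ⟨i, h⟩ else 0, fun i hi => by simp [hi], key _,
        i0, by simpa using h⟩
  -- Ratio test: subtracting `c j / g j` times the dependence kills the coefficient at `j` and, by
  -- minimality of the ratio, leaves the others nonnegative.
  obtain ⟨j, hj, hmin⟩ := exists_min_image ({i | 0 < g i} : Finset I) (fun i => c i / g i)
    ⟨i1, by simp [hi1]⟩
  simp only [mem_filter, mem_univ, true_and] at hj hmin
  set t := c j / g j with ht
  have ht0 : 0 ≤ t := div_nonneg (hc0 j) hj.le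
  have hjT : j ∈ T := by
    by_contra h; rw [hgT j h] at hj; exact hj.false
  have hlt2 : #{i | c i - t * g i ≠ 0} < #T := by
    refine card_lt_card ⟨fun i hi => ?_, fun hsub => ?_⟩
    · by_contra h
      have h2 : c i = 0 := by by_contra h3; exact h (by simp [hT, h3])
      simp [hgT i h, h2] at hi
    · have := hsub hjT
      simp only [mem_filter, mem_univ, true_and] at this
      exact this (by rw [ht, div_mul_cancel₀ _ hj.ne', sub_self])
  refine Nat.find_min hne (hcn ▸ hlt2) ⟨fun i => c i - t * g i, fun i => ?_, ?_, rfl⟩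
  · rcases le_or_gt (g i) 0 with h | h
    · have := mul_nonpos_of_nonneg_of_nonpos ht0 h
      linarith [hc0 i]
    · have := hmin i h
      rw [le_div_iff₀ h] at this
      linarith
  · simp only [sub_smul, sum_sub_distrib, mul_smul, ← smul_sum, hg, hcs, smul_zero, sub_zero]

/-- Conic Carathéodory theorem: a finite sum of vectors is a nonnegative combination of at most
`dim E` of them. -/
theorem exists_conic_combination [Nonempty I] (F : I → E) {d : ℕ}
    (hd : Module.finrank ℝ E ≤ d) : ∃ (c : Fin d → ℝ) (k : Fin d → I), (∀ j, 0 ≤ c j) ∧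
      ∑ j, c j • F (k j) = ∑ i, F i := by
  obtain ⟨c, hc0, hcs, hcn⟩ := exists_conic_support F
  set T : Finset I := {i | c i ≠ 0} with hT
  have hTd : Fintype.card T ≤ Fintype.card (Fin d) := by
    rw [Fintype.card_coe, Fintype.card_fin]; exact hcn.trans hd
  obtain ⟨e⟩ := Function.Embedding.nonempty_of_card_le hTd
  obtain ⟨i0⟩ := ‹Nonempty I›
  -- The support is embedded in `Fin d`; unused labels receive weight zero and an arbitrary index.
  refine ⟨fun j => if h : ∃ i, e i = j then c h.choose else 0,
    fun j => if h : ∃ i, e i = j then h.choose else i0, fun j => ?_, ?_⟩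
  · dsimp only; split_ifs
    · exact hc0 _
    · exact le_rfl
  · rw [← hcs]
    have h1 : ∑ i, c i • F i = ∑ i : T, c i • F i := by
      rw [sum_coe_sort T fun i => c i • F i]
      exact (sum_subset (subset_univ T) fun i _ hi => by
        have : c i = 0 := by by_contra h3; exact hi (by simp [hT, h3])
        simp [this]).symm
    rw [h1]
    symm
    have h2 : ∀ i : T, ∀ h : ∃ i', e i' = e i, h.choose = i := fun i h => e.injective h.choose_spec
    rw [← sum_subset (subset_univ (univ.map e))]
    · rw [sum_map]
      refine sum_congr rfl fun i _ => ?_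
      have h : ∃ i', e i' = e i := ⟨i, rfl⟩
      simp only [h, dite_true, h2 i h]
    · intro j _ hj
      have : ¬ ∃ i, e i = j := fun ⟨i, hi⟩ => hj (by simp [← hi])
      simp [this]

end Caratheodory

/-! ### The single-letter region in terms of entropy functionals -/

section Region

variable {X Y Z V U A B : Type*} [Fintype X] [Fintype Y] [Fintype Z] [Fintype V] [Fintype U]
  [Fintype A] [Fintype B] {P : X × Y × Z → ℝ} {PV : X → V → ℝ} {PU : V → U → ℝ}

/-- The source part `(X, Y, Z)` of an outcome. -/
def rvXYZ (ω : X × Y × Z × V × U) : X × Y × Z := (ω.1, ω.2.1, ω.2.2.1)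

theorem law_jointLaw (P : X × Y × Z → ℝ) (PV : X → V → ℝ) (PU : V → U → ℝ)
    (f : X × Y × Z × V × U → A) : law (jointLaw P PV PU) f =
      law (extLaw (extLaw P fun ω => PV ω.1) fun w => PU w.2)
        (fun w => f (w.1.1.1, w.1.1.2.1, w.1.1.2.2, w.1.2, w.2)) := by
  funext a
  simp only [law_eq, Fintype.sum_prod_type, jointLaw, extLaw]

theorem nent_jointLaw (P : X × Y × Z → ℝ) (PV : X → V → ℝ) (PU : V → U → ℝ)
    (f : X × Y × Z × V × U → A) : nent (jointLaw P PV PU) f =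
      nent (extLaw (extLaw P fun ω => PV ω.1) fun w => PU w.2)
        (fun w => f (w.1.1.1, w.1.1.2.1, w.1.1.2.2, w.1.2, w.2)) := by
  rw [nent, law_jointLaw]; rfl

theorem jointLaw_mem (hP : P ∈ stdSimplex ℝ (X × Y × Z)) (hV : ∀ x, PV x ∈ stdSimplex ℝ V)
    (hU : ∀ v, PU v ∈ stdSimplex ℝ U) : jointLaw P PV PU ∈ stdSimplex ℝ (X × Y × Z × V × U) := by
  constructor
  · rintro ⟨x, y, z, v, u⟩
    exact mul_nonneg (mul_nonneg (hP.1 _) ((hV _).1 _)) ((hU _).1 _)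
  · have := (extLaw_mem (extLaw_mem hP fun ω => hV ω.1) fun w => hU w.2).2
    simp only [Fintype.sum_prod_type, jointLaw, extLaw] at this ⊢
    exact this

theorem law_jointLaw_source (hV : ∀ x, PV x ∈ stdSimplex ℝ V) (hU : ∀ v, PU v ∈ stdSimplex ℝ U)
    (b : X × Y × Z → B) : law (jointLaw P PV PU) (fun ω => b (rvXYZ ω)) = law P b := by
  rw [law_jointLaw]
  exact (law_extLaw_fst (K := fun w : (X × Y × Z) × V => PU w.2) (fun w => hU w.2)
    (fun w => b w.1)).trans
      (law_extLaw_fst (K := fun ω : X × Y × Z => PV ω.1) (fun ω => hV ω.1) b)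

theorem nent_jointLaw_source (hV : ∀ x, PV x ∈ stdSimplex ℝ V) (hU : ∀ v, PU v ∈ stdSimplex ℝ U)
    (b : X × Y × Z → B) : nent (jointLaw P PV PU) (fun ω => b (rvXYZ ω)) = nent P b := by
  rw [nent, law_jointLaw_source hV hU]; rfl

/-- The Markov chain V - X - (Y, Z): the channel term H(V|X) is the same with and without `b`. -/
theorem nent_jointLaw_xvb (hP : P ∈ stdSimplex ℝ (X × Y × Z)) (hV : ∀ x, PV x ∈ stdSimplex ℝ V)
    (hU : ∀ v, PU v ∈ stdSimplex ℝ U) (b : X × Y × Z → B) :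
    nent (jointLaw P PV PU) (fun ω => (rvX ω, rvV ω, b (rvXYZ ω))) =
      nent (jointLaw P PV PU) (fun ω => (rvX ω, rvV ω)) +
        (nent P (fun ω => (ω.1, b ω)) - nent P fun ω => ω.1) := by
  have hJ := jointLaw_mem hP hV hU
  have h1 : nent (jointLaw P PV PU) (fun ω => (rvX ω, rvV ω, b (rvXYZ ω))) =
      nent (jointLaw P PV PU) (fun ω => (b (rvXYZ ω), rvX ω, rvV ω)) :=
    nent_congr hJ.1 fun ω ω' => by simp only [Prod.mk.injEq]; tauto
  have h2 : nent (jointLaw P PV PU) (fun ω => (rvX ω, rvV ω)) =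
      nent (jointLaw P PV PU) (fun ω => ((), rvX ω, rvV ω)) :=
    nent_congr hJ.1 fun ω ω' => by simp only [Prod.mk.injEq]; tauto
  have h3 : nent P (fun ω => ω.1) = nent P (fun ω => ((), ω.1)) :=
    nent_congr hP.1 fun ω ω' => by simp only [Prod.mk.injEq]; tauto
  have h4 : nent P (fun ω => (ω.1, b ω)) = nent P (fun ω => (b ω, ω.1)) :=
    nent_congr hP.1 fun ω ω' => by simp only [Prod.mk.injEq]; tauto
  rw [h1, h2, h3, h4, nent_jointLaw, nent_jointLaw]
  have e1 := nent_extLaw_fst (p := extLaw P fun ω => PV ω.1) (fun w => hU w.2)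
    (fun w => (b w.1, w.1.1, w.2))
  have e2 := nent_extLaw_fst (p := extLaw P fun ω => PV ω.1) (fun w => hU w.2)
    (fun w => ((), w.1.1, w.2))
  have e3 := nent_extLaw (p := P) (b := fun ω => ω.1) hV b
  have e4 := nent_extLaw (p := P) (b := fun ω => ω.1) hV (fun _ => ())
  simp only [rvXYZ, rvX, rvV]
  linarith

/-- The Markov chain U - V - (X, Y, Z), by cancellation of H(U|V). -/
theorem nent_jointLaw_vbu (hP : P ∈ stdSimplex ℝ (X × Y × Z)) (hV : ∀ x, PV x ∈ stdSimplex ℝ V)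
    (hU : ∀ v, PU v ∈ stdSimplex ℝ U) (b : X × Y × Z → B) :
    nent (jointLaw P PV PU) (fun ω => (rvV ω, b (rvXYZ ω), rvU ω)) =
      nent (jointLaw P PV PU) (fun ω => (b (rvXYZ ω), rvV ω)) +
        (nent (jointLaw P PV PU) (fun ω => (rvV ω, rvU ω)) -
          nent (jointLaw P PV PU) fun ω => rvV ω) := by
  have hJ := jointLaw_mem hP hV hU
  have h1 : nent (jointLaw P PV PU) (fun ω => (rvV ω, b (rvXYZ ω), rvU ω)) =
      nent (jointLaw P PV PU) (fun ω => (b (rvXYZ ω), rvV ω, rvU ω)) :=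
    nent_congr hJ.1 fun ω ω' => by simp only [Prod.mk.injEq]; tauto
  have h2 : nent (jointLaw P PV PU) (fun ω => (rvV ω, rvU ω)) =
      nent (jointLaw P PV PU) (fun ω => ((), rvV ω, rvU ω)) :=
    nent_congr hJ.1 fun ω ω' => by simp only [Prod.mk.injEq]; tauto
  have h3 : nent (jointLaw P PV PU) (fun ω => rvV ω) =
      nent (jointLaw P PV PU) (fun ω => ((), rvV ω)) :=
    nent_congr hJ.1 fun ω ω' => by simp only [Prod.mk.injEq]; tauto
  rw [h1, h2, h3]
  simp only [nent_jointLaw]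
  have e1 := nent_extLaw_fst (p := extLaw P fun ω => PV ω.1) (fun w => hU w.2)
    (fun w => (b w.1, w.2))
  have e2 := nent_extLaw_fst (p := extLaw P fun ω => PV ω.1) (fun w => hU w.2)
    (fun w => ((), w.2))
  have e3 := nent_extLaw (p := extLaw P fun ω => PV ω.1) (b := fun w => w.2) hU (fun w => b w.1)
  have e4 := nent_extLaw (p := extLaw P fun ω => PV ω.1) (b := fun w => w.2) hU (fun _ => ())
  simp only [rvXYZ, rvU, rvV]
  linarith

/-- The Markov chain U - X - (Y, Z) is deduced from the other two. Submodularity gives "at most";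
for "at least", V is added to the conditioning, where the two known chains evaluate the entropies
exactly. -/
theorem nent_jointLaw_xbu (hP : P ∈ stdSimplex ℝ (X × Y × Z)) (hV : ∀ x, PV x ∈ stdSimplex ℝ V)
    (hU : ∀ v, PU v ∈ stdSimplex ℝ U) (b : X × Y × Z → B) :
    nent (jointLaw P PV PU) (fun ω => (rvX ω, b (rvXYZ ω), rvU ω)) =
      nent (jointLaw P PV PU) (fun ω => (rvX ω, rvU ω)) +
        (nent P (fun ω => (ω.1, b ω)) - nent P fun ω => ω.1) := by
  have hJ := jointLaw_mem hP hV hU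
  have m1 := nent_jointLaw_xvb hP hV hU b
  have m2 := nent_jointLaw_vbu hP hV hU (fun ω => (ω.1, b ω))
  have m3 := nent_jointLaw_vbu hP hV hU (fun ω => ω.1)
  have s1 := nent_submod hJ.1 (j := fun ω => (rvX ω, b (rvXYZ ω), rvU ω)) (m := fun ω => rvX ω)
    (a := fun ω => (rvX ω, rvU ω)) (b := fun ω => (rvX ω, b (rvXYZ ω)))
    (by simp only [Prod.mk.injEq]; tauto) (by simp only [Prod.mk.injEq]; tauto)
    (by simp only [Prod.mk.injEq]; tauto)
  have s2 := nent_submod hJ.1 (j := fun ω => (rvV ω, (rvX ω, b (rvXYZ ω)), rvU ω))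
    (m := fun ω => (rvX ω, rvU ω))
    (a := fun ω => (rvX ω, b (rvXYZ ω), rvU ω)) (b := fun ω => (rvV ω, rvX ω, rvU ω))
    (by simp only [Prod.mk.injEq]; tauto) (by simp only [Prod.mk.injEq]; tauto)
    (by simp only [Prod.mk.injEq]; tauto)
  have e1 := nent_jointLaw_source (P := P) hV hU (fun ω => ω.1)
  have e2 := nent_jointLaw_source (P := P) hV hU (fun ω => (ω.1, b ω))
  have c1 : nent (jointLaw P PV PU) (fun ω => ((rvX ω, b (rvXYZ ω)), rvV ω)) =
      nent (jointLaw P PV PU) (fun ω => (rvX ω, rvV ω, b (rvXYZ ω))) :=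
    nent_congr hJ.1 fun ω ω' => by simp only [Prod.mk.injEq]; tauto
  simp only [rvXYZ, rvX, rvV, rvU] at *
  linarith

/-- The single-letter rate expressions through conditional entropies given `V` and `U`. -/
theorem single_letter_rates (hP : P ∈ stdSimplex ℝ (X × Y × Z))
    (hV : ∀ x, PV x ∈ stdSimplex ℝ V) (hU : ∀ v, PU v ∈ stdSimplex ℝ U) :
    let J := jointLaw P PV PU
    let a := nent J (fun ω => (rvX ω, rvV ω)) - nent J (fun ω => (rvY ω, rvV ω))
    let b := nent J (fun ω => (rvY ω, rvU ω)) - nent J (fun ω => (rvZ ω, rvU ω))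
    let c := nent J (fun ω => (rvY ω, rvV ω)) - nent J (fun ω => (rvZ ω, rvV ω))
    condMutualInfo J rvX rvV rvY =
        (nent P (fun ω => ω.1) - nent P (fun ω => ω.2.1) - a) / Real.log 2 ∧
      mutualInfo J rvX (fun ω => (rvV ω, rvY ω)) - condMutualInfo J rvX rvY rvU
          + condMutualInfo J rvX rvZ rvU =
        (2 * nent P (fun ω => ω.1) - nent P (fun ω => (ω.1, ω.2.2)) - a - b) / Real.log 2 ∧
      condMutualInfo J rvV rvY rvU - condMutualInfo J rvV rvZ rvU = (b - c) / Real.log 2 := by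
  intro J a b c
  have hJ : J ∈ stdSimplex ℝ _ := jointLaw_mem hP hV hU
  have m1 := nent_jointLaw_xvb hP hV hU (fun ω => ω.2.1)
  have m2 := nent_jointLaw_xbu hP hV hU (fun ω => ω.2.1)
  have m3 := nent_jointLaw_xbu hP hV hU (fun ω => ω.2.2)
  have m4 := nent_jointLaw_vbu hP hV hU (fun ω => ω.2.1)
  have m5 := nent_jointLaw_vbu hP hV hU (fun ω => ω.2.2)
  have e1 := nent_jointLaw_source (P := P) hV hU (fun ω => ω.1)
  have e2 := nent_jointLaw_source (P := P) hV hU (fun ω => ω.2.1)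
  have e3 := nent_jointLaw_source (P := P) hV hU (fun ω => (ω.1, ω.2.1))
  have c1 : nent J (fun ω => (rvV ω, rvY ω)) = nent J (fun ω => (rvY ω, rvV ω)) :=
    nent_congr hJ.1 fun ω ω' => by simp only [Prod.mk.injEq]; tauto
  have h1 : ∀ ω : X × Y × Z × V × U, (rvXYZ ω).1 = rvX ω := fun _ => rfl
  have h2 : ∀ ω : X × Y × Z × V × U, (rvXYZ ω).2.1 = rvY ω := fun _ => rfl
  have h3 : ∀ ω : X × Y × Z × V × U, (rvXYZ ω).2.2 = rvZ ω := fun _ => rfl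
  simp only [h1, h2, h3] at m1 m2 m3 m4 m5 e1 e2 e3
  change nent J _ = nent J _ + _ at m1 m2 m3
  change nent J _ = nent J _ + (nent J _ - nent J _) at m4 m5
  change nent J _ = _ at e1 e2 e3
  simp only [condMutualInfo_eq, mutualInfo_eq, div_sub_div_same, ← add_div]
  refine ⟨?_, ?_, ?_⟩ <;> congr 1
  · change _ = _ - _ - (nent J _ - nent J _); linarith
  · change _ = _ - (nent J _ - nent J _) - (nent J _ - nent J _); linarith
  · change _ = (nent J _ - nent J _) - (nent J _ - nent J _); linarith

end Region

/-! ### Conditional entropies given V or U as sums over the values of the auxiliary variable -/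

section Kernels

variable {X Y Z V U B : Type*} [Fintype X] [Fintype Y] [Fintype Z] [Fintype V] [Fintype U]
  [Fintype B] {P : X × Y × Z → ℝ} {PV : X → V → ℝ} {PU : V → U → ℝ}

/-- The identity channel. -/
noncomputable def idChan (x x' : X) : ℝ := if x = x' then 1 else 0

theorem idChan_mem (x : X) : idChan x ∈ stdSimplex ℝ X :=
  ⟨fun x' => by unfold idChan; split_ifs <;> norm_num, by simp [idChan]⟩

theorem law_jointLaw_bv (hU : ∀ v, PU v ∈ stdSimplex ℝ U) (b : X × Y × Z → B) (β : B) (v : V) :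
    law (jointLaw P PV PU) (fun ω => (b (rvXYZ ω), rvV ω)) (β, v) =
      ∑ x, law P (fun ω => (ω.1, b ω)) (x, β) * PV x v := by
  rw [law_jointLaw]
  refine (congrFun (law_extLaw_fst (p := extLaw P fun ω => PV ω.1)
    (K := fun w : (X × Y × Z) × V => PU w.2) (fun w => hU w.2)
    (fun w => (b w.1, w.2))) (β, v)).trans ?_
  exact law_extLaw (p := P) (fun ω => ω.1) PV b β v

theorem law_jointLaw_bu (hU : ∀ v, PU v ∈ stdSimplex ℝ U) (b : X × Y × Z → B) (β : B) (u : U) :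
    law (jointLaw P PV PU) (fun ω => (b (rvXYZ ω), rvU ω)) (β, u) =
      ∑ v, law (jointLaw P PV PU) (fun ω => (b (rvXYZ ω), rvV ω)) (β, v) * PU v u := by
  rw [law_jointLaw]
  refine (law_extLaw (p := extLaw P fun ω => PV ω.1) (fun w => w.2) PU (fun w => b w.1) β u).trans
    (sum_congr rfl fun v _ => ?_)
  rw [law_jointLaw]
  congr 1
  refine Eq.trans ?_ (congrFun (law_extLaw_fst (p := extLaw P fun ω => PV ω.1)
    (K := fun w : (X × Y × Z) × V => PU w.2) (fun w => hU w.2)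
    (fun w => (b w.1, w.2))) (β, v)).symm
  simp only [law_eq, Prod.mk.injEq, and_comm]

theorem law_diag (P : X × Y × Z → ℝ) (x x' : X) :
    law P (fun ω => (ω.1, ω.1)) (x', x) = law P (fun ω => ω.1) x' * idChan x' x := by
  unfold idChan
  split_ifs with h
  · subst h; simp [law_eq]
  · rw [law_eq, mul_zero]
    refine sum_eq_zero fun ω _ => if_neg fun h' => ?_
    simp only [Prod.mk.injEq] at h'
    exact h (h'.1.symm.trans h'.2)

/-- Every decomposition of the law of `X` into measures `m v` is realised by a test channel. -/
theorem exists_channel [Nonempty V] (hP : P ∈ stdSimplex ℝ (X × Y × Z)) (m : V → X → ℝ)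
    (hm0 : ∀ v x, 0 ≤ m v x) (hm : ∀ x, ∑ v, m v x = law P (fun ω => ω.1) x) :
    ∃ PV : X → V → ℝ, (∀ x, PV x ∈ stdSimplex ℝ V) ∧
      ∀ x v, law P (fun ω => ω.1) x * PV x v = m v x := by
  obtain ⟨v0⟩ := ‹Nonempty V›
  -- On letters of probability zero the channel is irrelevant; a point mass keeps it stochastic.
  refine ⟨fun x v => if law P (fun ω => ω.1) x = 0 then (if v = v0 then 1 else 0)
    else m v x / law P (fun ω => ω.1) x, fun x => ?_, fun x v => ?_⟩
  · by_cases h : law P (fun ω => ω.1) x = 0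
    · exact ⟨fun v => by simp only [h, if_true]; split_ifs <;> norm_num, by simp [h]⟩
    · refine ⟨fun v => ?_, ?_⟩
      · simp only [h, if_false]
        exact div_nonneg (hm0 _ _) (law_nonneg hP.1 _ _)
      · simp only [h, if_false, ← sum_div, hm, div_self h]
  · by_cases h : law P (fun ω => ω.1) x = 0
    · have h2 := hm x
      rw [h, sum_eq_zero_iff_of_nonneg fun v _ => hm0 v x] at h2
      rw [h, zero_mul, h2 v (mem_univ v)]
    · simp only [h, if_false, mul_div_cancel₀ _ h]

theorem law_jointLaw_xv (hU : ∀ v, PU v ∈ stdSimplex ℝ U) (x : X) (v : V) :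
    law (jointLaw P PV PU) (fun ω => (rvX ω, rvV ω)) (x, v) =
      law P (fun ω => ω.1) x * PV x v := by
  refine (law_jointLaw_bv (P := P) (PV := PV) hU (fun ω => ω.1) x v).trans ?_
  simp [law_diag, idChan]

theorem law_jointLaw_bv_eq (hP : P ∈ stdSimplex ℝ (X × Y × Z)) (hU : ∀ v, PU v ∈ stdSimplex ℝ U)
    (b : X × Y × Z → B) (β : B) (v : V) :
    law (jointLaw P PV PU) (fun ω => (b (rvXYZ ω), rvV ω)) (β, v) =
      ∑ x, law (jointLaw P PV PU) (fun ω => (rvX ω, rvV ω)) (x, v) *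
        condLaw P (fun ω => ω.1) b x β := by
  rw [law_jointLaw_bv hU]
  refine sum_congr rfl fun x _ => ?_
  rw [law_jointLaw_xv hU, ← law_mul_condLaw hP]
  ring

/-- Puts the entropy in the form required by the Carathéodory reduction: each `v` enters only
through its unnormalised law of X, the channel to `b` being fixed by the source. -/
theorem nent_given_V (hP : P ∈ stdSimplex ℝ (X × Y × Z)) (hU : ∀ v, PU v ∈ stdSimplex ℝ U)
    (b : X × Y × Z → B) :
    nent (jointLaw P PV PU) (fun ω => (b (rvXYZ ω), rvV ω)) - nent (jointLaw P PV PU) rvV =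
      ∑ v, chanEnt (condLaw P (fun ω => ω.1) b) (fun x => law P (fun ω => ω.1) x * PV x v) := by
  refine (nent_sub_nent_eq_chanEnt (law_jointLaw_bv_eq hP hU b)).trans ?_
  simp only [law_jointLaw_xv hU]

theorem nent_given_U (hP : P ∈ stdSimplex ℝ (X × Y × Z)) (hU : ∀ v, PU v ∈ stdSimplex ℝ U)
    (b : X × Y × Z → B) :
    nent (jointLaw P PV PU) (fun ω => (b (rvXYZ ω), rvU ω)) - nent (jointLaw P PV PU) rvU =
      ∑ u, chanEnt (condLaw P (fun ω => ω.1) b)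
        (fun x => ∑ v, law P (fun ω => ω.1) x * PV x v * PU v u) := by
  have hxu : ∀ x u, law (jointLaw P PV PU) (fun ω => (rvX ω, rvU ω)) (x, u) =
      ∑ v, law (jointLaw P PV PU) (fun ω => (rvX ω, rvV ω)) (x, v) * PU v u := fun x u =>
    law_jointLaw_bu (P := P) (PV := PV) hU (fun ω => ω.1) x u
  have hbu : ∀ β u, law (jointLaw P PV PU) (fun ω => (b (rvXYZ ω), rvU ω)) (β, u) =
      ∑ x, law (jointLaw P PV PU) (fun ω => (rvX ω, rvU ω)) (x, u) *
        condLaw P (fun ω => ω.1) b x β := fun β u => by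
    rw [law_jointLaw_bu hU]
    simp only [law_jointLaw_bv_eq hP hU, hxu, sum_mul]
    rw [sum_comm]
    exact sum_congr rfl fun v _ => sum_congr rfl fun x _ => by ring
  refine (nent_sub_nent_eq_chanEnt hbu).trans ?_
  simp only [hxu, law_jointLaw_xv hU]

end Kernels

/-! ### Reduction of the auxiliary alphabets -/

section Reduction

variable {X B B' U S : Type*} [Fintype X] [Fintype B] [Fintype B'] [Fintype U] [Fintype S]
  [Nonempty U] [Nonempty S]

/-- Carathéodory reduction of a two-level decomposition, preserving the functionals. -/
theorem exists_reduction {KX : X → X → ℝ} {KY : X → B → ℝ} {KZ : X → B' → ℝ}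
    (hX : ∀ x, KX x ∈ stdSimplex ℝ X)
    (hY : ∀ x, KY x ∈ stdSimplex ℝ B) (hZ : ∀ x, KZ x ∈ stdSimplex ℝ B') (m : U → S → X → ℝ)
    (hm : ∀ u s x, 0 ≤ m u s x) :
    ∃ m' : Fin (Fintype.card X + 3) → Fin (Fintype.card X + 2) → X → ℝ,
      (∀ u s x, 0 ≤ m' u s x) ∧ ∑ u, ∑ s, m' u s = ∑ u, ∑ s, m u s ∧
      ∑ u, ∑ s, (chanEnt KX (m' u s) - chanEnt KY (m' u s)) =
        ∑ u, ∑ s, (chanEnt KX (m u s) - chanEnt KY (m u s)) ∧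
      ∑ u, ∑ s, (chanEnt KY (m' u s) - chanEnt KZ (m' u s)) =
        ∑ u, ∑ s, (chanEnt KY (m u s) - chanEnt KZ (m u s)) ∧
      ∑ u, (chanEnt KY (∑ s, m' u s) - chanEnt KZ (∑ s, m' u s)) =
        ∑ u, (chanEnt KY (∑ s, m u s) - chanEnt KZ (∑ s, m u s)) := by
  set fA : (X → ℝ) → ℝ := fun μ => chanEnt KX μ - chanEnt KY μ with hfA
  set fC : (X → ℝ) → ℝ := fun μ => chanEnt KY μ - chanEnt KZ μ with hfC
  have hA : ∀ (c : ℝ) μ, fA (c • μ) = c * fA μ := fun c μ => by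
    simp only [hfA, chanEnt_smul hX, chanEnt_smul hY]; ring
  have hC : ∀ (c : ℝ) μ, fC (c • μ) = c * fC μ := fun c μ => by
    simp only [hfC, chanEnt_smul hY, chanEnt_smul hZ]; ring
  -- Inner reduction for each `u`: the law of X and the two functionals depending on V are
  -- preserved, `|X| + 2` coordinates in all. Preserving the law also preserves the functional of
  -- `u` itself.
  have h1 := fun u => exists_conic_combination (I := S) (E := (X → ℝ) × ℝ × ℝ)
    (d := Fintype.card X + 2) (fun s => (m u s, fA (m u s), fC (m u s)))
    (by simp [Module.finrank_prod])
  choose d idx hd0 hd using h1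
  -- Outer reduction: the functional depending on U is one further coordinate, whence `|X| + 3`.
  obtain ⟨c, k, hc0, hc⟩ := exists_conic_combination (I := U) (E := (X → ℝ) × ℝ × ℝ × ℝ)
    (d := Fintype.card X + 3) (fun u => (∑ s, m u s, ∑ s, fA (m u s), ∑ s, fC (m u s),
      fC (∑ s, m u s))) (by simp [Module.finrank_prod])
  simp only [Prod.smul_mk, Prod.ext_iff, Prod.fst_sum, Prod.snd_sum, smul_eq_mul] at hd hc
  refine ⟨fun j l => c j • d (k j) l • m (k j) (idx (k j) l), fun j l x => ?_, ?_, ?_, ?_, ?_⟩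
  · exact mul_nonneg (hc0 _) (mul_nonneg (hd0 _ _) (hm _ _ _))
  · rw [← hc.1]
    exact sum_congr rfl fun j _ => by rw [← smul_sum, (hd _).1]
  · change ∑ j, ∑ l, fA _ = _
    rw [← hc.2.1]
    refine sum_congr rfl fun j _ => ?_
    simp only [hA, ← mul_sum]
    rw [(hd _).2.1]
  · change ∑ j, ∑ l, fC _ = _
    rw [← hc.2.2.1]
    refine sum_congr rfl fun j _ => ?_
    simp only [hC, ← mul_sum]
    rw [(hd _).2.2]
  · change ∑ j, fC _ = _
    rw [← hc.2.2.2]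
    refine sum_congr rfl fun j _ => ?_
    rw [← smul_sum, hC, (hd _).1]

end Reduction

/-! ### Bounded test channels and closedness of the single-letter region -/

section Closed

variable {X Y Z : Type*} [Fintype X] [Fintype Y] [Fintype Z]  {P : X × Y × Z → ℝ}

/-- The three rate expressions are attained by test channels with bounded alphabets. -/
theorem exists_bounded_channels {U S : Type*} [Fintype U] [Fintype S] [Nonempty U] [Nonempty S]
    (hP : P ∈ stdSimplex ℝ (X × Y × Z)) (m : U → S → X → ℝ)
    (hm0 : ∀ u s x, 0 ≤ m u s x) (hm : ∀ x, ∑ u, ∑ s, m u s x = law P (fun ω => ω.1) x) :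
    ∃ (PV : X → Fin ((Fintype.card X + 3) * (Fintype.card X + 2)) → ℝ)
      (PU : Fin ((Fintype.card X + 3) * (Fintype.card X + 2)) → Fin (Fintype.card X + 3) → ℝ),
      (∀ x, PV x ∈ stdSimplex ℝ _) ∧ (∀ v, PU v ∈ stdSimplex ℝ _) ∧
      nent (jointLaw P PV PU) (fun ω => (rvX ω, rvV ω)) -
        nent (jointLaw P PV PU) (fun ω => (rvY ω, rvV ω)) =
        ∑ u, ∑ s, (chanEnt idChan (m u s) - chanEnt (condLaw P (fun ω => ω.1) fun ω => ω.2.1) (m u s)) ∧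
      nent (jointLaw P PV PU) (fun ω => (rvY ω, rvU ω)) -
        nent (jointLaw P PV PU) (fun ω => (rvZ ω, rvU ω)) =
        ∑ u, (chanEnt (condLaw P (fun ω => ω.1) fun ω => ω.2.1) (∑ s, m u s) -
          chanEnt (condLaw P (fun ω => ω.1) fun ω => ω.2.2) (∑ s, m u s)) ∧
      nent (jointLaw P PV PU) (fun ω => (rvY ω, rvV ω)) -
        nent (jointLaw P PV PU) (fun ω => (rvZ ω, rvV ω)) =
        ∑ u, ∑ s, (chanEnt (condLaw P (fun ω => ω.1) fun ω => ω.2.1) (m u s) -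
          chanEnt (condLaw P (fun ω => ω.1) fun ω => ω.2.2) (m u s)) := by
  obtain ⟨m', hm0', hm', hA, hC, hB⟩ := exists_reduction idChan_mem
    (condLaw_mem hP (fun ω => ω.1) fun ω => ω.2.1) (condLaw_mem hP (fun ω => ω.1) fun ω => ω.2.2)
    m hm0
  -- The new V is the pair of labels `(u, s)`, which explains the product bound; U is then its first
  -- component, a deterministic function of V.
  set e := finProdFinEquiv (m := Fintype.card X + 3) (n := Fintype.card X + 2)
  have hsum : ∀ f : Fin (Fintype.card X + 3) → Fin (Fintype.card X + 2) → ℝ,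
      ∑ v, f (e.symm v).1 (e.symm v).2 = ∑ u, ∑ s, f u s := fun f => by
    rw [e.symm.sum_comp fun w => f w.1 w.2, Fintype.sum_prod_type]
  obtain ⟨PV, hV, hmul⟩ := exists_channel hP (fun v => m' (e.symm v).1 (e.symm v).2)
    (fun v x => hm0' _ _ _) (fun x => by
      rw [hsum fun u s => m' u s x, ← hm]
      have := congrFun hm' x
      simpa only [Finset.sum_apply] using this)
  set PU : Fin ((Fintype.card X + 3) * (Fintype.card X + 2)) → Fin (Fintype.card X + 3) → ℝ :=
    fun v u => if (e.symm v).1 = u then 1 else 0 with hPU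
  have hU : ∀ v, PU v ∈ stdSimplex ℝ (Fin (Fintype.card X + 3)) := fun v =>
    ⟨fun u => by simp only [hPU]; split_ifs <;> norm_num, by simp [hPU]⟩
  -- The conditional law of X given X differs from the identity channel only at null letters, where
  -- the measures in question vanish.
  have hid : ∀ (μ : X → ℝ), (∀ x, law P (fun ω => ω.1) x = 0 → μ x = 0) →
      chanEnt (condLaw P (fun ω => ω.1) fun ω => ω.1) μ = chanEnt idChan μ := fun μ h0 => by
    unfold chanEnt
    congr 1
    refine sum_congr rfl fun b _ => congrArg _ (sum_congr rfl fun x _ => ?_)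
    by_cases h : law P (fun ω => ω.1) x = 0
    · rw [h0 x h, zero_mul, zero_mul]
    · rw [condLaw, if_neg h, law_diag, mul_div_cancel_left₀ _ h]
  have hg : ∀ u, (fun x => ∑ v, law P (fun ω => ω.1) x * PV x v * PU v u) = ∑ s, m' u s :=
    fun u => by
      funext x
      simp only [hmul, hPU, mul_ite, mul_one, mul_zero]
      rw [hsum fun u' s => if u' = u then m' u' s x else 0, sum_eq_single u]
      · simp
      · intro u' _ h; simp [h]
      · simp
  have vX := nent_given_V (PV := PV) hP hU fun ω => ω.1
  have vY := nent_given_V (PV := PV) hP hU fun ω => ω.2.1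
  have vZ := nent_given_V (PV := PV) hP hU fun ω => ω.2.2
  have uY := nent_given_U (PV := PV) hP hU fun ω => ω.2.1
  have uZ := nent_given_U (PV := PV) hP hU fun ω => ω.2.2
  rw [sum_congr rfl fun v _ => hid _ fun x h => mul_eq_zero_of_left h _] at vX
  simp only [hmul] at vX
  simp only [hmul] at vY vZ
  simp only [hg] at uY uZ
  rw [hsum fun u s => chanEnt _ (m' u s)] at vX vY vZ
  change nent _ _ - _ = _ at vX vY vZ uY uZ
  refine ⟨PV, PU, hV, hU, ?_, ?_, ?_⟩
  · rw [← hA]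
    simp only [sum_sub_distrib]
    rw [← vX, ← vY]
    simp only [rvXYZ, rvX, rvY]
    ring
  · rw [← hB]
    simp only [sum_sub_distrib]
    rw [← uY, ← uZ]
    simp only [rvXYZ, rvY, rvZ]
    ring
  · rw [← hC]
    simp only [sum_sub_distrib]
    rw [← vY, ← vZ]
    simp only [rvXYZ, rvY, rvZ]
    ring

theorem continuous_entropy_jointLaw {V U A : Type*} [Fintype V] [Fintype U] [Fintype A]
    (f : X × Y × Z × V × U → A) :
    Continuous fun q : (X → V → ℝ) × (V → U → ℝ) => entropy (jointLaw P q.1 q.2) f := by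
  refine Continuous.div_const (continuous_finsetSum _ fun a _ =>
    Real.continuous_negMulLog.comp ?_) _
  simp only [law_eq]
  refine continuous_finsetSum _ fun ω _ => ?_
  split_ifs
  · simp only [jointLaw]; fun_prop
  · exact continuous_const

theorem isCompact_channels (V U X : Type*) [Fintype V] [Fintype U] :
    IsCompact {q : (X → V → ℝ) × (V → U → ℝ) |
      (∀ x, q.1 x ∈ stdSimplex ℝ V) ∧ ∀ v, q.2 v ∈ stdSimplex ℝ U} := by
  have h1 : IsCompact (Set.univ.pi fun _ : X => stdSimplex ℝ V) :=
    isCompact_univ_pi fun _ => isCompact_stdSimplex ℝ V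
  have h2 : IsCompact (Set.univ.pi fun _ : V => stdSimplex ℝ U) :=
    isCompact_univ_pi fun _ => isCompact_stdSimplex ℝ U
  convert h1.prod h2 using 1
  ext q
  simp [Set.mem_prod, Set.mem_pi]

/-- The single-letter region contains the limits of its approximate members. -/
theorem mem_singleLetterRegion_of_approx {R L Rs : ℝ} (hR : 0 ≤ R) (hL : 0 ≤ L) (hRs : 0 ≤ Rs)
    (h : ∀ ε : ℝ, 0 < ε → ∃ (PV : X → Fin ((Fintype.card X + 3) * (Fintype.card X + 2)) → ℝ)
      (PU : Fin ((Fintype.card X + 3) * (Fintype.card X + 2)) → Fin (Fintype.card X + 3) → ℝ),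
      (∀ x, PV x ∈ stdSimplex ℝ _) ∧ (∀ v, PU v ∈ stdSimplex ℝ _) ∧
        condMutualInfo (jointLaw P PV PU) rvX rvV rvY ≤ R + ε ∧
        mutualInfo (jointLaw P PV PU) rvX (fun ω => (rvV ω, rvY ω))
            - condMutualInfo (jointLaw P PV PU) rvX rvY rvU
            + condMutualInfo (jointLaw P PV PU) rvX rvZ rvU ≤ L + ε ∧
        Rs - ε ≤ condMutualInfo (jointLaw P PV PU) rvV rvY rvU
            - condMutualInfo (jointLaw P PV PU) rvV rvZ rvU) :
    (R, L, Rs) ∈ singleLetterRegion P := by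
  refine ⟨hR, hL, hRs, _, _, le_rfl, le_rfl, ?_⟩
  have hε : ∀ n : ℕ, (0 : ℝ) < 1 / ((n : ℝ) + 1) := fun n => Nat.one_div_pos_of_nat
  choose PV PU hV hU h1 h2 h3 using fun n : ℕ => h _ (hε n)
  obtain ⟨q, ⟨hqV, hqU⟩, φ, hφ, hlim⟩ := (isCompact_channels
    (Fin ((Fintype.card X + 3) * (Fintype.card X + 2))) (Fin (Fintype.card X + 3)) X).tendsto_subseq
    (x := fun n => (PV n, PU n)) fun n => ⟨hV n, hU n⟩
  have hε0 : Filter.Tendsto (fun n => 1 / (((φ n : ℕ) : ℝ) + 1)) Filter.atTop (nhds 0) :=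
    tendsto_one_div_add_atTop_nhds_zero_nat.comp hφ.tendsto_atTop
  refine ⟨q.1, q.2, hqV, hqU, ?_, ?_, ?_⟩
  · refine le_of_tendsto_of_tendsto (b := Filter.atTop) (((?_ : Continuous
      fun q : (X → _ → ℝ) × (_ → _ → ℝ) => condMutualInfo (jointLaw P q.1 q.2) rvX rvV rvY).tendsto
      q).comp hlim) (by simpa using hε0.const_add R) (Filter.Eventually.of_forall fun n => h1 (φ n))
    simp only [condMutualInfo]
    exact (((continuous_entropy_jointLaw _).add (continuous_entropy_jointLaw _)).sub
      (continuous_entropy_jointLaw _)).sub (continuous_entropy_jointLaw _)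
  · refine le_of_tendsto_of_tendsto (b := Filter.atTop) (((?_ : Continuous
      fun q : (X → _ → ℝ) × (_ → _ → ℝ) => mutualInfo (jointLaw P q.1 q.2) rvX
        (fun ω => (rvV ω, rvY ω)) - condMutualInfo (jointLaw P q.1 q.2) rvX rvY rvU
            + condMutualInfo (jointLaw P q.1 q.2) rvX rvZ rvU).tendsto
      q).comp hlim) (by simpa using hε0.const_add L) (Filter.Eventually.of_forall fun n => h2 (φ n))
    simp only [condMutualInfo, mutualInfo]
    exact ((((continuous_entropy_jointLaw _).add (continuous_entropy_jointLaw _)).sub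
      (continuous_entropy_jointLaw _)).sub
      ((((continuous_entropy_jointLaw _).add (continuous_entropy_jointLaw _)).sub
      (continuous_entropy_jointLaw _)).sub (continuous_entropy_jointLaw _))).add
      ((((continuous_entropy_jointLaw _).add (continuous_entropy_jointLaw _)).sub
      (continuous_entropy_jointLaw _)).sub (continuous_entropy_jointLaw _))
  · refine le_of_tendsto_of_tendsto (b := Filter.atTop) (by simpa using hε0.const_sub Rs)
      (((?_ : Continuous
      fun q : (X → _ → ℝ) × (_ → _ → ℝ) => condMutualInfo (jointLaw P q.1 q.2) rvV rvY rvU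
            - condMutualInfo (jointLaw P q.1 q.2) rvV rvZ rvU).tendsto
      q).comp hlim) (Filter.Eventually.of_forall fun n => h3 (φ n))
    simp only [condMutualInfo]
    exact ((((continuous_entropy_jointLaw _).add (continuous_entropy_jointLaw _)).sub
      (continuous_entropy_jointLaw _)).sub (continuous_entropy_jointLaw _)).sub
      ((((continuous_entropy_jointLaw _).add (continuous_entropy_jointLaw _)).sub
      (continuous_entropy_jointLaw _)).sub (continuous_entropy_jointLaw _))

end Closed

/-! ### Observations of parts of the sequences -/

section Observation

variable {X Y Z κ : Type*} [Fintype X] [Fintype Y] [Fintype Z] [Fintype κ]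
  {P : X × Y × Z → ℝ} {n : ℕ}

/-- The single-letter observation of `X`, `Y`, `Z` if `a`, `b`, `d` hold, respectively. -/
noncomputable def obs₁ (a b d : Prop) (ω : X × Y × Z) : Option X × Option Y × Option Z :=
  (if a then some ω.1 else none, if b then some ω.2.1 else none, if d then some ω.2.2 else none)

/-- The observation of the `X`, `Y`, `Z` coordinates selected by `a`, `b`, `d`. -/
noncomputable def obs (a b d : Fin n → Prop) (ω : Fin n → X × Y × Z) :
    Fin n → Option X × Option Y × Option Z := fun j => obs₁ (a j) (b j) (d j) (ω j)

theorem obs_eq_iff {a b d : Fin n → Prop} {ω ω' : Fin n → X × Y × Z} :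
    obs a b d ω = obs a b d ω' ↔ ∀ j, (a j → (ω j).1 = (ω' j).1) ∧
      (b j → (ω j).2.1 = (ω' j).2.1) ∧ (d j → (ω j).2.2 = (ω' j).2.2) := by
  simp only [funext_iff, obs, obs₁, Prod.mk.injEq]
  refine forall_congr' fun j => ?_
  by_cases h1 : a j <;> by_cases h2 : b j <;> by_cases h3 : d j <;> simp [h1, h2, h3]

theorem nent_obs (hP : P ∈ stdSimplex ℝ (X × Y × Z)) (a b d : Fin n → Prop) :
    nent (iidLaw P n) (obs a b d) = ∑ j, nent P (obs₁ (a j) (b j) (d j)) :=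
  nent_piLaw (fun _ => hP) fun j => obs₁ (a j) (b j) (d j)

theorem seqX_eq_iff {ω ω' : Fin n → X × Y × Z} :
    seqX ω = seqX ω' ↔ ∀ j, (ω j).1 = (ω' j).1 := funext_iff

theorem seqY_eq_iff {ω ω' : Fin n → X × Y × Z} :
    seqY ω = seqY ω' ↔ ∀ j, (ω j).2.1 = (ω' j).2.1 := funext_iff

theorem seqZ_eq_iff {ω ω' : Fin n → X × Y × Z} :
    seqZ ω = seqZ ω' ↔ ∀ j, (ω j).2.2 = (ω' j).2.2 := funext_iff

theorem iidLaw_mem (hP : P ∈ stdSimplex ℝ (X × Y × Z)) (n : ℕ) :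
    iidLaw P n ∈ stdSimplex ℝ (Fin n → X × Y × Z) := piLaw_mem fun _ => hP

/-- The past of `Z` and the future of `Y`. -/
noncomputable def pastFuture (i : Fin n) (ω : Fin n → X × Y × Z) :
    Fin n → Option X × Option Y × Option Z :=
  obs (fun _ => False) (fun j => i < j) (fun j => j < i) ω

theorem pastFuture_eq_iff {i : Fin n} {ω ω' : Fin n → X × Y × Z} :
    pastFuture i ω = pastFuture i ω' ↔ ∀ j, (i < j → (ω j).2.1 = (ω' j).2.1) ∧
      (j < i → (ω j).2.2 = (ω' j).2.2) := by
  simp [pastFuture, obs_eq_iff]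

/-- Csiszár's sum identity. -/
theorem csiszar_sum (hP : P ∈ stdSimplex ℝ (X × Y × Z)) (K : (Fin n → X × Y × Z) → κ) :
    ∑ i, (nent (iidLaw P n) (fun ω => ((ω i).2.1, K ω, pastFuture i ω)) -
      nent (iidLaw P n) (fun ω => ((ω i).2.2, K ω, pastFuture i ω))) =
      nent (iidLaw P n) (fun ω => (K ω, seqY ω)) - nent (iidLaw P n) (fun ω => (K ω, seqZ ω)) := by
  have hp := (iidLaw_mem hP n).1
  -- Interpolation between Yⁿ and Zⁿ: `F i` observes Z before position `i` and Y from `i` on.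
  -- Passing from `i` to `i + 1` exchanges Y for Z at one position, so the sum telescopes.
  set F : ℕ → ℝ := fun i => nent (iidLaw P n) (fun ω => (K ω,
    obs (fun _ => False) (fun j => i ≤ (j : ℕ)) (fun j => (j : ℕ) < i) ω)) with hF
  have h0 : F 0 = nent (iidLaw P n) (fun ω => (K ω, seqY ω)) :=
    nent_congr hp fun ω ω' => by
      simp [Prod.mk.injEq, obs_eq_iff, seqY_eq_iff]
  have h1 : F n = nent (iidLaw P n) (fun ω => (K ω, seqZ ω)) :=
    nent_congr hp fun ω ω' => by
      simp [Prod.mk.injEq, obs_eq_iff, seqZ_eq_iff]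
  have hi : ∀ i : Fin n, (nent (iidLaw P n) (fun ω => ((ω i).2.1, K ω, pastFuture i ω)) -
      nent (iidLaw P n) (fun ω => ((ω i).2.2, K ω, pastFuture i ω))) = F i - F (i + 1) := fun i => by
    congr 1
    · refine nent_congr hp fun ω ω' => ?_
      simp only [Prod.mk.injEq, obs_eq_iff, pastFuture_eq_iff, false_imp_iff, true_and, Fin.lt_def]
      constructor
      · rintro ⟨hK, h⟩
        exact ⟨(h i).1 le_rfl, hK, fun j => ⟨fun hj => (h j).1 hj.le, (h j).2⟩⟩
      · rintro ⟨hi, hK, h⟩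
        refine ⟨hK, fun j => ⟨fun hj => ?_, (h j).2⟩⟩
        rcases hj.eq_or_lt with hj | hj
        · rwa [← Fin.ext hj]
        · exact (h j).1 hj
    · refine nent_congr hp fun ω ω' => ?_
      simp only [Prod.mk.injEq, obs_eq_iff, pastFuture_eq_iff, false_imp_iff, true_and, Fin.lt_def]
      constructor
      · rintro ⟨hK, h⟩
        exact ⟨(h i).2 (Nat.lt_succ_self _), hK,
          fun j => ⟨fun hj => (h j).1 hj, fun hj => (h j).2 (hj.trans (Nat.lt_succ_self _))⟩⟩
      · rintro ⟨hi, hK, h⟩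
        refine ⟨hK, fun j => ⟨(h j).1, fun hj => ?_⟩⟩
        rcases (Nat.lt_succ_iff.1 hj).eq_or_lt with hj | hj
        · rwa [Fin.ext hj]
        · exact (h j).2 hj
  rw [sum_congr rfl fun i _ => hi i, Fin.sum_univ_eq_sum_range fun i => F i - F (i + 1),
    sum_range_sub', h0, h1]

theorem nent_single_letter (hP : P ∈ stdSimplex ℝ (X × Y × Z)) {A : Type*} [Fintype A] (i : Fin n)
    (f : X × Y × Z → A) : nent (iidLaw P n) (fun ω => f (ω i)) = nent P f := by
  have h : law (iidLaw P n) (fun ω => ω i) = P := by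
    funext a
    have := sum_piLaw_apply (p := fun _ : Fin n => P) (fun _ => hP) i fun a' => if a' = a then 1 else 0
    simp only [mul_ite, mul_one, mul_zero, sum_ite_eq', mem_univ, if_true] at this
    rw [law_eq, iidLaw_eq, ← this]
    refine sum_congr rfl fun ω _ => ?_
    by_cases h : ω i = a <;> simp [h]
  conv_rhs => rw [← h]
  rw [nent_law]

/-- The sum of the single-letter entropies of `X` given the auxiliary variables and `Y` is at least
the entropy of `Xⁿ` given `K` and `Yⁿ`. -/
theorem sum_nent_ge (hP : P ∈ stdSimplex ℝ (X × Y × Z)) (K : (Fin n → X × Y × Z) → κ)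
    (hK : ∀ ω ω', (∀ j, (ω j).1 = (ω' j).1) → K ω = K ω') :
    n * nent P (fun ω => ω.1) - nent (iidLaw P n) (fun ω => (K ω, seqY ω)) ≤
      ∑ i, (nent (iidLaw P n) (fun ω => ((ω i).1, K ω, pastFuture i ω)) -
        nent (iidLaw P n) (fun ω => ((ω i).2.1, K ω, pastFuture i ω))) := by
  have hp := (iidLaw_mem hP n).1
  set F : ℕ → ℝ := fun i => nent (iidLaw P n) (fun ω => (K ω,
    obs (fun j => (j : ℕ) < i) (fun _ => True) (fun _ => False) ω)) with hF
  have h0 : F 0 = nent (iidLaw P n) (fun ω => (K ω, seqY ω)) :=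
    nent_congr hp fun ω ω' => by
      simp [Prod.mk.injEq, obs_eq_iff, seqY_eq_iff]
  have h1 : F n = n * nent P (fun ω => (ω.1, ω.2.1)) := by
    have e1 : F n = nent (iidLaw P n) (fun ω j => ((ω j).1, (ω j).2.1)) :=
      nent_congr hp fun ω ω' => by
        rw [funext_iff, Prod.mk.injEq, obs_eq_iff]
        simp only [Prod.mk.injEq, Fin.is_lt, true_imp_iff, false_imp_iff, and_true]
        exact ⟨fun h => ⟨hK _ _ fun j => (h j).1, h⟩, fun h => h.2⟩
    rw [e1]
    refine (nent_piLaw (fun _ => hP) fun _ ω => (ω.1, ω.2.1)).trans ?_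
    simp
  -- The increment is H(X_i | K, X before i, Yⁿ). It is bounded by H(X_i | Y_i, K, Z before i, Y
  -- after i), expressed through joint entropies.
  have hi : ∀ i : Fin n, F (i + 1) - F i ≤
      nent (iidLaw P n) (fun ω => ((ω i).1, K ω, pastFuture i ω)) -
        nent (iidLaw P n) (fun ω => ((ω i).2.1, K ω, pastFuture i ω)) +
        (nent P (fun ω => (ω.1, ω.2.1)) - nent P (fun ω => ω.1)) := fun i => by
    set ge : Fin n → Prop := fun j => i ≤ j with hge
    set le : Fin n → Prop := fun j => j ≤ i with hle
    set lt : Fin n → Prop := fun j => j < i with hlt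
    set tt : Fin n → Prop := fun _ => True with htt
    set ff : Fin n → Prop := fun _ => False with hff
    have hlele : ∀ j, lt j → le j := fun j h => le_of_lt h
    have e1 : F i = nent (iidLaw P n) (fun ω => (K ω, obs lt tt ff ω)) := rfl
    have e2 : F (i + 1) = nent (iidLaw P n) (fun ω => (K ω, obs le tt ff ω)) :=
      nent_congr hp fun ω ω' => by
        simp only [Prod.mk.injEq, obs_eq_iff, htt, hff, hle, Fin.le_def, Nat.lt_succ_iff]
    -- Y before `i` is dropped from the conditioning.
    have s1 := nent_submod hp (j := fun ω => (K ω, obs le tt ff ω))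
      (m := fun ω => (K ω, obs lt ge ff ω)) (a := fun ω => (K ω, obs lt tt ff ω))
      (b := fun ω => (K ω, obs le ge ff ω))
      (by simp only [Prod.mk.injEq, obs_eq_iff]; grind)
      (by simp only [Prod.mk.injEq, obs_eq_iff]; grind)
      (by simp only [Prod.mk.injEq, obs_eq_iff]; grind)
    -- The next three inequalities insert Z before `i` into the conditioning. This Z depends on all
    -- that is observed only through X before `i`, since `K` is a function of Xⁿ; `s2` and `s3`
    -- bound its conditional entropy in the two terms, and memorylessness (`s4`) equates the bounds.
    have s2 := nent_submod hp (j := fun ω => obs tt ge lt ω)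
      (m := fun ω => (K ω, obs le ge ff ω)) (a := fun ω => obs tt ge ff ω)
      (b := fun ω => (K ω, obs le ge lt ω))
      (by simp only [Prod.mk.injEq, obs_eq_iff]; grind)
      (by simp only [Prod.mk.injEq, obs_eq_iff]; grind)
      (by simp only [Prod.mk.injEq, obs_eq_iff]; grind)
    have s3 := nent_submod hp (j := fun ω => (K ω, obs lt ge lt ω))
      (m := fun ω => obs lt ff ff ω) (a := fun ω => obs lt ff lt ω)
      (b := fun ω => (K ω, obs lt ge ff ω))
      (by simp only [Prod.mk.injEq, obs_eq_iff]; grind)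
      (by simp only [obs_eq_iff]; grind)
      (by simp only [Prod.mk.injEq, obs_eq_iff]; grind)
    have s4 : nent (iidLaw P n) (obs tt ge lt) + nent (iidLaw P n) (obs lt ff ff) =
        nent (iidLaw P n) (obs tt ge ff) + nent (iidLaw P n) (obs lt ff lt) := by
      simp only [nent_obs hP, ← sum_add_distrib]
      refine sum_congr rfl fun j _ => ?_
      by_cases h : j < i
      · have h' : ¬ i ≤ j := not_le.2 h
        simp only [hge, hlt, htt, hff, h, h', add_comm]
      · have h' : i ≤ j := not_lt.1 h
        simp only [hge, hlt, htt, hff, h, h']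
    -- X before `i` is dropped, leaving exactly Y_i and the auxiliary variables as conditioning.
    have s5 := nent_submod hp (j := fun ω => (K ω, obs le ge lt ω))
      (m := fun ω => ((ω i).2.1, K ω, pastFuture i ω)) (a := fun ω => (K ω, obs lt ge lt ω))
      (b := fun ω => ((ω i).1, (ω i).2.1, K ω, pastFuture i ω))
      (by
        simp only [Prod.mk.injEq, obs_eq_iff, pastFuture_eq_iff]
        rintro ω ω' ⟨hk, h⟩ ⟨hx, hy, -, h'⟩
        refine ⟨hk, fun j => ⟨fun hj => ?_, (h j).2⟩⟩
        rcases hj.eq_or_lt with hj | hj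
        · rw [hj]; exact hx
        · exact (h j).1 hj)
      (by
        simp only [Prod.mk.injEq, obs_eq_iff, pastFuture_eq_iff]
        rintro ω ω' ⟨hk, h⟩
        exact ⟨(h i).2.1 le_rfl, hk, fun j => ⟨fun hj => (h j).2.1 hj.le, (h j).2.2⟩⟩)
      (by simp only [Prod.mk.injEq]; tauto)
    -- Conditioning Y_i on X_i alone gives an upper bound; in the sum this becomes n H(Y|X).
    have s6 := nent_submod hp (j := fun ω => ((ω i).1, (ω i).2.1, K ω, pastFuture i ω))
      (m := fun ω => (ω i).1) (a := fun ω => ((ω i).1, K ω, pastFuture i ω))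
      (b := fun ω => ((ω i).1, (ω i).2.1))
      (by simp only [Prod.mk.injEq]; tauto) (by simp only [Prod.mk.injEq]; tauto)
      (by simp only [Prod.mk.injEq]; tauto)
    rw [nent_single_letter hP i (fun ω => ω.1), nent_single_letter hP i (fun ω => (ω.1, ω.2.1))] at s6
    rw [e1, e2]
    linarith
  have hsum := sum_le_sum fun i (_ : i ∈ (univ : Finset (Fin n))) => hi i
  rw [Fin.sum_univ_eq_sum_range fun i => F (i + 1) - F i, sum_range_sub, h0, h1, sum_add_distrib,
    sum_const, card_univ, Fintype.card_fin, nsmul_eq_mul] at hsum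
  linarith

end Observation

/-! ### Resampling one coordinate -/

section Resample

variable {ι Ω A B C : Type*} [Fintype ι] [DecidableEq ι] [Fintype Ω] [Fintype A] [Fintype B] [Fintype C]

/-- Independence makes an independent redraw of one coordinate invisible in mean. This reduces
conditional independence at time `i` to a statement about a single letter. -/
theorem sum_piLaw_resample {p : ι → Ω → ℝ} (hp : ∀ i, p i ∈ stdSimplex ℝ Ω) (i : ι)
    (F : (ι → Ω) → ℝ) :
    ∑ ω, piLaw p ω * F ω = ∑ ω, piLaw p ω * ∑ a, p i a * F (Function.update ω i a) := by
  set e := (Equiv.piSplitAt i fun _ : ι => Ω).symm with he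
  have hup : ∀ (a b : Ω) r, Function.update (e (a, r)) i b = e (b, r) := fun a b r => by
    funext j
    by_cases h : j = i
    · subst h; simp [he]
    · simp [he, h]
  have hpi : ∀ (a : Ω) r, piLaw p (e (a, r)) = p i a * ∏ j : {j // j ≠ i}, p j (r j) :=
    fun a r => by
      rw [piLaw, Fintype.prod_eq_mul_prod_subtype_ne _ i]
      congr 1
      · simp [he]
      · refine prod_congr rfl fun j _ => ?_
        simp [he, j.2]
  rw [← e.sum_comp, ← e.sum_comp, Fintype.sum_prod_type_right, Fintype.sum_prod_type_right]
  refine sum_congr rfl fun r _ => ?_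
  simp only [hup, hpi]
  rw [← sum_mul, ← sum_mul, (hp i).2, one_mul, mul_sum]
  exact sum_congr rfl fun a _ => by ring

/-- If `V` depends on the `i`-th coordinate only through `a`, then `V` and `b` are conditionally
independent given `a`. -/
theorem law_markov {p : Ω → ℝ} (hp : p ∈ stdSimplex ℝ Ω) (i : ι) (a : Ω → A) (b : Ω → B)
    (V : (ι → Ω) → C) (hV : ∀ ω α, a α = a (ω i) → V (Function.update ω i α) = V ω) (β : B) (ν : C) :
    law (piLaw fun _ : ι => p) (fun ω => (b (ω i), V ω)) (β, ν) =
      ∑ α, law (piLaw fun _ : ι => p) (fun ω => (a (ω i), V ω)) (α, ν) * condLaw p a b α β := by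
  have h1 := sum_law_mul (piLaw fun _ : ι => p) (fun ω => (a (ω i), V ω))
    (fun c => if c.2 = ν then condLaw p a b c.1 β else 0)
  rw [Fintype.sum_prod_type] at h1
  simp only [mul_ite, mul_zero, sum_ite_eq', mem_univ, if_true] at h1
  rw [h1]
  have h2 : law (piLaw fun _ : ι => p) (fun ω => (b (ω i), V ω)) (β, ν) =
      ∑ ω, piLaw (fun _ : ι => p) ω * (if V ω = ν then if b (ω i) = β then 1 else 0 else 0) := by
    rw [law_eq]
    refine sum_congr rfl fun ω _ => ?_
    by_cases h : V ω = ν <;> by_cases h' : b (ω i) = β <;> simp [h, h']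
  have h3 : ∑ ω, (if V ω = ν then piLaw (fun _ : ι => p) ω * condLaw p a b (a (ω i)) β else 0) =
      ∑ ω, piLaw (fun _ : ι => p) ω * (if V ω = ν then condLaw p a b (a (ω i)) β else 0) := by
    simp
  rw [h2, h3]
  conv_lhs => rw [sum_piLaw_resample (fun _ => hp) i]
  conv_rhs => rw [sum_piLaw_resample (fun _ => hp) i]
  refine sum_congr rfl fun ω _ => congrArg _ ?_
  simp only [Function.update_self]
  have hdep : ∀ α α', a α = a α' → V (Function.update ω i α) = V (Function.update ω i α') :=
    fun α α' h => by
      have := hV (Function.update ω i α') α (by simpa using h)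
      simpa using this
  -- With the other coordinates frozen, the event `V = ν` depends on the redrawn letter only through
  -- `a`; both sides become single-letter expectations weighted by `φ (a ·)`.
  obtain ⟨φ, hφ⟩ : ∃ φ : A → ℝ, ∀ α, (if V (Function.update ω i α) = ν then (1 : ℝ) else 0) =
      φ (a α) := ⟨fun x => if h : ∃ α, a α = x then
        (if V (Function.update ω i h.choose) = ν then 1 else 0) else 0, fun α => by
      have h : ∃ α', a α' = a α := ⟨α, rfl⟩
      simp only [h, dite_true]
      rw [hdep _ _ h.choose_spec]⟩
  have e1 : ∀ α, (p α * if V (Function.update ω i α) = ν then if b α = β then 1 else 0 else 0) =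
      p α * (φ (a α) * if b α = β then 1 else 0) := fun α => by
    rw [← hφ]; by_cases h : V (Function.update ω i α) = ν <;> simp [h]
  have e2 : ∀ α, (p α * if V (Function.update ω i α) = ν then condLaw p a b (a α) β else 0) =
      p α * (φ (a α) * condLaw p a b (a α) β) := fun α => by
    rw [← hφ]; by_cases h : V (Function.update ω i α) = ν <;> simp [h]
  rw [sum_congr rfl fun α _ => e1 α, sum_congr rfl fun α _ => e2 α,
    ← sum_law_mul p a fun x => φ x * condLaw p a b x β,
    ← sum_law_mul p (fun α => (a α, b α)) fun x => φ x.1 * if x.2 = β then 1 else 0,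
    Fintype.sum_prod_type]
  refine sum_congr rfl fun x _ => ?_
  simp only [mul_ite, mul_one, mul_zero, sum_ite_eq', mem_univ, if_true]
  rw [← law_mul_condLaw hp]
  ring

end Resample

/-! ### Converse -/

section Converse

variable {X Y Z : Type*} [Fintype X] [Fintype Y] [Fintype Z] {P : X × Y × Z → ℝ} {n : ℕ}

theorem pastFuture_update (i : Fin n) (ω : Fin n → X × Y × Z) (a : X × Y × Z) :
    pastFuture i (Function.update ω i a) = pastFuture i ω := by
  rw [pastFuture_eq_iff]
  intro j
  constructor
  · intro hj; rw [Function.update_of_ne hj.ne']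
  · intro hj; rw [Function.update_of_ne hj.ne]

/-- The past and future variables do not involve coordinate `i`, and `K` sees it only through X, so
the auxiliary variables, X_i and the remaining letters form a Markov chain. -/
theorem nent_eq_chanEnt_iid (hP : P ∈ stdSimplex ℝ (X × Y × Z)) {κ B : Type*} [Fintype κ]
    [Fintype B] (K : (Fin n → X × Y × Z) → κ) (hK : ∀ ω ω', (∀ j, (ω j).1 = (ω' j).1) → K ω = K ω')
    (b : X × Y × Z → B) (i : Fin n) :
    nent (iidLaw P n) (fun ω => (b (ω i), K ω, pastFuture i ω)) -
        nent (iidLaw P n) (fun ω => (K ω, pastFuture i ω)) =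
      ∑ ν, chanEnt (condLaw P (fun ω => ω.1) b)
        (fun x => law (iidLaw P n) (fun ω => ((ω i).1, K ω, pastFuture i ω)) (x, ν)) := by
  refine nent_sub_nent_eq_chanEnt fun β ν => ?_
  refine law_markov hP i (fun ω => ω.1) b (fun ω => (K ω, pastFuture i ω)) (fun ω α hα => ?_) β ν
  rw [pastFuture_update, hK (Function.update ω i α) ω]
  intro j
  by_cases h : j = i
  · subst h; simpa using hα
  · rw [Function.update_of_ne h]

theorem chanEnt_congr_condLaw_self (μ : X → ℝ)
    (h0 : ∀ x, law P (fun ω => ω.1) x = 0 → μ x = 0) :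
    chanEnt (condLaw P (fun ω => ω.1) fun ω => ω.1) μ = chanEnt idChan μ := by
  unfold chanEnt
  congr 1
  refine sum_congr rfl fun b _ => congrArg _ (sum_congr rfl fun x _ => ?_)
  by_cases h : law P (fun ω => ω.1) x = 0
  · rw [h0 x h, zero_mul, zero_mul]
  · rw [condLaw, if_neg h, law_diag, mul_div_cancel_left₀ _ h]

section Aux

variable {A B B' : Type*} [Fintype A] [Fintype B] [Fintype B']

/-- The (unnormalised) laws of `X` given the auxiliary variables of the converse. -/
noncomputable def auxMeasure (P : X × Y × Z → ℝ) (M : (Fin n → X × Y × Z) → A)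
    (S : (Fin n → X × Y × Z) → B) (u : Fin n × A × (Fin n → Option X × Option Y × Option Z))
    (s : B) : X → ℝ := (n : ℝ)⁻¹ • fun x => law (iidLaw P n)
      (fun ω => ((ω u.1).1, (S ω, M ω), pastFuture u.1 ω)) (x, (s, u.2.1), u.2.2)

variable {M : (Fin n → X × Y × Z) → A} {S : (Fin n → X × Y × Z) → B}

theorem sum_auxMeasure (u : Fin n × A × (Fin n → Option X × Option Y × Option Z)) :
    ∑ s, auxMeasure P M S u s = (n : ℝ)⁻¹ • fun x => law (iidLaw P n)
      (fun ω => ((ω u.1).1, M ω, pastFuture u.1 ω)) (x, u.2.1, u.2.2) := by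
  simp only [auxMeasure, ← smul_sum]
  congr 1
  funext x
  rw [Finset.sum_apply]
  simp only [law_eq]
  rw [sum_comm]
  refine sum_congr rfl fun ω _ => ?_
  by_cases h : ((ω u.1).1, M ω, pastFuture u.1 ω) = (x, u.2.1, u.2.2)
  · simp only [Prod.mk.injEq] at h
    simp [h.1, h.2.1, h.2.2]
  · rw [if_neg h]
    refine sum_eq_zero fun s _ => if_neg fun h' => h ?_
    simp only [Prod.mk.injEq] at h' ⊢
    exact ⟨h'.1, h'.2.1.2, h'.2.2⟩

/-- The time index is a component of `u`, and homogeneity extracts its probability `1 / n`; what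
remains is the average over time of conditional entropies. -/
theorem sum_chanEnt_auxMeasure (hP : P ∈ stdSimplex ℝ (X × Y × Z))
    (hM : ∀ ω ω', (∀ j, (ω j).1 = (ω' j).1) → M ω = M ω')
    (hS : ∀ ω ω', (∀ j, (ω j).1 = (ω' j).1) → S ω = S ω') (b : X × Y × Z → B') :
    ∑ u, ∑ s, chanEnt (condLaw P (fun ω => ω.1) b) (auxMeasure P M S u s) =
      (n : ℝ)⁻¹ * ∑ i : Fin n,
        (nent (iidLaw P n) (fun ω => (b (ω i), (S ω, M ω), pastFuture i ω)) -
        nent (iidLaw P n) (fun ω => ((S ω, M ω), pastFuture i ω))) := by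
  have hKS : ∀ ω ω' : Fin n → X × Y × Z, (∀ j, (ω j).1 = (ω' j).1) →
      (S ω, M ω) = (S ω', M ω') := fun ω ω' h => by rw [hM _ _ h, hS _ _ h]
  simp only [auxMeasure, chanEnt_smul (condLaw_mem hP _ _), ← mul_sum]
  rw [Fintype.sum_prod_type]
  refine congrArg _ (sum_congr rfl fun i _ => ?_)
  rw [nent_eq_chanEnt_iid hP (fun ω => (S ω, M ω)) hKS b i]
  simp only [Fintype.sum_prod_type]
  rw [sum_comm]
  conv_rhs => rw [sum_comm]; enter [2, a]; rw [sum_comm]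
  rw [sum_comm]

theorem sum_chanEnt_sum_auxMeasure (hP : P ∈ stdSimplex ℝ (X × Y × Z))
    (hM : ∀ ω ω', (∀ j, (ω j).1 = (ω' j).1) → M ω = M ω') (b : X × Y × Z → B') :
    ∑ u, chanEnt (condLaw P (fun ω => ω.1) b) (∑ s, auxMeasure P M S u s) =
      (n : ℝ)⁻¹ * ∑ i : Fin n,
        (nent (iidLaw P n) (fun ω => (b (ω i), M ω, pastFuture i ω)) -
        nent (iidLaw P n) (fun ω => (M ω, pastFuture i ω))) := by
  simp only [sum_auxMeasure, chanEnt_smul (condLaw_mem hP _ _), ← mul_sum]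
  rw [Fintype.sum_prod_type]
  exact congrArg _ (sum_congr rfl fun i _ => (nent_eq_chanEnt_iid hP M hM b i).symm)

end Aux

/-- The single-letter functionals of the auxiliary variables of the converse. -/
theorem exists_channels_of_code (hP : P ∈ stdSimplex ℝ (X × Y × Z)) (hn : 0 < n)
    {A B : Type*} [Fintype A] [Fintype B] [Nonempty A] [Nonempty B] (M : (Fin n → X × Y × Z) → A)
    (S : (Fin n → X × Y × Z) → B) (hM : ∀ ω ω', (∀ j, (ω j).1 = (ω' j).1) → M ω = M ω')
    (hS : ∀ ω ω', (∀ j, (ω j).1 = (ω' j).1) → S ω = S ω') :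
    ∃ (PV : X → Fin ((Fintype.card X + 3) * (Fintype.card X + 2)) → ℝ)
      (PU : Fin ((Fintype.card X + 3) * (Fintype.card X + 2)) → Fin (Fintype.card X + 3) → ℝ),
      (∀ x, PV x ∈ stdSimplex ℝ _) ∧ (∀ v, PU v ∈ stdSimplex ℝ _) ∧
      n * (nent (jointLaw P PV PU) (fun ω => (rvX ω, rvV ω)) -
        nent (jointLaw P PV PU) (fun ω => (rvY ω, rvV ω))) ≥
        n * nent P (fun ω => ω.1) - nent (iidLaw P n) (fun ω => ((S ω, M ω), seqY ω)) ∧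
      n * (nent (jointLaw P PV PU) (fun ω => (rvY ω, rvU ω)) -
        nent (jointLaw P PV PU) (fun ω => (rvZ ω, rvU ω))) =
        nent (iidLaw P n) (fun ω => (M ω, seqY ω)) - nent (iidLaw P n) (fun ω => (M ω, seqZ ω)) ∧
      n * (nent (jointLaw P PV PU) (fun ω => (rvY ω, rvV ω)) -
        nent (jointLaw P PV PU) (fun ω => (rvZ ω, rvV ω))) =
        nent (iidLaw P n) (fun ω => ((S ω, M ω), seqY ω)) -
          nent (iidLaw P n) (fun ω => ((S ω, M ω), seqZ ω)) := by
  have hp := iidLaw_mem hP n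
  have hn' : (n : ℝ) ≠ 0 := by positivity
  have hne : Nonempty (X × Y × Z) := by
    by_contra h
    rw [not_nonempty_iff] at h
    have := hP.2
    simp at this
  have : Nonempty (Fin n) := ⟨⟨0, hn⟩⟩
  have hlawx : ∀ (i : Fin n) x, law (iidLaw P n) (fun ω => (ω i).1) x = law P (fun ω => ω.1) x :=
    fun i x => by
      have := sum_piLaw_apply (p := fun _ : Fin n => P) (fun _ => hP) i
        fun a => if a.1 = x then 1 else 0
      simpa [law_eq, iidLaw_eq] using this
  have hKS : ∀ ω ω' : Fin n → X × Y × Z, (∀ j, (ω j).1 = (ω' j).1) →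
      (S ω, M ω) = (S ω', M ω') := fun ω ω' h => by rw [hM _ _ h, hS _ _ h]
  obtain ⟨x0, y0, z0⟩ := hne.some
  have : Nonempty (Fin n × A × (Fin n → Option X × Option Y × Option Z)) :=
    ⟨⟨⟨0, hn⟩, Classical.arbitrary A, fun _ => (none, none, none)⟩⟩
  obtain ⟨PV, PU, hV, hU, hA, hB, hC⟩ := exists_bounded_channels hP (auxMeasure P M S)
    (fun u s x => mul_nonneg (by positivity) (law_nonneg hp.1 _ _)) (fun x => by
      have h1 : ∀ u, ∑ s, auxMeasure P M S u s x = (n : ℝ)⁻¹ * law (iidLaw P n)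
          (fun ω => ((ω u.1).1, M ω, pastFuture u.1 ω)) (x, u.2.1, u.2.2) := fun u => by
        have := congrFun (sum_auxMeasure (P := P) (M := M) (S := S) u) x
        rwa [Finset.sum_apply] at this
      rw [sum_congr rfl fun u _ => h1 u, Fintype.sum_prod_type]
      have h2 : ∀ i : Fin n, ∑ y : A × (Fin n → Option X × Option Y × Option Z), (n : ℝ)⁻¹ *
          law (iidLaw P n) (fun ω => ((ω i).1, M ω, pastFuture i ω)) (x, y.1, y.2) =
          (n : ℝ)⁻¹ * law P (fun ω => ω.1) x := fun i => by
        rw [← mul_sum]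
        refine congrArg _ ((sum_law_pair_right (iidLaw P n) (fun ω => (ω i).1)
          (fun ω => (M ω, pastFuture i ω)) x).trans (hlawx i x))
      rw [sum_congr rfl fun i _ => h2 i, sum_const, card_univ, Fintype.card_fin, nsmul_eq_mul,
        mul_inv_cancel_left₀ hn'])
  have kX := sum_chanEnt_auxMeasure (M := M) (S := S) hP hM hS (fun ω => ω.1)
  have kY := sum_chanEnt_auxMeasure (M := M) (S := S) hP hM hS (fun ω => ω.2.1)
  have kZ := sum_chanEnt_auxMeasure (M := M) (S := S) hP hM hS (fun ω => ω.2.2)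
  have uY := sum_chanEnt_sum_auxMeasure (M := M) (S := S) hP hM (fun ω => ω.2.1)
  have uZ := sum_chanEnt_sum_auxMeasure (M := M) (S := S) hP hM (fun ω => ω.2.2)
  have hid : ∀ u s, chanEnt (condLaw P (fun ω => ω.1) fun ω => ω.1) (auxMeasure P M S u s) =
      chanEnt idChan (auxMeasure P M S u s) := fun u s => by
    refine chanEnt_congr_condLaw_self _ fun x hx => mul_eq_zero_of_right _ ?_
    refine le_antisymm ?_ (law_nonneg hp.1 _ _)
    rw [← hx, ← hlawx u.1]
    exact prob_mono hp.1 fun ω _ h => congrArg Prod.fst h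
  simp only [hid] at kX
  simp only [sum_sub_distrib] at hA hB hC kX kY kZ uY uZ
  rw [kX, kY] at hA
  rw [uY, uZ] at hB
  rw [kY, kZ] at hC
  -- Only the difference between X and Y given V is estimated; the differences between Y and Z are
  -- exact by Csiszár's identity.
  have c1 := sum_nent_ge hP (fun ω => (S ω, M ω)) hKS
  have c2 := csiszar_sum hP M
  have c3 := csiszar_sum hP (fun ω => (S ω, M ω))
  simp only [sum_sub_distrib] at c1 c2 c3
  refine ⟨PV, PU, hV, hU, ?_, ?_, ?_⟩
  · rw [hA, ← mul_sub, mul_inv_cancel_left₀ hn']; linarith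
  · rw [hB, ← mul_sub, mul_inv_cancel_left₀ hn']; linarith
  · rw [hC, ← mul_sub, mul_inv_cancel_left₀ hn']; linarith

/-- For each ε, a single sufficiently long code with small enough δ yields test channels satisfying
the bounds up to ε, and closedness of the region finishes. -/
theorem keyRateRegion_subset (hP : P ∈ stdSimplex ℝ (X × Y × Z)) :
    keyRateRegion P ⊆ singleLetterRegion P := by
  rintro ⟨R, L, Rs⟩ ⟨hR, hL, hRs, h⟩
  refine mem_singleLetterRegion_of_approx hR hL hRs fun ε hε => ?_
  have hl2 : 0 < Real.log 2 := Real.log_pos one_lt_two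
  obtain ⟨x0, -, -⟩ : Nonempty (X × Y × Z) := by
    by_contra h
    rw [not_nonempty_iff] at h
    have := hP.2
    simp at this
  have hcX : (1 : ℝ) ≤ Fintype.card X := by
    exact_mod_cast Fintype.card_pos_iff.2 ⟨x0⟩
  set lX := Real.log (Fintype.card X) / Real.log 2 with hlX
  have hlX0 : 0 ≤ lX := div_nonneg (Real.log_nonneg hcX) hl2.le
  -- Half of ε pays for the slacks, two of them directly and `lX` per unit of δ through Fano; the
  -- other half pays for Fano's additive bit.
  set δ := ε / (2 * (2 + lX)) with hδ
  have hδ0 : 0 < δ := by positivity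
  obtain ⟨n, ⟨c, hc⟩, hn⟩ := ((h δ hδ0).and
    (Filter.eventually_ge_atTop (⌈2 / ε⌉₊ + 1))).exists
  have hn0 : 0 < n := by omega
  have hn1 : (0 : ℝ) < n := by exact_mod_cast hn0
  have hnε : 1 / (n : ℝ) ≤ ε / 2 := by
    have : 2 / ε ≤ n := (Nat.le_ceil _).trans (by exact_mod_cast (by omega : ⌈2 / ε⌉₊ ≤ n))
    rw [div_le_iff₀ hε] at this
    rw [div_le_div_iff₀ hn1 two_pos]
    linarith
  have hδε : δ * (2 + lX) = ε / 2 := by rw [hδ]; field_simp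
  have hp := iidLaw_mem hP n
  have : Nonempty (Fin c.numM) := ⟨c.encM fun _ => x0⟩
  have : Nonempty (Fin c.numS) := ⟨c.encS fun _ => x0⟩
  have hM : ∀ ω ω' : Fin n → X × Y × Z, (∀ j, (ω j).1 = (ω' j).1) → c.descr ω = c.descr ω' :=
    fun ω ω' h => by rw [Code.descr, Code.descr, seqX_eq_iff.2 h]
  have hS : ∀ ω ω' : Fin n → X × Y × Z, (∀ j, (ω j).1 = (ω' j).1) → c.key ω = c.key ω' :=
    fun ω ω' h => by rw [Code.key, Code.key, seqX_eq_iff.2 h]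
  obtain ⟨PV, PU, hV, hU, hA, hB, hC⟩ := exists_channels_of_code hP hn0 c.descr c.key hM hS
  obtain ⟨r1, r2, r3⟩ := single_letter_rates hP hV hU
  refine ⟨PV, PU, hV, hU, ?_⟩
  rw [r1, r2, r3]
  have hfano : nent (iidLaw P n) (fun ω => ((c.key ω, c.descr ω), seqY ω)) -
      nent (iidLaw P n) (fun ω => (c.descr ω, seqY ω)) ≤
        Real.log 2 + δ * (n * Real.log (Fintype.card X)) := by
    have e1 : nent (iidLaw P n) (fun ω => ((c.key ω, c.descr ω), seqY ω)) =
        nent (iidLaw P n) (fun ω => (c.key ω, c.descr ω, seqY ω)) :=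
      nent_congr hp.1 fun ω ω' => by simp only [Prod.mk.injEq]; tauto
    rw [e1]
    -- The definition of a code does not bound `numS`, so Fano is applied on the range of the key
    -- encoder, which has at most `|X| ^ n` elements.
    refine (nent_fano hp c.key (fun ω => (c.descr ω, seqY ω)) c.dec (univ.image c.encS)
      fun ω => mem_image_of_mem _ (mem_univ _)).trans ?_
    have hcard : ((univ.image c.encS).card : ℝ) ≤ (Fintype.card X : ℝ) ^ n := by
      have := card_image_le (s := univ) (f := c.encS)
      rw [card_univ, Fintype.card_fun, Fintype.card_fin] at this
      exact_mod_cast this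
    have hpos : (1 : ℝ) ≤ ((univ.image c.encS).card : ℝ) := by
      exact_mod_cast card_pos.2 ⟨_, mem_image_of_mem _ (mem_univ fun _ => x0)⟩
    have hlog : Real.log ((univ.image c.encS).card : ℝ) ≤ n * Real.log (Fintype.card X) := by
      rw [← Real.log_pow]; exact Real.log_le_log (by linarith) hcard
    gcongr
    exact hc.falseRejection
  have hHY : nent (iidLaw P n) seqY = n * nent P (fun ω => ω.2.1) := by
    refine (nent_piLaw (fun _ : Fin n => hP) fun _ ω => ω.2.1).trans ?_
    simp
  have hHX : nent (iidLaw P n) seqX = n * nent P (fun ω => ω.1) := by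
    refine (nent_piLaw (fun _ : Fin n => hP) fun _ ω => ω.1).trans ?_
    simp
  have hHXZ : nent (iidLaw P n) (fun ω => (seqX ω, c.descr ω, seqZ ω)) =
      n * nent P (fun ω => (ω.1, ω.2.2)) := by
    have e1 : nent (iidLaw P n) (fun ω => (seqX ω, c.descr ω, seqZ ω)) =
        nent (iidLaw P n) (fun ω j => ((ω j).1, (ω j).2.2)) :=
      nent_congr hp.1 fun ω ω' => by
        rw [funext_iff, Prod.mk.injEq, Prod.mk.injEq, seqX_eq_iff, seqZ_eq_iff]
        simp only [Prod.mk.injEq]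
        exact ⟨fun h => ⟨fun j => (h j).1, hM _ _ fun j => (h j).1, fun j => (h j).2⟩,
          fun h j => ⟨h.1 j, h.2.2 j⟩⟩
    rw [e1]
    refine (nent_piLaw (fun _ : Fin n => hP) fun _ ω => (ω.1, ω.2.2)).trans ?_
    simp
  have hMY : nent (iidLaw P n) (fun ω => (c.descr ω, seqY ω)) ≤
      nent (iidLaw P n) c.descr + nent (iidLaw P n) seqY :=
    nent_subadd hp (by simp only [Prod.mk.injEq]; tauto)
  have hMc := nent_le_log_card_univ hp c.descr
  rw [Fintype.card_fin] at hMc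
  have h1 := hc.compression
  have h2 := hc.leakage
  have h3 := hc.keyRate
  have h4 := hc.keyLeakage
  have e2 : nent (iidLaw P n) (fun ω => (c.key ω, c.descr ω, seqZ ω)) =
      nent (iidLaw P n) (fun ω => ((c.key ω, c.descr ω), seqZ ω)) :=
    nent_congr hp.1 fun ω ω' => by simp only [Prod.mk.injEq]; tauto
  rw [mutualInfo_eq, hHX, hHXZ, one_div_mul_eq_div, div_div, div_le_iff₀ (by positivity)] at h2
  rw [mutualInfo_eq, e2, one_div_mul_eq_div, div_div, div_le_iff₀ (by positivity)] at h4
  rw [entropy_eq, one_div_mul_eq_div, div_div, le_div_iff₀ (by positivity)] at h3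
  rw [Real.logb, one_div_mul_eq_div, div_div, div_le_iff₀ (by positivity)] at h1
  have hF : Real.log 2 + δ * (n * Real.log (Fintype.card X)) + 2 * (δ * (Real.log 2 * n)) ≤
      ε * (Real.log 2 * n) := by
    have e : Real.log (Fintype.card X) = lX * Real.log 2 := by rw [hlX, div_mul_cancel₀ _ hl2.ne']
    have : Real.log 2 + δ * (n * Real.log (Fintype.card X)) + 2 * (δ * (Real.log 2 * n)) =
        Real.log 2 * (1 + n * (δ * (2 + lX))) := by rw [e]; ring
    rw [this, hδε]
    rw [div_le_iff₀ hn1] at hnε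
    have h5 : 1 + n * (ε / 2) ≤ n * ε := by linarith
    have := mul_le_mul_of_nonneg_left h5 hl2.le
    linarith
  have hδn : 0 ≤ δ * (Real.log 2 * n) := by positivity
  simp only at h1 h2 h3 h4
  refine ⟨?_, ?_, ?_⟩
  -- n(H(X) - H(Y) - a) ≤ H(S,M,Yⁿ) - H(Yⁿ), which by Fano is at most H(M,Yⁿ) - H(Yⁿ) ≤ H(M) ≤ log
  -- |M| plus the error.
  · rw [div_le_iff₀ hl2]
    refine le_of_mul_le_mul_left ?_ hn1
    linarith
  -- H(S,M,Yⁿ) - H(M,Yⁿ) is again the Fano error; the rest is I(Xⁿ; M,Zⁿ).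
  · rw [div_le_iff₀ hl2]
    refine le_of_mul_le_mul_left ?_ hn1
    linarith
  -- n(b - c) = H(S|M,Zⁿ) - H(S|M,Yⁿ), where the first term is H(S) minus the key leakage and the
  -- second is the Fano error.
  · rw [le_div_iff₀ hl2]
    refine le_of_mul_le_mul_left ?_ hn1
    linarith

end Converse

/-! ### Random hashing -/

section Hashing

variable {Ω A B K K' : Type*} [Fintype Ω] [Fintype A] [DecidableEq A] [Fintype B] [Fintype K] [Fintype K']

/-- The event that the hash value of `a` and the side information `b` do not identify `a` within the
list `T b`. -/
def hashError (a : Ω → A) (b : Ω → B) (T : B → Finset A) (h : A → K) : Set Ω :=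
  {ω | a ω ∉ T (b ω) ∨ ∃ a' ∈ T (b ω), a' ≠ a ω ∧ h a' = h (a ω)}

theorem exists_hash_decoder [Nonempty A] (a : Ω → A) (b : Ω → B) (T : B → Finset A) (h : A → K) :
    ∃ dec : K × B → A, ∀ ω, dec (h (a ω), b ω) ≠ a ω → ω ∈ hashError a b T h := by
  refine ⟨fun w => if hw : ∃ a' ∈ T w.2, h a' = w.1 then hw.choose else Classical.arbitrary A,
    fun ω hω => ?_⟩
  by_contra hne
  simp only [hashError, Set.mem_ofPred_eq, not_or, not_not, not_exists, not_and] at hne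
  have hw : ∃ a' ∈ T (b ω), h a' = h (a ω) := ⟨a ω, hne.1, rfl⟩
  simp only [hw, dite_true] at hω
  exact hne.2 _ hw.choose_spec.1 hω hw.choose_spec.2

/-- Union bound over the list, averaged over the random hash: each wrong candidate collides with
probability at most `ρ`. -/
theorem sum_hashError_le {p : Ω → ℝ} (hp : p ∈ stdSimplex ℝ Ω) (a : Ω → A) (b : Ω → B)
    (T : B → Finset A) {t ρ : ℝ} (hT : ∀ b, ((T b).card : ℝ) ≤ t) (hρ : 0 ≤ ρ)
    {q : (A → K') → ℝ} (hq : q ∈ stdSimplex ℝ (A → K')) (g : K' → K)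
    (hcol : ∀ a a', a' ≠ a → ∑ h, q h * (if g (h a') = g (h a) then 1 else 0) ≤ ρ) :
    ∑ h, q h * prob p (hashError a b T fun x => g (h x)) ≤
      prob p {ω | a ω ∉ T (b ω)} + t * ρ := by
  have h1 : ∀ h : A → K', prob p (hashError a b T fun x => g (h x)) ≤
      prob p {ω | a ω ∉ T (b ω)} + ∑ ω, p ω * ∑ a' ∈ T (b ω),
        (if a' ≠ a ω then if g (h a') = g (h (a ω)) then 1 else 0 else 0) := fun h => by
    rw [prob_eq, prob_eq, ← sum_add_distrib]
    refine sum_le_sum fun ω _ => ?_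
    have hs : 0 ≤ p ω * ∑ a' ∈ T (b ω),
        (if a' ≠ a ω then if g (h a') = g (h (a ω)) then (1 : ℝ) else 0 else 0) :=
      mul_nonneg (hp.1 ω) (sum_nonneg fun _ _ => by split_ifs <;> norm_num)
    by_cases hin : ω ∈ hashError a b T fun x => g (h x)
    · rw [if_pos hin]
      rcases hin with hin | ⟨a', ha', hne, hc⟩
      · rw [if_pos (by exact hin)]; linarith
      · have : (1 : ℝ) ≤ ∑ a' ∈ T (b ω),
            (if a' ≠ a ω then if g (h a') = g (h (a ω)) then (1 : ℝ) else 0 else 0) := by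
          refine le_trans ?_ (single_le_sum (fun a' _ => ?_) ha')
          · simp [hne, hc]
          · split_ifs <;> norm_num
        have h2 := mul_le_mul_of_nonneg_left this (hp.1 ω)
        rw [mul_one] at h2
        refine h2.trans (le_add_of_nonneg_left ?_)
        split_ifs
        · exact hp.1 ω
        · exact le_rfl
    · rw [if_neg hin]
      refine add_nonneg ?_ hs
      split_ifs
      · exact hp.1 ω
      · exact le_rfl
  refine (sum_le_sum fun h _ => mul_le_mul_of_nonneg_left (h1 h) (hq.1 h)).trans ?_
  simp only [mul_add, sum_add_distrib, ← sum_mul, hq.2, one_mul]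
  refine add_le_add le_rfl ?_
  have h2 : ∑ h, q h * ∑ ω, p ω * ∑ a' ∈ T (b ω),
        (if a' ≠ a ω then if g (h a') = g (h (a ω)) then (1 : ℝ) else 0 else 0) =
      ∑ ω, p ω * ∑ a' ∈ T (b ω), if a' ≠ a ω then
        ∑ h, q h * (if g (h a') = g (h (a ω)) then (1 : ℝ) else 0) else 0 := by
    simp only [mul_sum]
    rw [sum_comm]
    refine sum_congr rfl fun ω _ => ?_
    rw [sum_comm]
    refine sum_congr rfl fun a' _ => ?_
    split_ifs
    · rw [mul_sum]
      exact sum_congr rfl fun h _ => by ring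
    · simp
  rw [h2]
  calc _ ≤ ∑ ω, p ω * (t * ρ) := by
        refine sum_le_sum fun ω _ => mul_le_mul_of_nonneg_left ?_ (hp.1 ω)
        calc _ ≤ ∑ a' ∈ T (b ω), ρ := by
              refine sum_le_sum fun a' _ => ?_
              split_ifs with hne
              · exact hcol _ _ hne
              · exact hρ
          _ = (T (b ω)).card * ρ := by rw [sum_const, nsmul_eq_mul]
          _ ≤ t * ρ := mul_le_mul_of_nonneg_right (hT _) hρ
    _ = t * ρ := by rw [← sum_mul, hp.2, one_mul]

/-- The uniform law. -/
noncomputable def unif (K : Type*) [Fintype K] (_ : K) : ℝ := (Fintype.card K : ℝ)⁻¹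

theorem unif_mem [Nonempty K] : unif K ∈ stdSimplex ℝ K :=
  ⟨fun _ => by unfold unif; positivity, by
    simp only [unif, sum_const, card_univ, nsmul_eq_mul]
    exact mul_inv_cancel₀ (by positivity)⟩

/-- Hash values of distinct points are independent and uniform, so their images under `g` collide
with the probability that two independent copies agree. -/
theorem sum_collision [Nonempty K'] (g : K' → K) {a a' : A} (h : a' ≠ a) :
    ∑ f : A → K', piLaw (fun _ => unif K') f * (if g (f a') = g (f a) then 1 else 0) =
      ∑ k, law (unif K') g k ^ 2 := by
  have h1 : ∀ f : A → K', (if g (f a') = g (f a) then (1 : ℝ) else 0) =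
      ∑ k, (if g (f a') = k then 1 else 0) * (if g (f a) = k then 1 else 0) := fun f => by
    simp
  simp only [h1, mul_sum]
  rw [sum_comm]
  refine sum_congr rfl fun k _ => ?_
  rw [sum_piLaw_apply₂ (fun _ => unif_mem) h (fun x => if g x = k then 1 else 0)
    fun x => if g x = k then 1 else 0, sq]
  simp [law_eq]

theorem sum_collision_id [Nonempty K'] {a a' : A} (h : a' ≠ a) :
    ∑ f : A → K', piLaw (fun _ => unif K') f * (if f a' = f a then 1 else 0) =
      (Fintype.card K' : ℝ)⁻¹ := by
  rw [sum_collision (fun k => k) h]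
  have : ∀ k : K', law (unif K') (fun k => k) k = (Fintype.card K' : ℝ)⁻¹ := fun k => by
    simp [law_eq, unif]
  simp only [this, sum_const, card_univ, nsmul_eq_mul, sq]
  rw [mul_inv_cancel_left₀ (by positivity)]

theorem sum_collision_fst [Nonempty K] [Nonempty K'] {a a' : A} (h : a' ≠ a) :
    ∑ f : A → K × K', piLaw (fun _ => unif (K × K')) f * (if (f a').1 = (f a).1 then 1 else 0) =
      (Fintype.card K : ℝ)⁻¹ := by
  rw [sum_collision (fun k : K × K' => k.1) h]
  have h1 : (Fintype.card K' : ℝ) ≠ 0 := by positivity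
  have h2 : (Fintype.card K : ℝ) ≠ 0 := by positivity
  have : ∀ k : K, law (unif (K × K')) (fun k => k.1) k = (Fintype.card K : ℝ)⁻¹ := fun k => by
    simp only [law_eq, unif, Fintype.sum_prod_type_right, Fintype.card_prod, Nat.cast_mul,
      sum_ite_eq', mem_univ, if_true, sum_const, card_univ, nsmul_eq_mul]
    field_simp
  simp only [this, sum_const, card_univ, nsmul_eq_mul, sq]
  rw [mul_inv_cancel_left₀ h2]

theorem exists_le_of_sum_le {p : Ω → ℝ} (hp : p ∈ stdSimplex ℝ Ω) {F : Ω → ℝ} {c : ℝ}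
    (h : ∑ ω, p ω * F ω ≤ c) : ∃ ω, F ω ≤ c := by
  by_contra hlt
  push Not at hlt
  have h1 : ∑ ω, p ω * (F ω - c) ≤ 0 := by
    simp only [mul_sub, sum_sub_distrib, ← sum_mul, hp.2]; linarith
  have h2 : ∀ ω ∈ univ, 0 ≤ p ω * (F ω - c) := fun ω _ =>
    mul_nonneg (hp.1 ω) (sub_pos.2 (hlt ω)).le
  have h3 := (sum_eq_zero_iff_of_nonneg h2).1 (le_antisymm h1 (sum_nonneg h2))
  have h4 : ∀ ω, p ω = 0 := fun ω =>
    (mul_eq_zero.1 (h3 ω (mem_univ ω))).resolve_right (sub_pos.2 (hlt ω)).ne'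
  have := hp.2
  simp [h4] at this

end Hashing

/-! ### Conditionally typical lists -/

section Lists

variable {Ω A B : Type*} [Fintype Ω] [Fintype A] [Fintype B] {P : Ω → ℝ}

/-- The sequences of conditional probability at least `exp (-s)` given `b`. -/
noncomputable def typicalList (P : Ω → ℝ) (f : Ω → A) (g : Ω → B) {N : ℕ} (s : ℝ) (b : Fin N → B) :
    Finset (Fin N → A) :=
  {a | 0 < ∏ i, law P g (b i) ∧ Real.exp (-s) * ∏ i, law P g (b i) ≤
    ∏ i, law P (fun ω => (f ω, g ω)) (a i, b i)}

/-- Every member has conditional probability at least `exp (-s)`, and these probabilities sum to at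
most one. -/
theorem card_typicalList_le (hP : P ∈ stdSimplex ℝ Ω) (f : Ω → A) (g : Ω → B) {N : ℕ} (s : ℝ)
    (b : Fin N → B) : ((typicalList P f g s b).card : ℝ) ≤ Real.exp s := by
  by_cases hG : 0 < ∏ i, law P g (b i)
  · have h1 : ∑ a : Fin N → A, ∏ i, law P (fun ω => (f ω, g ω)) (a i, b i) =
        ∏ i, law P g (b i) := by
      rw [sum_prod_apply fun i a => law P (fun ω => (f ω, g ω)) (a, b i)]
      refine prod_congr rfl fun i _ => ?_
      have := sum_law_mul P (fun ω => (f ω, g ω)) (fun c => if c.2 = b i then 1 else 0)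
      rw [Fintype.sum_prod_type] at this
      simp only [mul_boole, sum_ite_eq', mem_univ, if_true] at this
      rw [this]; rfl
    have h2 : ((typicalList P f g s b).card : ℝ) * (Real.exp (-s) * ∏ i, law P g (b i)) ≤
        ∏ i, law P g (b i) := by
      rw [← nsmul_eq_mul]
      refine (card_nsmul_le_sum _ (fun a => ∏ i, law P (fun ω => (f ω, g ω)) (a i, b i)) _
        fun a ha => ?_).trans ?_
      · simp only [typicalList, mem_filter, mem_univ, true_and] at ha
        exact ha.2
      · rw [← h1]
        exact sum_le_univ_sum_of_nonneg fun a => prod_nonneg fun i _ => law_nonneg hP.1 _ _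
    rw [← mul_assoc] at h2
    have h3 := (mul_le_iff_le_one_left hG).1 h2
    rwa [Real.exp_neg, mul_inv_le_iff₀ (Real.exp_pos s), one_mul] at h3
  · have : typicalList P f g s b = ∅ := by
      simp [typicalList, hG]
    rw [this]
    simp [Real.exp_nonneg]

/-- The conditional log-likelihood is a sum of independent terms with mean the conditional entropy,
so Chebyshev's inequality applies. -/
theorem eventually_prob_notMem_typicalList (hP : P ∈ stdSimplex ℝ Ω) (f : Ω → A) (g : Ω → B)
    {ε η : ℝ} (hε : 0 < ε) (hη : 0 < η) : ∀ᶠ N : ℕ in Filter.atTop,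
      prob (piLaw fun _ : Fin N => P) {ω | (fun i => f (ω i)) ∉ typicalList P f g
        (N * (nent P (fun ω => (f ω, g ω)) - nent P g + ε)) fun i => g (ω i)} ≤ η := by
  set H := nent P (fun ω => (f ω, g ω)) - nent P g with hH
  set φ : Ω → ℝ := fun ω => -Real.log (law P (fun ω => (f ω, g ω)) (f ω, g ω)) +
    Real.log (law P g (g ω)) with hφ
  set c := ∑ ω, P ω * φ ω ^ 2 with hc
  have hmean : ∑ ω, P ω * φ ω = H := by
    rw [hH, nent_eq, nent_eq, ← sum_sub_distrib]
    exact sum_congr rfl fun ω _ => by simp only [hφ]; ring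
  filter_upwards [Filter.eventually_ge_atTop (⌈c / (ε ^ 2 * η)⌉₊ + 1)] with N hN
  have hN0 : (0 : ℝ) < N := by exact_mod_cast (by omega : 0 < N)
  have hcheb := prob_chebyshev (fun _ : Fin N => hP) (fun _ => φ) (t := N * ε) (by positivity)
  simp only [hmean, sum_const, card_univ, Fintype.card_fin, nsmul_eq_mul] at hcheb
  refine (prob_mono (piLaw_mem fun _ => hP).1 fun ω hω h => ?_).trans (hcheb.trans ?_)
  · rw [piLaw_pos_iff fun _ => hP.1] at hω
    have hg : ∀ i, 0 < law P g (g (ω i)) := fun i => (hω i).trans_le (le_law hP.1 g (ω i))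
    have hfg : ∀ i, 0 < law P (fun ω => (f ω, g ω)) (f (ω i), g (ω i)) := fun i =>
      (hω i).trans_le (le_law hP.1 (fun ω => (f ω, g ω)) (ω i))
    have hG : 0 < ∏ i, law P g (g (ω i)) := prod_pos fun i _ => hg i
    simp only [typicalList, mem_filter, mem_univ, true_and, Set.mem_ofPred_eq, not_and, not_le]
      at h ⊢
    have h1 := h hG
    have h2 := Real.log_lt_log (prod_pos fun i _ => hfg i) h1
    rw [Real.log_mul (Real.exp_pos _).ne' hG.ne', Real.log_exp,
      Real.log_prod fun i _ => (hg i).ne', Real.log_prod fun i _ => (hfg i).ne'] at h2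
    refine le_trans ?_ (le_abs_self _)
    simp only [hφ, sum_add_distrib, sum_neg_distrib]
    linarith
  · change N * c / (N * ε) ^ 2 ≤ η
    have h1 : c / (ε ^ 2 * η) ≤ N := (Nat.le_ceil _).trans
      (by exact_mod_cast (by omega : ⌈c / (ε ^ 2 * η)⌉₊ ≤ N))
    rw [div_le_iff₀ (by positivity)] at h1 ⊢
    nlinarith

end Lists

/-! ### Hashing a memoryless source for description and key -/

section KeyAgreement

theorem floor_exp_bounds {s : ℝ} (hs : 0 ≤ s) : 1 ≤ ⌊Real.exp s⌋₊ ∧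
    Real.log (⌊Real.exp s⌋₊ : ℝ) ≤ s ∧ ((⌊Real.exp s⌋₊ : ℝ))⁻¹ ≤ 2 * Real.exp (-s) := by
  have h1 : 1 ≤ ⌊Real.exp s⌋₊ := Nat.le_floor (by simpa using hs)
  have h1' : (1 : ℝ) ≤ (⌊Real.exp s⌋₊ : ℝ) := by exact_mod_cast h1
  have h2 : (⌊Real.exp s⌋₊ : ℝ) ≤ Real.exp s := Nat.floor_le (Real.exp_nonneg s)
  refine ⟨h1, ?_, ?_⟩
  · rw [Real.log_le_iff_le_exp (by linarith)]
    exact h2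
  · have h3 := Nat.lt_floor_add_one (Real.exp s)
    rw [inv_le_iff_one_le_mul₀ (by linarith), Real.exp_neg]
    have h4 := Real.exp_pos s
    rw [mul_assoc, ← div_eq_inv_mul, ← mul_div_assoc, one_le_div h4]
    linarith

theorem eventually_mul_exp_neg_le {ε η : ℝ} (hε : 0 < ε) (hη : 0 < η) (c : ℝ) :
    ∀ᶠ N : ℕ in Filter.atTop, c * Real.exp (-(N * ε)) ≤ η := by
  have h : Filter.Tendsto (fun N : ℕ => c * Real.exp (-(N * ε))) Filter.atTop (nhds (c * 0)) :=
    (Real.tendsto_exp_neg_atTop_nhds_zero.comp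
      (tendsto_natCast_atTop_atTop.atTop_mul_const hε)).const_mul c
  rw [mul_zero] at h
  exact h.eventually (ge_mem_nhds hη)

variable {Ω U V Y Z : Type*} [Fintype Ω] [Fintype U] [Fintype V] [Fintype Y] [Fintype Z]
  [Nonempty U] [Nonempty V] {P : Ω → ℝ}

/-- Hash functions for the description and for the key of a memoryless source. -/
theorem eventually_exists_hashes (hP : P ∈ stdSimplex ℝ Ω) (u : Ω → U) (v : Ω → V) (y : Ω → Y)
    (z : Ω → Z) {ε : ℝ} (hε : 0 < ε) : ∀ᶠ N : ℕ in Filter.atTop,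
    ∃ (k₁ k₂ k₃ : ℕ) (h₁ : (Fin N → U) → Fin k₁) (h₂ : (Fin N → V) → Fin k₂)
      (h₃ : (Fin N → V) → Fin k₃) (dec : (Fin k₁ × Fin k₂) × (Fin N → Y) → (Fin N → V))
      (dec' : Fin k₃ × (Fin N → U) × Fin k₂ × (Fin N → Z) → (Fin N → V)),
      Real.log k₁ ≤ N * (nent P (fun ω => (u ω, y ω)) - nent P y + ε) ∧
      Real.log k₂ ≤ N * (nent P (fun ω => (v ω, u ω, y ω)) - nent P (fun ω => (u ω, y ω)) + ε) ∧
      Real.log k₃ ≤ N * (max ((nent P (fun ω => (v ω, u ω, z ω)) - nent P (fun ω => (u ω, z ω))) -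
        (nent P (fun ω => (v ω, u ω, y ω)) - nent P (fun ω => (u ω, y ω)))) 0 + ε) ∧
      prob (piLaw fun _ : Fin N => P) {ω | dec ((h₁ fun i => u (ω i), h₂ fun i => v (ω i)),
        fun i => y (ω i)) ≠ fun i => v (ω i)} ≤ ε ∧
      prob (piLaw fun _ : Fin N => P) {ω | dec' (h₃ fun i => v (ω i), fun i => u (ω i),
        h₂ fun i => v (ω i), fun i => z (ω i)) ≠ fun i => v (ω i)} ≤ ε := by
  set Hu := nent P (fun ω => (u ω, y ω)) - nent P y with hHu
  set Hv := nent P (fun ω => (v ω, u ω, y ω)) - nent P (fun ω => (u ω, y ω)) with hHv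
  set Hz := nent P (fun ω => (v ω, u ω, z ω)) - nent P (fun ω => (u ω, z ω)) with hHz
  have hu0 : 0 ≤ Hu := sub_nonneg.2 (nent_mono hP.1 (by simp only [Prod.mk.injEq]; tauto))
  have hv0 : 0 ≤ Hv := sub_nonneg.2 (nent_mono hP.1 (by simp only [Prod.mk.injEq]; tauto))
  -- Three decoders are analysed, each failing by atypicality or by collision, which makes six
  -- events.
  have hη : 0 < ε / 6 := by positivity
  filter_upwards [eventually_prob_notMem_typicalList hP u y (half_pos hε) hη,
    eventually_prob_notMem_typicalList hP v (fun ω => (u ω, y ω)) (half_pos hε) hη,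
    eventually_prob_notMem_typicalList hP v (fun ω => (u ω, z ω)) (half_pos hε) hη,
    eventually_mul_exp_neg_le (half_pos hε) hη 4] with N e1 e2 e3 e4
  have hp := piLaw_mem fun _ : Fin N => hP
  have hN : (0 : ℝ) ≤ N := Nat.cast_nonneg N
  obtain ⟨a1, b1, c1⟩ := floor_exp_bounds (s := N * (Hu + ε)) (by positivity)
  obtain ⟨a2, b2, c2⟩ := floor_exp_bounds (s := N * (Hv + ε)) (by positivity)
  obtain ⟨a3, b3, c3⟩ := floor_exp_bounds (s := N * (max (Hz - Hv) 0 + ε)) (by positivity)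
  set k₁ := ⌊Real.exp (N * (Hu + ε))⌋₊
  set k₂ := ⌊Real.exp (N * (Hv + ε))⌋₊
  set k₃ := ⌊Real.exp (N * (max (Hz - Hv) 0 + ε))⌋₊
  have : Nonempty (Fin k₁) := ⟨⟨0, a1⟩⟩
  have : Nonempty (Fin k₂) := ⟨⟨0, a2⟩⟩
  have : Nonempty (Fin k₃) := ⟨⟨0, a3⟩⟩
  have s1 := sum_hashError_le hp (fun ω i => u (ω i)) (fun ω i => y (ω i))
    (typicalList P u y (N * (Hu + ε / 2))) (card_typicalList_le hP u y _)
    (ρ := (Fintype.card (Fin k₁) : ℝ)⁻¹) (by positivity)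
    (piLaw_mem fun _ : (Fin N → U) => unif_mem (K := Fin k₁)) (fun k => k)
    fun a a' h => (sum_collision_id h).le
  -- One random hash with values in `Fin k₂ × Fin k₃` serves twice: its first component must
  -- identify V from (U, Y), and the whole pair must identify V from (U, Z).
  have s2 := sum_hashError_le hp (fun ω i => v (ω i)) (fun ω i => (u (ω i), y (ω i)))
    (typicalList P v (fun ω => (u ω, y ω)) (N * (Hv + ε / 2))) (card_typicalList_le hP v _ _)
    (ρ := (Fintype.card (Fin k₂) : ℝ)⁻¹) (by positivity)
    (piLaw_mem fun _ : (Fin N → V) => unif_mem (K := Fin k₂ × Fin k₃)) (fun k => k.1)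
    fun a a' h => (sum_collision_fst h).le
  have s3 := sum_hashError_le hp (fun ω i => v (ω i)) (fun ω i => (u (ω i), z (ω i)))
    (typicalList P v (fun ω => (u ω, z ω)) (N * (Hz + ε / 2))) (card_typicalList_le hP v _ _)
    (ρ := (Fintype.card (Fin k₂ × Fin k₃) : ℝ)⁻¹) (by positivity)
    (piLaw_mem fun _ : (Fin N → V) => unif_mem (K := Fin k₂ × Fin k₃)) (fun k => k)
    fun a a' h => (sum_collision_id h).le
  have t1 : Real.exp (N * (Hu + ε / 2)) * (Fintype.card (Fin k₁) : ℝ)⁻¹ ≤ ε / 6 := by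
    rw [Fintype.card_fin]
    calc _ ≤ Real.exp (N * (Hu + ε / 2)) * (2 * Real.exp (-(N * (Hu + ε)))) := by gcongr
      _ = 2 * Real.exp (-(N * (ε / 2))) := by
        rw [mul_left_comm, ← Real.exp_add]; congr 2; ring
      _ ≤ 4 * Real.exp (-(N * (ε / 2))) := by gcongr; norm_num
      _ ≤ ε / 6 := e4
  have t2 : Real.exp (N * (Hv + ε / 2)) * (Fintype.card (Fin k₂) : ℝ)⁻¹ ≤ ε / 6 := by
    rw [Fintype.card_fin]
    calc _ ≤ Real.exp (N * (Hv + ε / 2)) * (2 * Real.exp (-(N * (Hv + ε)))) := by gcongr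
      _ = 2 * Real.exp (-(N * (ε / 2))) := by
        rw [mul_left_comm, ← Real.exp_add]; congr 2; ring
      _ ≤ 4 * Real.exp (-(N * (ε / 2))) := by gcongr; norm_num
      _ ≤ ε / 6 := e4
  -- The pair has total rate at least `Hv + max (Hz - Hv) 0 ≥ Hz`, enough for the list given (U, Z).
  -- The factor 4 comes from rounding two alphabet sizes down.
  have t3 : Real.exp (N * (Hz + ε / 2)) * (Fintype.card (Fin k₂ × Fin k₃) : ℝ)⁻¹ ≤ ε / 6 := by
    rw [Fintype.card_prod, Fintype.card_fin, Fintype.card_fin, Nat.cast_mul, mul_inv]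
    calc _ ≤ Real.exp (N * (Hz + ε / 2)) * ((2 * Real.exp (-(N * (Hv + ε)))) *
          (2 * Real.exp (-(N * (max (Hz - Hv) 0 + ε))))) := by gcongr
      _ = 4 * Real.exp (N * (Hz + ε / 2) + (-(N * (Hv + ε)) + -(N * (max (Hz - Hv) 0 + ε)))) := by
        rw [Real.exp_add, Real.exp_add]; ring
      _ ≤ 4 * Real.exp (-(N * (ε / 2))) := by
        gcongr
        have := mul_le_mul_of_nonneg_left (le_max_left (Hz - Hv) 0) hN
        have h2 : 0 ≤ N * ε := by positivity
        linarith
      _ ≤ ε / 6 := e4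
  obtain ⟨h₁, g1⟩ := exists_le_of_sum_le (piLaw_mem fun _ => unif_mem)
    (s1.trans (add_le_add e1 t1))
  have s23 := add_le_add (s2.trans (add_le_add e2 t2)) (s3.trans (add_le_add e3 t3))
  rw [← sum_add_distrib] at s23
  simp only [← mul_add] at s23
  obtain ⟨h, g23⟩ := exists_le_of_sum_le (piLaw_mem fun _ => unif_mem) s23
  obtain ⟨d1, hd1⟩ := exists_hash_decoder (fun (ω : Fin N → Ω) i => u (ω i))
    (fun (ω : Fin N → Ω) i => y (ω i)) (typicalList P u y (N * (Hu + ε / 2))) fun x => h₁ x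
  obtain ⟨d2, hd2⟩ := exists_hash_decoder (fun (ω : Fin N → Ω) i => v (ω i))
    (fun (ω : Fin N → Ω) i => (u (ω i), y (ω i)))
    (typicalList P v (fun ω => (u ω, y ω)) (N * (Hv + ε / 2))) fun x => (h x).1
  obtain ⟨d3, hd3⟩ := exists_hash_decoder (fun (ω : Fin N → Ω) i => v (ω i))
    (fun (ω : Fin N → Ω) i => (u (ω i), z (ω i)))
    (typicalList P v (fun ω => (u ω, z ω)) (N * (Hz + ε / 2))) fun x => h x
  have n2 := prob_nonneg hp.1 (hashError (fun ω i => v (ω i)) (fun ω i => (u (ω i), y (ω i)))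
    (typicalList P v (fun ω => (u ω, y ω)) (N * (Hv + ε / 2))) fun x => (h x).1)
  have n3 := prob_nonneg hp.1 (hashError (fun ω i => v (ω i)) (fun ω i => (u (ω i), z (ω i)))
    (typicalList P v (fun ω => (u ω, z ω)) (N * (Hz + ε / 2))) fun x => h x)
  -- The legitimate decoder recovers U from Y first and then V from (U, Y). The second decoder is
  -- fictitious and is used only in the secrecy analysis, where U is given.
  refine ⟨k₁, k₂, k₃, h₁, fun x => (h x).1, fun x => (h x).2,
    fun w => d2 (w.1.2, fun i => (d1 (w.1.1, w.2) i, w.2 i)),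
    fun w => d3 ((w.2.2.1, w.1), fun i => (w.2.1 i, w.2.2.2 i)), b1, b2, b3, ?_, ?_⟩
  · refine (prob_le_add hp.1 (F := hashError (fun ω i => u (ω i)) (fun ω i => y (ω i))
      (typicalList P u y (N * (Hu + ε / 2))) fun x => h₁ x)
      (G := hashError (fun ω i => v (ω i)) (fun ω i => (u (ω i), y (ω i)))
        (typicalList P v (fun ω => (u ω, y ω)) (N * (Hv + ε / 2))) fun x => (h x).1)
      fun ω _ hω => ?_).trans (by linarith)
    by_cases hu : d1 (h₁ fun i => u (ω i), fun i => y (ω i)) = fun i => u (ω i)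
    · right
      apply hd2
      simpa only [Set.mem_ofPred_eq, hu] using hω
    · exact Or.inl (hd1 ω hu)
  · exact (prob_mono hp.1 fun ω _ hω => hd3 ω hω).trans (by linarith)

end KeyAgreement

/-! ### Block codes -/

section Blocks

variable {X Y Z U V A : Type*} [Fintype X] [Fintype Y] [Fintype Z] [Fintype U] [Fintype V]
  [Fintype A] [Nonempty U] [Nonempty V] {P : X × Y × Z → ℝ} {n : ℕ}

/-- The position of the `j`-th letter of the `i`-th block of length `k`. -/
def blockIndex (n k : ℕ) (w : Fin (n / k) × Fin k) : Fin n :=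
  ⟨w.1 * k + w.2, by
    have h1 : (w.1 : ℕ) + 1 ≤ n / k := w.1.2
    have h2 := w.2.2
    have h3 := Nat.div_mul_le_self n k
    nlinarith⟩

theorem blockIndex_injective (n k : ℕ) : Function.Injective (blockIndex n k) := by
  rintro ⟨i, j⟩ ⟨i', j'⟩ h
  have hk : 0 < k := j.pos
  have h' : (i : ℕ) * k + j = i' * k + j' := congrArg Fin.val h
  have hj : (j : ℕ) = j' := by
    have := congrArg (· % k) h'
    simpa [Nat.mod_eq_of_lt] using this
  have hi : (i : ℕ) = i' := by
    rw [hj] at h'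
    exact Nat.eq_of_mul_eq_mul_right hk (Nat.add_right_cancel h')
  rw [Fin.ext hi, Fin.ext hj]

/-- The complete blocks of length `k` of a sequence of length `n`. -/
def blocks (k : ℕ) (a : Fin n → A) (i : Fin (n / k)) (j : Fin k) : A := a (blockIndex n k (i, j))

/-- The letters of a sequence after its last complete block. -/
def tail (k : ℕ) (a : Fin n → A) (t : Fin k) : Option A :=
  if h : n / k * k + t < n then some (a ⟨_, h⟩) else none

theorem eq_of_blocks_eq {k : ℕ} (hk : 0 < k) {a a' : Fin n → A} (hb : blocks k a = blocks k a')
    (ht : tail k a = tail k a') : a = a' := by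
  funext j
  by_cases hj : (j : ℕ) < n / k * k
  · have h1 : (j : ℕ) / k < n / k := Nat.div_lt_of_lt_mul (by rwa [mul_comm])
    have h2 := congrFun (congrFun hb ⟨j / k, h1⟩) ⟨j % k, Nat.mod_lt _ hk⟩
    have h3 : blockIndex n k (⟨j / k, h1⟩, ⟨j % k, Nat.mod_lt _ hk⟩) = j :=
      Fin.ext (Nat.div_add_mod' (j : ℕ) k)
    simpa only [blocks, h3] using h2
  · push Not at hj
    have h1 : n / k * k + (j - n / k * k) = (j : ℕ) := by omega
    have h2 : (j : ℕ) - n / k * k < k := by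
      have := Nat.div_add_mod' n k
      have := Nat.mod_lt n hk
      have := j.2
      omega
    have h3 := congrFun ht ⟨_, h2⟩
    simp only [tail, h1, j.2, dite_true, Option.some.injEq] at h3
    exact h3

theorem law_blocks (hP : P ∈ stdSimplex ℝ (X × Y × Z)) (n k : ℕ) :
    law (iidLaw P n) (blocks k) = piLaw fun _ : Fin (n / k) => iidLaw P k := by
  funext b
  have h1 := congrFun (law_piLaw_comp (p := fun _ : Fin n => P) (fun _ => hP) (blockIndex n k)
    (blockIndex_injective n k)) fun w => b w.1 w.2
  have h2 : piLaw (fun _ : Fin (n / k) × Fin k => P) (fun w => b w.1 w.2) =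
      piLaw (fun _ : Fin (n / k) => iidLaw P k) b := by
    simp only [piLaw, iidLaw, Fintype.prod_prod_type]
  rw [← h2, ← h1, law_eq, law_eq, iidLaw_eq]
  refine sum_congr rfl fun ω _ => ?_
  have h3 : blocks k ω = b ↔ (fun w => ω (blockIndex n k w)) = fun w => b w.1 w.2 := by
    simp only [funext_iff, blocks, Prod.forall]
  by_cases h : blocks k ω = b
  · rw [if_pos h, if_pos (h3.1 h)]
  · rw [if_neg h, if_neg fun h' => h (h3.2 h')]

theorem nent_blocks (hP : P ∈ stdSimplex ℝ (X × Y × Z)) (n k : ℕ)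
    (f : (Fin (n / k) → Fin k → X × Y × Z) → A) :
    nent (iidLaw P n) (fun ω => f (blocks k ω)) = nent (piLaw fun _ : Fin (n / k) => iidLaw P k) f := by
  rw [← law_blocks hP, nent_law]

theorem prob_blocks (hP : P ∈ stdSimplex ℝ (X × Y × Z)) (n k : ℕ)
    (E : Set (Fin (n / k) → Fin k → X × Y × Z)) :
    prob (iidLaw P n) {ω | blocks k ω ∈ E} = prob (piLaw fun _ : Fin (n / k) => iidLaw P k) E := by
  rw [← law_blocks hP, prob_law]

/-- A code of length `n` from hash functions on blocks of length `k`. -/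
theorem exists_block_code (hP : P ∈ stdSimplex ℝ (X × Y × Z)) {k : ℕ} (hk : 0 < k)
    (fu : (Fin k → X) → U) (fv : (Fin k → X) → V) {ε : ℝ} {k₁ k₂ k₃ : ℕ}
    (h₁ : (Fin (n / k) → U) → Fin k₁) (h₂ : (Fin (n / k) → V) → Fin k₂)
    (h₃ : (Fin (n / k) → V) → Fin k₃)
    (dec : (Fin k₁ × Fin k₂) × (Fin (n / k) → Fin k → Y) → (Fin (n / k) → V))
    (dec' : Fin k₃ × (Fin (n / k) → U) × Fin k₂ × (Fin (n / k) → Fin k → Z) → (Fin (n / k) → V))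
    (hdec : prob (piLaw fun _ : Fin (n / k) => iidLaw P k) {ω | dec ((h₁ fun i => fu (seqX (ω i)),
      h₂ fun i => fv (seqX (ω i))), fun i => seqY (ω i)) ≠ fun i => fv (seqX (ω i))} ≤ ε)
    (hdec' : prob (piLaw fun _ : Fin (n / k) => iidLaw P k) {ω | dec' (h₃ fun i => fv (seqX (ω i)),
      fun i => fu (seqX (ω i)), h₂ fun i => fv (seqX (ω i)), fun i => seqZ (ω i)) ≠
        fun i => fv (seqX (ω i))} ≤ ε) (hk₁ : 0 < k₁) (hk₂ : 0 < k₂) :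
    ∃ c : Code X Y n,
      prob (iidLaw P n) {ω | c.keyEst ω ≠ c.key ω} ≤ ε ∧
      Real.log c.numM = Real.log k₁ + Real.log k₂ ∧
      nent (iidLaw P n) seqX + nent (iidLaw P n) (fun ω => (c.descr ω, seqZ ω)) -
        nent (iidLaw P n) (fun ω => (seqX ω, c.descr ω, seqZ ω)) ≤
        (n / k : ℕ) * nent (iidLaw P k) (fun ω => (fu (seqX ω), seqZ ω)) + Real.log k₂ +
          k * Real.log (Fintype.card Z + 1) -
          n * (nent P (fun ω => (ω.1, ω.2.2)) - nent P fun ω => ω.1) ∧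
      (n / k : ℕ) * (nent (iidLaw P k) (fun ω => (fv (seqX ω), fu (seqX ω), seqZ ω)) -
        nent (iidLaw P k) (fun ω => (fu (seqX ω), seqZ ω))) - Real.log k₂ -
        (Real.log 2 + ε * ((n / k : ℕ) * Real.log (Fintype.card V))) ≤ nent (iidLaw P n) c.key ∧
      nent (iidLaw P n) c.key + nent (iidLaw P n) (fun ω => (c.descr ω, seqZ ω)) -
        nent (iidLaw P n) (fun ω => (c.key ω, c.descr ω, seqZ ω)) ≤
        Real.log k₃ + Real.log k₂ -
        (n / k : ℕ) * (nent (iidLaw P k) (fun ω => (fv (seqX ω), fu (seqX ω), seqZ ω)) -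
        nent (iidLaw P k) (fun ω => (fu (seqX ω), seqZ ω))) + k * Real.log (Fintype.card Z + 1) +
        (Real.log 2 + ε * ((n / k : ℕ) * Real.log (Fintype.card V))) := by
  set p := iidLaw P n with hpdef
  set q := piLaw fun _ : Fin (n / k) => iidLaw P k with hq
  have hp : p ∈ stdSimplex ℝ _ := iidLaw_mem hP n
  have hqm : q ∈ stdSimplex ℝ _ := piLaw_mem fun _ => iidLaw_mem hP k
  set c : Code X Y n :=
    { numM := k₁ * k₂
      numS := k₃
      encM := fun x => finProdFinEquiv (h₁ fun i => fu (blocks k x i), h₂ fun i => fv (blocks k x i))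
      encS := fun x => h₃ fun i => fv (blocks k x i)
      dec := fun w => h₃ (dec (finProdFinEquiv.symm w.1, blocks k w.2)) } with hc
  set Ub : (Fin n → X × Y × Z) → Fin (n / k) → U := fun ω i => fu (seqX (blocks k ω i)) with hUb
  set Vb : (Fin n → X × Y × Z) → Fin (n / k) → V := fun ω i => fv (seqX (blocks k ω i)) with hVb
  set Zb : (Fin n → X × Y × Z) → Fin (n / k) → Fin k → Z := fun ω i => seqZ (blocks k ω i) with hZb
  have hdescr : ∀ ω, c.descr ω = finProdFinEquiv (h₁ (Ub ω), h₂ (Vb ω)) := fun ω => rfl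
  have hkey : ∀ ω, c.key ω = h₃ (Vb ω) := fun ω => rfl
  have hZeq : ∀ ω ω' : Fin n → X × Y × Z, seqZ ω = seqZ ω' → Zb ω = Zb ω' := fun ω ω' h => by
    funext i j
    exact congrFun h (blockIndex n k (i, j))
  have hZeq' : ∀ ω ω' : Fin n → X × Y × Z, Zb ω = Zb ω' → tail k (seqZ ω) = tail k (seqZ ω') →
      seqZ ω = seqZ ω' := fun ω ω' h h' => eq_of_blocks_eq hk h h'
  have hXV : ∀ ω ω' : Fin n → X × Y × Z, seqX ω = seqX ω' → c.descr ω = c.descr ω' :=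
    fun ω ω' h => by rw [Code.descr, Code.descr, h]
  -- The letters after the last complete block are ignored by the code but seen by the adversary;
  -- their entropy is bounded by a constant independent of `n`.
  have htail : nent p (fun ω => tail k (seqZ ω)) ≤ k * Real.log (Fintype.card Z + 1) := by
    refine (nent_le_log_card_univ hp _).trans (le_of_eq ?_)
    rw [Fintype.card_fun, Fintype.card_option, Fintype.card_fin]
    push_cast
    rw [Real.log_pow]
  have hM2 : nent p (fun ω => h₂ (Vb ω)) ≤ Real.log k₂ := by
    have := nent_le_log_card_univ hp (fun ω => h₂ (Vb ω))
    rwa [Fintype.card_fin] at this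
  have hS : nent p c.key ≤ Real.log k₃ := by
    have := nent_le_log_card_univ hp c.key
    rwa [Fintype.card_fin] at this
  have hUZ : nent p (fun ω => (Ub ω, Zb ω)) =
      (n / k : ℕ) * nent (iidLaw P k) (fun ω => (fu (seqX ω), seqZ ω)) := by
    have e1 : nent p (fun ω => (Ub ω, Zb ω)) =
        nent p (fun ω i => (fu (seqX (blocks k ω i)), seqZ (blocks k ω i))) :=
      nent_congr hp.1 fun ω ω' => by
        simp only [hUb, hZb, Prod.mk.injEq, funext_iff (f := fun i => (_, _)), forall_and,
          funext_iff (f := fun i => fu _), funext_iff (f := fun i : Fin (n / k) => seqZ _)]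
    rw [e1, nent_blocks hP n k fun ω i => (fu (seqX (ω i)), seqZ (ω i)),
      nent_piLaw (fun _ => iidLaw_mem hP k) fun _ ω => (fu (seqX ω), seqZ ω)]
    simp
  have hVUZ : nent p (fun ω => (Vb ω, Ub ω, Zb ω)) =
      (n / k : ℕ) * nent (iidLaw P k) (fun ω => (fv (seqX ω), fu (seqX ω), seqZ ω)) := by
    have e1 : nent p (fun ω => (Vb ω, Ub ω, Zb ω)) =
        nent p (fun ω i => (fv (seqX (blocks k ω i)), fu (seqX (blocks k ω i)),
          seqZ (blocks k ω i))) :=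
      nent_congr hp.1 fun ω ω' => by
        simp only [hUb, hZb, hVb, Prod.mk.injEq, funext_iff (f := fun i => (_, _)), forall_and,
          funext_iff (f := fun i => fu _), funext_iff (f := fun i => fv _),
          funext_iff (f := fun i : Fin (n / k) => seqZ _)]
    rw [e1, nent_blocks hP n k fun ω i => (fv (seqX (ω i)), fu (seqX (ω i)), seqZ (ω i)),
      nent_piLaw (fun _ => iidLaw_mem hP k) fun _ ω => (fv (seqX ω), fu (seqX ω), seqZ ω)]
    simp
  -- The key, U, the second hash and Z almost determine V; hence they carry nearly the whole entropy
  -- H(V,U,Z).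
  have hfano : nent p (fun ω => (Vb ω, h₃ (Vb ω), Ub ω, h₂ (Vb ω), Zb ω)) -
      nent p (fun ω => (h₃ (Vb ω), Ub ω, h₂ (Vb ω), Zb ω)) ≤
        Real.log 2 + ε * ((n / k : ℕ) * Real.log (Fintype.card V)) := by
    refine (nent_fano hp Vb (fun ω => (h₃ (Vb ω), Ub ω, h₂ (Vb ω), Zb ω)) dec' univ
      (by simp)).trans ?_
    rw [card_univ, Fintype.card_fun, Fintype.card_fin, Nat.cast_pow, Real.log_pow]
    have h0 : 0 ≤ Real.log (Fintype.card V) := Real.log_natCast_nonneg _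
    have h1 := (prob_blocks hP n k {ω | dec' (h₃ fun i => fv (seqX (ω i)),
      fun i => fu (seqX (ω i)), h₂ fun i => fv (seqX (ω i)), fun i => seqZ (ω i)) ≠
        fun i => fv (seqX (ω i))}).trans_le hdec'
    simp only [Set.mem_ofPred_eq] at h1
    gcongr
  have hXZ : nent p (fun ω => (seqX ω, c.descr ω, seqZ ω)) = n * nent P (fun ω => (ω.1, ω.2.2)) := by
    have e1 : nent p (fun ω => (seqX ω, c.descr ω, seqZ ω)) =
        nent p (fun ω j => ((ω j).1, (ω j).2.2)) :=
      nent_congr hp.1 fun ω ω' => by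
        rw [funext_iff, Prod.mk.injEq, Prod.mk.injEq, seqZ_eq_iff]
        simp only [Prod.mk.injEq]
        exact ⟨fun h => ⟨seqX_eq_iff.2 fun j => (h j).1, hXV _ _ (seqX_eq_iff.2 fun j => (h j).1),
          fun j => (h j).2⟩, fun h j => ⟨seqX_eq_iff.1 h.1 j, h.2.2 j⟩⟩
    rw [e1]
    refine (nent_piLaw (fun _ : Fin n => hP) fun _ ω => (ω.1, ω.2.2)).trans ?_
    simp
  have hX : nent p seqX = n * nent P (fun ω => ω.1) := by
    refine (nent_piLaw (fun _ : Fin n => hP) fun _ ω => ω.1).trans ?_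
    simp
  have i1 : nent p (fun ω => (Ub ω, h₂ (Vb ω), seqZ ω)) ≤
      nent p (fun ω => (Ub ω, h₂ (Vb ω), Zb ω)) + nent p (fun ω => tail k (seqZ ω)) :=
    nent_subadd hp (by
      simp only [Prod.mk.injEq]
      exact fun ω ω' h h' => ⟨h.1, h.2.1, hZeq' _ _ h.2.2 h'⟩)
  have i2 : nent p (fun ω => (Ub ω, h₂ (Vb ω), Zb ω)) ≤
      nent p (fun ω => (Ub ω, Zb ω)) + nent p (fun ω => h₂ (Vb ω)) :=
    nent_subadd hp (by simp only [Prod.mk.injEq]; tauto)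
  -- From here on the adversary is granted the whole of U in place of its hash, which can only
  -- increase what is learnt.
  have i3 : nent p (fun ω => (c.descr ω, seqZ ω)) ≤ nent p (fun ω => (Ub ω, h₂ (Vb ω), seqZ ω)) :=
    nent_mono hp.1 fun ω ω' h => by
      simp only [Prod.mk.injEq] at h
      simp only [hdescr, h.1, h.2.1, h.2.2]
  have i4 : nent p (fun ω => (Vb ω, Ub ω, Zb ω)) ≤
      nent p (fun ω => (Vb ω, h₃ (Vb ω), Ub ω, h₂ (Vb ω), Zb ω)) :=
    nent_mono hp.1 (by simp only [Prod.mk.injEq]; tauto)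
  have i5 : nent p (fun ω => (h₃ (Vb ω), Ub ω, h₂ (Vb ω), Zb ω)) ≤
      nent p c.key + nent p (fun ω => (Ub ω, h₂ (Vb ω), Zb ω)) :=
    nent_subadd hp (by simp only [Prod.mk.injEq, hkey]; tauto)
  -- Data processing: the key leaks at most as much to (M, Zⁿ) as to (U, second hash, Zⁿ).
  have i6 : nent p (fun ω => (h₃ (Vb ω), Ub ω, h₂ (Vb ω), seqZ ω)) +
      nent p (fun ω => (c.descr ω, seqZ ω)) ≤ nent p (fun ω => (c.key ω, c.descr ω, seqZ ω)) +
        nent p (fun ω => (Ub ω, h₂ (Vb ω), seqZ ω)) :=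
    nent_submod hp.1 (by simp only [Prod.mk.injEq, hkey]; tauto)
      (by simp only [Prod.mk.injEq]; tauto)
      (fun ω ω' h => by
        simp only [Prod.mk.injEq] at h
        simp only [hdescr, h.1, h.2.1, h.2.2])
  have i7 : nent p (fun ω => (h₃ (Vb ω), Ub ω, h₂ (Vb ω), Zb ω)) ≤
      nent p (fun ω => (h₃ (Vb ω), Ub ω, h₂ (Vb ω), seqZ ω)) :=
    nent_mono hp.1 fun ω ω' h => by
      simp only [Prod.mk.injEq] at h ⊢
      exact ⟨h.1, h.2.1, h.2.2.1, hZeq _ _ h.2.2.2⟩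
  refine ⟨c, ?_, ?_, ?_, ?_, ?_⟩
  · have h1 := (prob_blocks hP n k {ω | dec ((h₁ fun i => fu (seqX (ω i)),
      h₂ fun i => fv (seqX (ω i))), fun i => seqY (ω i)) ≠ fun i => fv (seqX (ω i))}).trans_le hdec
    refine (prob_mono hp.1 fun ω _ hω => ?_).trans h1
    simp only [Set.mem_ofPred_eq] at hω ⊢
    intro heq
    refine hω ?_
    change h₃ (dec (finProdFinEquiv.symm (c.descr ω), blocks k (seqY ω))) = h₃ (Vb ω)
    rw [hdescr, Equiv.symm_apply_apply]
    exact congrArg h₃ heq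
  · change Real.log ((k₁ * k₂ : ℕ) : ℝ) = _
    rw [Nat.cast_mul, Real.log_mul (by positivity) (by positivity)]
  · rw [hXZ, hX]; linarith
  · linarith
  · linarith

end Blocks

/-! ### Greedy covering -/

section Covering

variable {Ω W : Type*} [Fintype Ω] [Fintype W]

/-- Greedy choice: a random codeword covers on average at least a fraction `ρ` of the part still
uncovered, so some codeword does, and each round multiplies the uncovered mass by at most `1 - ρ`.
-/
theorem exists_cover {P : Ω → ℝ} (hP : ∀ ω, 0 ≤ P ω) {q : W → ℝ} (hq : q ∈ stdSimplex ℝ W)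
    (T : Ω → W → Prop) (G : Set Ω) {ρ : ℝ} (hρ : ρ ≤ 1)
    (h : ∀ ω ∈ G, ρ ≤ prob q {w | T ω w}) (M : ℕ) : ∃ C : Finset W, C.card ≤ M ∧
      prob P {ω | ω ∈ G ∧ ∀ w ∈ C, ¬ T ω w} ≤ (1 - ρ) ^ M * prob P G := by
  induction M with
  | zero => exact ⟨∅, by simp, by simp⟩
  | succ M ih =>
    obtain ⟨C, hC, hle⟩ := ih
    set E : Set Ω := {ω | ω ∈ G ∧ ∀ w ∈ C, ¬ T ω w} with hE
    have h1 : ∑ w, q w * prob P {ω | ω ∈ E ∧ ¬ T ω w} ≤ (1 - ρ) * prob P E := by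
      simp only [prob_eq, mul_sum]
      rw [sum_comm]
      refine sum_le_sum fun ω _ => ?_
      by_cases hω : ω ∈ E
      · have h2 := h ω hω.1
        have h3 := prob_add_compl hq {w | T ω w}
        rw [if_pos hω]
        refine le_trans (b := prob q {w | T ω w}ᶜ * P ω) (le_of_eq ?_)
          (mul_le_mul_of_nonneg_right (by linarith) (hP ω))
        rw [prob_eq, sum_mul]
        refine sum_congr rfl fun w _ => ?_
        by_cases hT : T ω w <;> simp [hω, hT]
      · simp [hω]
    obtain ⟨w, hw⟩ := exists_le_of_sum_le hq h1
    refine ⟨insert w C, (card_insert_le _ _).trans (by omega), ?_⟩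
    have h5 : {ω | ω ∈ G ∧ ∀ w' ∈ insert w C, ¬ T ω w'} = {ω | ω ∈ E ∧ ¬ T ω w} := by
      ext ω
      simp only [hE, Set.mem_ofPred_eq, mem_insert, forall_eq_or_imp]
      tauto
    rw [h5, pow_succ', mul_assoc]
    exact hw.trans (mul_le_mul_of_nonneg_left hle (by linarith))

theorem one_sub_pow_le_exp {ρ : ℝ} (hρ : ρ ≤ 1) (M : ℕ) : (1 - ρ) ^ M ≤ Real.exp (-(ρ * M)) := by
  have h1 : 1 - ρ ≤ Real.exp (-ρ) := Real.one_sub_le_exp_neg ρ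
  calc (1 - ρ) ^ M ≤ Real.exp (-ρ) ^ M := pow_le_pow_left₀ (by linarith) h1 M
    _ = Real.exp (-(ρ * M)) := by rw [← Real.exp_nat_mul]; congr 1; ring

theorem prob_exists_le_sum {P : Ω → ℝ} (hP : ∀ ω, 0 ≤ P ω) (E : W → Set Ω) :
    prob P {ω | ∃ w, ω ∈ E w} ≤ ∑ w, prob P (E w) := by
  simp only [prob_eq]
  rw [sum_comm]
  refine sum_le_sum fun ω _ => ?_
  have h0 : ∀ w ∈ (univ : Finset W), 0 ≤ (if ω ∈ E w then P ω else 0) := fun w _ => by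
    split_ifs
    · exact hP ω
    · exact le_rfl
  by_cases h : ∃ w, ω ∈ E w
  · rw [if_pos (show ω ∈ {ω | ∃ w, ω ∈ E w} from h)]
    obtain ⟨w, hw⟩ := h
    have := single_le_sum h0 (mem_univ w)
    rwa [if_pos hw] at this
  · rw [if_neg (show ω ∉ {ω | ∃ w, ω ∈ E w} from h)]
    exact sum_nonneg h0

end Covering

/-! ### Robust typicality -/

section Typicality

variable {Ω D E A B W : Type*} [Fintype Ω] [Fintype D] [Fintype E] [Fintype A] [Fintype B]
  [Fintype W] {Q : D → ℝ} {n : ℕ} {ε : ℝ}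

/-- The number of occurrences of `d`. -/
noncomputable def occ (a : Fin n → D) (d : D) : ℝ := ∑ i, if a i = d then 1 else 0

/-- Robust typicality of a sequence. -/
def Typ (Q : D → ℝ) (ε : ℝ) (a : Fin n → D) : Prop := ∀ d, |occ a d - n * Q d| ≤ n * ε * Q d

theorem sum_occ_mul (a : Fin n → D) (φ : D → ℝ) : ∑ d, occ a d * φ d = ∑ i, φ (a i) := by
  simp only [occ, sum_mul, ite_mul, one_mul, zero_mul]
  rw [sum_comm]
  simp

/-- The tolerance is proportional to `Q d`, so letters of probability zero cannot occur. Logarithms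
of probabilities along typical sequences are therefore harmless. -/
theorem Typ.ne_zero {a : Fin n → D} (h : Typ Q ε a) (i : Fin n) : Q (a i) ≠ 0 := fun h0 => by
  have h1 := h (a i)
  rw [h0, mul_zero, mul_zero, sub_zero] at h1
  have h2 : (1 : ℝ) ≤ occ a (a i) := by
    have := single_le_sum (f := fun j => if a j = a i then (1 : ℝ) else 0)
      (fun j _ => by split_ifs <;> norm_num) (mem_univ i)
    simpa [occ] using this
  linarith [le_abs_self (occ a (a i))]

/-- The typical average lemma: empirical means of any function are controlled by weighting the
deviations of the letter counts. -/
theorem Typ.abs_sum_sub_le {a : Fin n → D} (h : Typ Q ε a) (φ : D → ℝ) :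
    |∑ i, φ (a i) - n * ∑ d, Q d * φ d| ≤ n * ε * ∑ d, Q d * |φ d| := by
  rw [← sum_occ_mul, mul_sum, ← sum_sub_distrib, mul_sum]
  refine (abs_sum_le_sum_abs _ _).trans (sum_le_sum fun d _ => ?_)
  rw [← mul_assoc, ← sub_mul, abs_mul, ← mul_assoc]
  exact mul_le_mul_of_nonneg_right (h d) (abs_nonneg _)

theorem Typ.law {a : Fin n → D} (h : Typ Q ε a) (f : D → E) :
    Typ (law Q f) ε (fun i => f (a i)) := fun e => by
  have h1 := h.abs_sum_sub_le (fun d => if f d = e then 1 else 0)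
  have h2 : ∑ d, Q d * (if f d = e then (1 : ℝ) else 0) = SecretKey.law Q f e := by simp [law_eq]
  have h3 : ∑ d, Q d * |if f d = e then (1 : ℝ) else 0| = SecretKey.law Q f e := by
    rw [← h2]
    exact sum_congr rfl fun d _ => by split_ifs <;> simp
  rw [h2, h3] at h1
  exact h1

variable {p : Ω → ℝ}

/-- Conditional typicality. -/
theorem eventually_prob_not_typ (hp : p ∈ stdSimplex ℝ Ω) (a : Ω → A) (w : Ω → W) {ε ε' η : ℝ}
    (hε : ε < ε') (hη : 0 < η) : ∀ᶠ n : ℕ in Filter.atTop, ∀ α : Fin n → A,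
      Typ (law p a) ε α → prob (piLaw fun i => condLaw p a w (α i))
        {β | ¬ Typ (law p fun ω => (a ω, w ω)) ε' fun i => (α i, β i)} ≤ η := by
  set Q := law p fun ω => (a ω, w ω) with hQ
  have hQ0 : ∀ d, 0 ≤ Q d := law_nonneg hp.1 _
  have hη' : 0 < η / (Fintype.card (A × W) + 1) := by positivity
  have hall : ∀ᶠ n : ℕ in Filter.atTop, ∀ d : A × W, 0 < Q d →
      (n : ℝ) / (n * ((ε' - ε) * Q d)) ^ 2 ≤ η / (Fintype.card (A × W) + 1) := by
    rw [Filter.eventually_all]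
    intro d
    by_cases hd : 0 < Q d
    · have hc : 0 < (ε' - ε) * Q d := mul_pos (sub_pos.2 hε) hd
      set c := (ε' - ε) * Q d
      filter_upwards [Filter.eventually_ge_atTop
        (⌈1 / (c ^ 2 * (η / (Fintype.card (A × W) + 1)))⌉₊ + 1)] with n hn _
      have hn0 : (0 : ℝ) < n := by exact_mod_cast (by omega : 0 < n)
      have h1 : 1 / (c ^ 2 * (η / (Fintype.card (A × W) + 1))) ≤ n := (Nat.le_ceil _).trans
        (by exact_mod_cast (by omega : ⌈1 / (c ^ 2 * (η / (Fintype.card (A × W) + 1)))⌉₊ ≤ n))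
      rw [div_le_iff₀ (by positivity)] at h1 ⊢
      nlinarith
    · exact Filter.Eventually.of_forall fun n h => absurd h hd
  filter_upwards [hall] with n hn α hα
  have hK : ∀ i, condLaw p a w (α i) ∈ stdSimplex ℝ W := fun i => condLaw_mem hp a w _
  have hd : ∀ d : A × W, prob (piLaw fun i => condLaw p a w (α i))
      {β | n * ε' * Q d < |occ (fun i => (α i, β i)) d - n * Q d|} ≤
        η / (Fintype.card (A × W) + 1) := fun d => by
    have hmul : law p a d.1 * condLaw p a w d.1 d.2 = Q d := law_mul_condLaw hp a w d.1 d.2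
    have hmean : ∑ i, ∑ b, condLaw p a w (α i) b * (if (α i, b) = d then 1 else 0) =
        occ α d.1 * condLaw p a w d.1 d.2 := by
      rw [occ, sum_mul]
      refine sum_congr rfl fun i _ => ?_
      by_cases hi : α i = d.1
      · rw [if_pos hi, one_mul, sum_eq_single d.2]
        · rw [if_pos (show (α i, d.2) = d from Prod.ext hi rfl), hi, mul_one]
        · intro b _ hb
          rw [if_neg fun h => hb (congrArg Prod.snd h), mul_zero]
        · simp
      · rw [if_neg hi, zero_mul]
        exact sum_eq_zero fun b _ => by rw [if_neg fun h => hi (congrArg Prod.fst h), mul_zero]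
    -- The expected count of `d` is already within the smaller tolerance `ε`, by typicality of `α`;
    -- Chebyshev only has to cover the gap `ε' - ε`.
    have hdev : |occ α d.1 * condLaw p a w d.1 d.2 - n * Q d| ≤ n * ε * Q d := by
      have h1 := mul_le_mul_of_nonneg_right (hα d.1) ((condLaw_mem hp a w d.1).1 d.2)
      rw [← abs_of_nonneg ((condLaw_mem hp a w d.1).1 d.2), ← abs_mul,
        abs_of_nonneg ((condLaw_mem hp a w d.1).1 d.2), sub_mul, mul_assoc, mul_assoc (n * ε),
        hmul] at h1
      exact h1
    -- At letters of probability zero the tolerance vanishes and Chebyshev is useless, but such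
    -- letters almost surely never occur.
    rcases (hQ0 d).eq_or_lt with h0 | h0
    · have hz : prob (piLaw fun i => condLaw p a w (α i))
          {β | n * ε' * Q d < |occ (fun i => (α i, β i)) d - n * Q d|} = 0 := by
        refine sum_eq_zero fun β _ => ?_
        split_ifs with hβ
        · by_contra hne
          have hpos := (piLaw_nonneg (fun i => (hK i).1) β).lt_of_ne' hne
          rw [piLaw_pos_iff fun i => (hK i).1] at hpos
          rw [Set.mem_ofPred_eq, ← h0, mul_zero, mul_zero, sub_zero] at hβ
          have hocc : occ (fun i => (α i, β i)) d = 0 := by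
            refine sum_eq_zero fun i _ => if_neg fun hi => ?_
            have h2 := hα.ne_zero i
            have h3 := hpos i
            rw [← hi] at hmul h0
            rw [← h0] at hmul
            exact (mul_ne_zero h2 h3.ne') hmul
          rw [hocc, abs_zero] at hβ
          exact hβ.false
        · rfl
      rw [hz]; exact hη'.le
    · have hc : 0 < (ε' - ε) * Q d := mul_pos (sub_pos.2 hε) h0
      rcases Nat.eq_zero_or_pos n with hn0 | hn0
      · subst hn0
        refine (le_of_eq (sum_eq_zero fun β _ => if_neg ?_)).trans hη'.le
        simp [occ]
      have hn1 : (0 : ℝ) < n := by exact_mod_cast hn0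
      have hcheb := prob_chebyshev hK (fun i b => if (α i, b) = d then 1 else 0)
        (t := n * ((ε' - ε) * Q d)) (by positivity)
      have hocc : ∀ β : Fin n → W, (∑ i, if (α i, β i) = d then (1 : ℝ) else 0) =
          occ (fun i => (α i, β i)) d := fun β =>
        sum_congr rfl fun i _ => by by_cases h : (α i, β i) = d <;> simp [h]
      simp only [hocc] at hcheb
      rw [hmean] at hcheb
      refine (prob_mono (piLaw_mem hK).1 fun β _ hβ => ?_).trans (hcheb.trans
        (le_trans ?_ (hn d h0)))
      · rw [Set.mem_ofPred_eq] at hβ ⊢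
        have h5 := abs_sub_abs_le_abs_sub (occ (fun i => (α i, β i)) d - n * Q d)
          (occ α d.1 * condLaw p a w d.1 d.2 - n * Q d)
        rw [sub_sub_sub_cancel_right] at h5
        nlinarith
      · gcongr
        calc _ ≤ ∑ i : Fin n, ∑ b, condLaw p a w (α i) b * 1 := by
              refine sum_le_sum fun i _ => sum_le_sum fun b _ =>
                mul_le_mul_of_nonneg_left ?_ ((hK i).1 b)
              split_ifs <;> norm_num
          _ = n := by simp [(hK _).2]
  have hun := prob_exists_le_sum (piLaw_mem hK).1
    (fun d : A × W => {β : Fin n → W | n * ε' * Q d < |occ (fun i => (α i, β i)) d - n * Q d|})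
  have hsub : {β : Fin n → W | ¬ Typ Q ε' fun i => (α i, β i)} = {β | ∃ d, β ∈
      {β : Fin n → W | n * ε' * Q d < |occ (fun i => (α i, β i)) d - n * Q d|}} := by
    ext β
    simp only [Typ, Set.mem_ofPred_eq, not_forall, not_le]
  rw [hsub]
  refine hun.trans ((sum_le_sum fun d _ => hd d).trans ?_)
  rw [sum_const, card_univ, nsmul_eq_mul, mul_div_assoc', div_le_iff₀ (by positivity)]
  nlinarith

/-- A lower bound for the probability of joint typicality under a mismatched channel. -/
theorem le_prob_typ (hp : p ∈ stdSimplex ℝ Ω) (a : Ω → A) (w : Ω → W) (g : A → B) :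
    ∃ c : ℝ, 0 ≤ c ∧ ∀ (n : ℕ) (ε : ℝ) (α : Fin n → A),
      prob (piLaw fun i => condLaw p a w (α i))
        {β | ¬ Typ (law p fun ω => (a ω, w ω)) ε fun i => (α i, β i)} ≤ 1 / 2 →
      1 / 2 * Real.exp (-(n * (nent p a + nent p (fun ω => (g (a ω), w ω)) -
        nent p (fun ω => (a ω, w ω)) - nent p (fun ω => g (a ω)) + ε * c))) ≤
      prob (piLaw fun i => condLaw p (fun ω => g (a ω)) w (g (α i)))
        {β | Typ (law p fun ω => (a ω, w ω)) ε fun i => (α i, β i)} := by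
  set Q := law p fun ω => (a ω, w ω) with hQ
  set κ := condLaw p a w with hκ
  set ρ := condLaw p (fun ω => g (a ω)) w with hρ
  -- Log-likelihood ratio between the true channel and the one seeing only `g (a)`; its mean is I(a;
  -- w | g(a)).
  set ψ : A × W → ℝ := fun d => Real.log (κ d.1 d.2) - Real.log (ρ (g d.1) d.2) with hψ
  have hQ0 : ∀ d, 0 ≤ Q d := law_nonneg hp.1 _
  have hpos : ∀ d : A × W, 0 < Q d → 0 < law p a d.1 ∧ 0 < κ d.1 d.2 ∧
      0 < law p (fun ω => g (a ω)) (g d.1) ∧ 0 < ρ (g d.1) d.2 := fun d hd => by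
    have h1 : law p a d.1 * κ d.1 d.2 = Q d := law_mul_condLaw hp a w d.1 d.2
    have h2 := law_mul_condLaw hp (fun ω => g (a ω)) w (g d.1) d.2
    have h3 : Q d ≤ law p (fun ω => (g (a ω), w ω)) (g d.1, d.2) :=
      prob_mono hp.1 fun ω _ h => by
        have h' : (a ω, w ω) = d := h
        change (g (a ω), w ω) = (g d.1, d.2)
        rw [← h']
    have h4 := hd.trans_le h3
    rw [← h2] at h4
    rw [← h1] at hd
    exact ⟨pos_of_mul_pos_left hd ((condLaw_mem hp _ _ _).1 _),
      pos_of_mul_pos_right hd (law_nonneg hp.1 _ _),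
      pos_of_mul_pos_left h4 ((condLaw_mem hp _ _ _).1 _),
      pos_of_mul_pos_right h4 (law_nonneg hp.1 _ _)⟩
  have hI : ∑ d, Q d * ψ d = nent p a + nent p (fun ω => (g (a ω), w ω)) -
        nent p (fun ω => (a ω, w ω)) - nent p (fun ω => g (a ω)) := by
    rw [hQ, sum_law_mul, nent_eq, nent_eq, nent_eq, nent_eq, ← sum_add_distrib, ← sum_sub_distrib,
      ← sum_sub_distrib]
    refine sum_congr rfl fun ω _ => ?_
    rcases (hp.1 ω).eq_or_lt with h0 | h0
    · simp [← h0]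
    · obtain ⟨h1, h2, h3, h4⟩ := hpos (a ω, w ω) (h0.trans_le (le_law hp.1 (fun ω => (a ω, w ω)) ω))
      rw [← law_mul_condLaw hp a w, ← law_mul_condLaw hp (fun ω => g (a ω)) w,
        Real.log_mul h1.ne' h2.ne', Real.log_mul h3.ne' h4.ne']
      simp only [hψ, hκ, hρ]
      ring
  refine ⟨∑ d, Q d * |ψ d|, sum_nonneg fun d _ => mul_nonneg (hQ0 d) (abs_nonneg _),
    fun n ε α hα => ?_⟩
  rw [← hI]
  set s := n * (∑ d, Q d * ψ d + ε * ∑ d, Q d * |ψ d|) with hs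
  have hcompl := prob_add_compl (piLaw_mem fun i => condLaw_mem hp a w (α i))
    {β | Typ Q ε fun i => (α i, β i)}
  have hα' : 1 / 2 ≤ prob (piLaw fun i => κ (α i)) {β | Typ Q ε fun i => (α i, β i)} := by
    have h0 : {β : Fin n → W | Typ Q ε fun i => (α i, β i)}ᶜ =
        {β | ¬ Typ Q ε fun i => (α i, β i)} := by
      ext β
      simp only [Set.mem_compl_iff, Set.mem_ofPred_eq]
    rw [h0] at hcompl
    linarith
  -- Change of measure: on typical sequences the true law exceeds the mismatched law by a factor of
  -- at most `exp s`, and the typical set has true probability at least one half.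
  refine (mul_le_mul_of_nonneg_right hα' (Real.exp_nonneg _)).trans ?_
  rw [prob_eq, prob_eq, sum_mul]
  refine sum_le_sum fun β _ => ?_
  by_cases hβ : β ∈ {β | Typ Q ε fun i => (α i, β i)}
  · rw [if_pos hβ, if_pos hβ]
    have hT : Typ Q ε fun i => (α i, β i) := hβ
    have h1 : ∀ i, 0 < Q (α i, β i) := fun i => (hQ0 _).lt_of_ne' (hT.ne_zero i)
    have h2 := (le_abs_self _).trans (hT.abs_sum_sub_le ψ)
    have h3 : Real.log (piLaw (fun i => κ (α i)) β) - Real.log (piLaw (fun i => ρ (g (α i))) β) =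
        ∑ i, ψ (α i, β i) := by
      rw [piLaw, piLaw, Real.log_prod fun i _ => (hpos _ (h1 i)).2.1.ne',
        Real.log_prod fun i _ => (hpos _ (h1 i)).2.2.2.ne', ← sum_sub_distrib]
    have hk : 0 < piLaw (fun i => κ (α i)) β := prod_pos fun i _ => (hpos _ (h1 i)).2.1
    have hr : 0 < piLaw (fun i => ρ (g (α i))) β := prod_pos fun i _ => (hpos _ (h1 i)).2.2.2
    rw [← Real.log_le_log_iff (by positivity) hr, Real.log_mul hk.ne' (Real.exp_pos _).ne',
      Real.log_exp]
    have h4 : s = n * ∑ d, Q d * ψ d + n * ε * ∑ d, Q d * |ψ d| := by rw [hs]; ring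
    linarith
  · rw [if_neg hβ, if_neg hβ, zero_mul]

end Typicality

/-! ### Two-level covering by typical sequences -/

section Quantization

variable {Ω A B W X U V : Type*} [Fintype Ω] [Fintype A] [Fintype B] [Fintype W] [Fintype X]
  [Fintype U] [Fintype V] {p : Ω → ℝ}

/-- Sequences that are typical with sequences of a fixed type can be covered by a small code. -/
theorem exists_typ_cover (hp : p ∈ stdSimplex ℝ Ω) (a : Ω → A) (w : Ω → W) (g : A → B) :
    ∃ c : ℝ, 0 ≤ c ∧ ∀ ε ε' γ η : ℝ, 0 ≤ ε → ε < ε' → ε' * c < γ → 0 < η →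
      ∀ᶠ n : ℕ in Filter.atTop, ∀ (P : (Fin n → X) → ℝ) (G : Set (Fin n → X))
        (α : (Fin n → X) → Fin n → A) (b : Fin n → B), (∀ x, 0 ≤ P x) →
        (∀ x ∈ G, Typ (law p a) ε (α x) ∧ ∀ i, g (α x i) = b i) →
        ∃ C : Finset (Fin n → W), (C.card : ℝ) ≤
            Real.exp (n * (nent p a + nent p (fun ω => (g (a ω), w ω)) -
              nent p (fun ω => (a ω, w ω)) - nent p (fun ω => g (a ω)) + γ)) ∧
          prob P {x | x ∈ G ∧ ∀ β ∈ C, ¬ Typ (law p fun ω => (a ω, w ω)) ε' fun i => (α x i, β i)} ≤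
            η * prob P G := by
  obtain ⟨c, hc, hle⟩ := le_prob_typ hp a w g
  refine ⟨c, hc, fun ε ε' γ η hε0 hε hγ hη => ?_⟩
  set I := nent p a + nent p (fun ω => (g (a ω), w ω)) -
    nent p (fun ω => (a ω, w ω)) - nent p (fun ω => g (a ω)) with hI
  have hI0 : 0 ≤ I := by
    have := nent_submod hp.1 (j := fun ω => (a ω, w ω)) (m := fun ω => g (a ω)) (a := a)
      (b := fun ω => (g (a ω), w ω))
      (fun ω ω' h1 h2 => by simp only [Prod.mk.injEq] at h2 ⊢; exact ⟨h1, h2.2⟩)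
      (fun ω ω' h => by rw [h]) (fun ω ω' h => by simp only [Prod.mk.injEq] at h; exact h.1)
    linarith
  have hεc : 0 ≤ ε' * c := mul_nonneg (by linarith) hc
  filter_upwards [eventually_prob_not_typ hp a w hε (by norm_num : (0 : ℝ) < 1 / 2),
    eventually_mul_exp_neg_le (sub_pos.2 hγ) hη 4] with n h1 h2 P G α b hP hG
  set s := n * (I + γ) with hs
  have hs0 : 0 ≤ s := mul_nonneg n.cast_nonneg (by linarith)
  obtain ⟨hM1, -, hMinv⟩ := floor_exp_bounds hs0
  set M := ⌊Real.exp s⌋₊ with hM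
  set ρ := 1 / 2 * Real.exp (-(n * (I + ε' * c))) with hρ
  have hρ1 : ρ ≤ 1 := by
    have : Real.exp (-(n * (I + ε' * c))) ≤ 1 :=
      Real.exp_le_one_iff.2 (neg_nonpos.2 (mul_nonneg n.cast_nonneg (by linarith)))
    rw [hρ]; linarith
  obtain ⟨C, hC, hcov⟩ := exists_cover hP
    (q := piLaw fun i => condLaw p (fun ω => g (a ω)) w (b i))
    (piLaw_mem fun i => condLaw_mem hp _ _ _)
    (fun x β => Typ (law p fun ω => (a ω, w ω)) ε' fun i => (α x i, β i)) G hρ1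
    (fun x hx => by
      have h3 := hle n ε' (α x) (h1 (α x) (hG x hx).1)
      simp only [(hG x hx).2] at h3
      exact h3) M
  refine ⟨C, (Nat.cast_le.2 hC).trans (Nat.floor_le (Real.exp_nonneg _)), hcov.trans ?_⟩
  refine mul_le_mul_of_nonneg_right ((one_sub_pow_le_exp hρ1 M).trans ?_) (prob_nonneg hP _)
  have hMpos : (0 : ℝ) < M := by exact_mod_cast hM1
  have hρpos : 0 < ρ := by positivity
  -- The crude bound `1 / (ρ M)` suffices, because `ρ M` already grows exponentially.
  have h4 : Real.exp (-(ρ * M)) ≤ (ρ * M)⁻¹ := by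
    rw [Real.exp_neg]
    exact inv_anti₀ (by positivity) ((by linarith : ρ * M ≤ ρ * M + 1).trans (Real.add_one_le_exp _))
  have h5 : (ρ * M)⁻¹ ≤ 4 * Real.exp (-(n * (γ - ε' * c))) := by
    rw [mul_inv]
    have h6 : ρ⁻¹ = 2 * Real.exp (n * (I + ε' * c)) := by
      rw [hρ, mul_inv, ← Real.exp_neg, neg_neg]; norm_num
    rw [h6]
    refine (mul_le_mul_of_nonneg_left hMinv (by positivity)).trans (le_of_eq ?_)
    rw [show -(n * (γ - ε' * c)) = n * (I + ε' * c) + -s by rw [hs]; ring, Real.exp_add]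
    ring
  linarith

theorem law_const (hp : p ∈ stdSimplex ℝ Ω) : law p (fun _ => ()) () = 1 := by
  simp [law_eq, hp.2]

theorem eventually_prob_not_typ_iid (hp : p ∈ stdSimplex ℝ Ω) (w : Ω → W) {ε η : ℝ}
    (hε : 0 < ε) (hη : 0 < η) : ∀ᶠ n : ℕ in Filter.atTop,
      prob (piLaw fun _ : Fin n => law p w) {β | ¬ Typ (law p w) ε β} ≤ η := by
  filter_upwards [eventually_prob_not_typ hp (fun _ => ()) w hε hη] with n hn
  have h1 : condLaw p (fun _ => ()) w () = law p w := by
    funext b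
    have := law_mul_condLaw hp (fun _ => ()) w () b
    rw [law_const hp, one_mul] at this
    rw [this]
    simp [law_eq]
  have h2 := hn (fun _ => ()) (fun d => by
    have : occ (fun _ : Fin n => ()) d = n := by simp [occ]
    rw [this, show d = () from rfl, law_const hp]; simp)
  rw [h1] at h2
  refine (prob_mono (piLaw_mem fun _ => law_mem hp w).1 fun β _ (hβ : ¬ Typ (law p w) ε β)
    (hT : Typ (law p fun ω => ((), w ω)) ε fun i => ((), β i)) => hβ ?_).trans h2
  have h3 := hT.law Prod.snd
  rwa [law_law] at h3

/-- A deterministic two-level quantizer with jointly typical outputs. -/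
theorem eventually_exists_quantizer (hp : p ∈ stdSimplex ℝ Ω) (x : Ω → X) (u : Ω → U) (v : Ω → V)
    {δ : ℝ} (hδ : 0 < δ) : ∀ᶠ n : ℕ in Filter.atTop,
      ∃ enc : (Fin n → X) → Option ((Fin n → U) × (Fin n → V)),
        (∀ a s, enc a = some s → Typ (law p fun ω => ((x ω, u ω), v ω)) δ
          fun i => ((a i, s.1 i), s.2 i)) ∧
        prob (piLaw fun _ => law p x) {a | enc a = none} ≤ δ ∧
        Real.log ((univ.image fun a => (enc a).map Prod.fst).card : ℝ) ≤
          n * (nent p x + nent p u - nent p (fun ω => (x ω, u ω)) + δ) ∧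
        Real.log ((univ.image enc).card : ℝ) ≤
          n * (nent p x + nent p (fun ω => (u ω, v ω)) -
            nent p (fun ω => ((x ω, u ω), v ω)) + δ) := by
  obtain ⟨c₁, hc₁, H₁⟩ := exists_typ_cover (X := X) hp x u (fun _ => ())
  obtain ⟨c₂, hc₂, H₂⟩ := exists_typ_cover (X := X) hp (fun ω => (x ω, u ω)) v Prod.snd
  obtain ⟨ε, hε, hεδ, hεc₁, hεc₂⟩ : ∃ ε : ℝ, 0 < ε ∧ ε ≤ δ ∧ ε * c₁ < δ / 4 ∧ ε * c₂ < δ / 4 := by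
    refine ⟨min δ (δ / (8 * (c₁ + c₂ + 1))), by positivity, min_le_left _ _, ?_, ?_⟩ <;>
    · have h1 : min δ (δ / (8 * (c₁ + c₂ + 1))) ≤ δ / (8 * (c₁ + c₂ + 1)) := min_le_right _ _
      rw [le_div_iff₀ (by positivity)] at h1
      have h2 : 0 < min δ (δ / (8 * (c₁ + c₂ + 1))) := by positivity
      nlinarith
  -- The tolerance doubles at each stage, ε/4 for X, ε/2 for (X, U), ε for (X, U, V), and each stage
  -- fails with probability at most δ/3. Both covers have rate slack δ/4; the remaining δ/2 absorbs
  -- the extra symbol `none`.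
  filter_upwards [eventually_prob_not_typ_iid hp x (show 0 < ε / 4 by positivity)
      (show 0 < δ / 3 by positivity),
    H₁ (ε / 4) (ε / 2) (δ / 4) (δ / 3) (by positivity) (by linarith) (by nlinarith) (by positivity),
    H₂ (ε / 2) ε (δ / 4) (δ / 3) (by positivity) (by linarith) (by linarith) (by positivity),
    Filter.eventually_ge_atTop ⌈2 / δ⌉₊] with n h0 h1 h2 hn
  have hlog2 : Real.log 2 ≤ n * (δ / 2) := by
    have h3 : 2 / δ ≤ n := (Nat.le_ceil _).trans (Nat.cast_le.2 hn)
    rw [div_le_iff₀ hδ] at h3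
    linarith [Real.log_two_lt_d9]
  set μ := piLaw fun _ : Fin n => law p x with hμ
  have hμ' : μ ∈ stdSimplex ℝ (Fin n → X) := piLaw_mem fun _ => law_mem hp x
  obtain ⟨C₁, hC₁, hcov₁⟩ := h1 μ {a | Typ (law p x) (ε / 4) a} id (fun _ => ()) hμ'.1
    (fun a ha => ⟨ha, fun _ => rfl⟩)
  set T₁ : (Fin n → X) → (Fin n → U) → Prop := fun a s =>
    Typ (law p fun ω => (x ω, u ω)) (ε / 2) fun i => (a i, s i) with hT₁
  set fu : (Fin n → X) → Option (Fin n → U) := fun a =>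
    if h : ∃ s ∈ C₁, T₁ a s then some h.choose else none with hfu
  have hfu_some : ∀ a s, fu a = some s → s ∈ C₁ ∧ T₁ a s := fun a s h => by
    simp only [hfu] at h
    split_ifs at h with h'
    rw [← Option.some.inj h]
    exact h'.choose_spec
  have hfu_none : ∀ a, fu a = none → ∀ s ∈ C₁, ¬ T₁ a s := fun a h s hs hT => by
    simp only [hfu] at h
    rw [dif_pos ⟨s, hs, hT⟩] at h
    cases h
  -- A separate second-level code for every U-codeword `s`, covering the source sequences quantized
  -- to `s`. The failure probabilities, proportional to the masses of these cells, add up to at most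
  -- δ/3.
  have h2' := fun s : Fin n → U => h2 μ {a | fu a = some s} (fun a i => (a i, s i)) s hμ'.1
    (fun a ha => ⟨(hfu_some a s ha).2, fun _ => rfl⟩)
  choose C₂ hC₂ hcov₂ using h2'
  set T₂ : (Fin n → X) → (Fin n → U) × (Fin n → V) → Prop := fun a s =>
    Typ (law p fun ω => ((x ω, u ω), v ω)) ε fun i => ((a i, s.1 i), s.2 i) with hT₂
  set enc : (Fin n → X) → Option ((Fin n → U) × (Fin n → V)) := fun a =>
    if h : ∃ s, (fu a = some s.1 ∧ s.2 ∈ C₂ s.1) ∧ T₂ a s then some h.choose else none with henc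
  have henc_some : ∀ a s, enc a = some s → (fu a = some s.1 ∧ s.2 ∈ C₂ s.1) ∧ T₂ a s :=
    fun a s h => by
      simp only [henc] at h
      split_ifs at h with h'
      rw [← Option.some.inj h]
      exact h'.choose_spec
  have henc_none : ∀ a, enc a = none → ∀ s, fu a = some s → ∀ t ∈ C₂ s, ¬ T₂ a (s, t) :=
    fun a h s hs t ht hT => by
      simp only [henc] at h
      rw [dif_pos ⟨(s, t), ⟨hs, ht⟩, hT⟩] at h
      cases h
  have hexp : ∀ {m : ℕ} {r : ℝ}, (m : ℝ) ≤ Real.exp r → 0 ≤ r → Real.log ((1 + m : ℕ) : ℝ) ≤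
      Real.log 2 + r := fun {m r} h hr => by
    rw [← Real.log_exp r, ← Real.log_mul (by norm_num) (Real.exp_pos _).ne']
    refine Real.log_le_log (by positivity) ?_
    have := Real.one_le_exp hr
    push_cast
    linarith
  have hI1 : 0 ≤ nent p x + nent p u - nent p (fun ω => (x ω, u ω)) := by
    have := nent_subadd hp (j := fun ω => (x ω, u ω)) (a := x) (b := u)
      (fun ω ω' h1 h2 => by rw [h1, h2])
    linarith
  have hI2 : 0 ≤ nent p x + nent p (fun ω => (u ω, v ω)) -
      nent p (fun ω => ((x ω, u ω), v ω)) := by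
    have := nent_subadd hp (j := fun ω => ((x ω, u ω), v ω)) (a := x) (b := fun ω => (u ω, v ω))
      (fun ω ω' h1 h2 => by simp only [Prod.mk.injEq] at h2 ⊢; tauto)
    linarith
  have hn0 : (0 : ℝ) ≤ n := n.cast_nonneg
  have e1 : nent p x + nent p (fun ω => ((), u ω)) - nent p (fun ω => (x ω, u ω)) -
      nent p (fun _ => ()) = nent p x + nent p u - nent p (fun ω => (x ω, u ω)) := by
    rw [nent_const hp, nent_congr hp.1 (f := fun ω => ((), u ω)) (g := u) (by simp)]
    ring
  rw [e1] at hC₁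
  refine ⟨enc, fun a s h d => ((henc_some a s h).2 d).trans ?_, ?_, ?_, ?_⟩
  · refine mul_le_mul_of_nonneg_right ?_ (law_nonneg hp.1 _ _)
    exact mul_le_mul_of_nonneg_left hεδ hn0
  · set E : (Fin n → U) → Set (Fin n → X) := fun s => {a | a ∈ {a | fu a = some s} ∧ ∀ t ∈ C₂ s,
      ¬ Typ (law p fun ω => ((x ω, u ω), v ω)) ε fun i => ((a i, s i), t i)} with hE
    have h3 : prob μ {a | ∃ s, a ∈ E s} ≤ δ / 3 := by
      refine (prob_exists_le_sum hμ'.1 E).trans ((sum_le_sum fun s _ => hcov₂ s).trans ?_)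
      rw [← mul_sum]
      have h4 := sum_law μ fu
      rw [hμ'.2, Fintype.sum_option] at h4
      have h5 := law_nonneg hμ'.1 fu none
      have h6 : ∑ s, prob μ {a | fu a = some s} ≤ 1 := by
        change _ + ∑ s, prob μ {a | fu a = some s} = 1 at h4
        linarith
      nlinarith
    have h4 : prob μ {a | a ∈ {a | Typ (law p x) (ε / 4) a} ∧ ∀ s ∈ C₁, ¬ T₁ a s} ≤ δ / 3 := by
      refine le_trans hcov₁ ?_
      have := prob_le_one hμ' {a | Typ (law p x) (ε / 4) a}
      nlinarith
    have h5 := prob_le_add hμ'.1 (E := {a | enc a = none}) (F := {a | ¬ Typ (law p x) (ε / 4) a})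
      (G := {a | (a ∈ {a | Typ (law p x) (ε / 4) a} ∧ ∀ s ∈ C₁, ¬ T₁ a s) ∨ ∃ s, a ∈ E s})
      (fun a _ ha => by
        by_cases hT : Typ (law p x) (ε / 4) a
        · right
          rcases hf : fu a with _ | s
          · exact Or.inl ⟨hT, hfu_none a hf⟩
          · exact Or.inr ⟨s, hf, henc_none a ha s hf⟩
        · exact Or.inl hT)
    have h6 := prob_le_add hμ'.1
      (E := {a | (a ∈ {a | Typ (law p x) (ε / 4) a} ∧ ∀ s ∈ C₁, ¬ T₁ a s) ∨ ∃ s, a ∈ E s})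
      (F := {a | a ∈ {a | Typ (law p x) (ε / 4) a} ∧ ∀ s ∈ C₁, ¬ T₁ a s})
      (G := {a | ∃ s, a ∈ E s}) (fun a _ ha => ha)
    linarith
  · have h3 : (univ.image fun a => (enc a).map Prod.fst).card ≤ 1 + C₁.card := by
      have h4 : (univ.image fun a => (enc a).map Prod.fst) ⊆ {none} ∪ C₁.image some := by
        intro o ho
        obtain ⟨a, -, rfl⟩ := mem_image.1 ho
        rcases h : enc a with _ | s
        · simp
        · simp [(hfu_some a s.1 (henc_some a s h).1.1).1]
      refine (card_le_card h4).trans ((card_union_le _ _).trans ?_)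
      simpa using card_image_le
    rcases Nat.eq_zero_or_pos (univ.image fun a => (enc a).map Prod.fst).card with h0 | h0
    · rw [h0, Nat.cast_zero, Real.log_zero]
      exact mul_nonneg hn0 (by linarith)
    · refine (Real.log_le_log (by exact_mod_cast h0) (Nat.cast_le.2 h3)).trans
        ((hexp hC₁ (mul_nonneg hn0 (by linarith))).trans ?_)
      linarith [mul_nonneg hn0 hδ.le]
  · have h3 : (univ.image enc).card ≤ 1 + ∑ s ∈ C₁, (C₂ s).card := by
      have h4 : univ.image enc ⊆ {none} ∪ C₁.biUnion fun s => (C₂ s).image fun t => some (s, t) := by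
        intro o ho
        obtain ⟨a, -, rfl⟩ := mem_image.1 ho
        rcases h : enc a with _ | s
        · simp
        · have h5 := henc_some a s h
          refine mem_union_right _ (mem_biUnion.2 ⟨s.1, (hfu_some a s.1 h5.1.1).1, ?_⟩)
          exact mem_image.2 ⟨s.2, h5.1.2, rfl⟩
      refine (card_le_card h4).trans ((card_union_le _ _).trans ?_)
      rw [card_singleton]
      exact Nat.add_le_add_left (card_biUnion_le.trans (sum_le_sum fun s _ => card_image_le)) 1
    have h4 : ((∑ s ∈ C₁, (C₂ s).card : ℕ) : ℝ) ≤
        Real.exp (n * (nent p x + nent p (fun ω => (u ω, v ω)) -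
            nent p (fun ω => ((x ω, u ω), v ω)) + δ / 2)) := by
      push_cast
      refine (sum_le_sum fun s _ => hC₂ s).trans ?_
      rw [sum_const, nsmul_eq_mul]
      refine (mul_le_mul_of_nonneg_right hC₁ (Real.exp_nonneg _)).trans (le_of_eq ?_)
      rw [← Real.exp_add]
      congr 1
      ring
    rcases Nat.eq_zero_or_pos (univ.image enc).card with h0 | h0
    · rw [h0, Nat.cast_zero, Real.log_zero]
      exact mul_nonneg hn0 (by linarith)
    · refine (Real.log_le_log (by exact_mod_cast h0) (Nat.cast_le.2 h3)).trans
        ((hexp h4 (mul_nonneg hn0 (by linarith))).trans ?_)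
      linarith

end Quantization

/-! ### Entropies of quantized sequences -/

section Superletters

variable {O X S F G T : Type*} [Fintype O] [Fintype X] [Fintype S] [Fintype F] [Fintype G]
  [Fintype T] {P : O → ℝ} {K : X → S → ℝ} {n : ℕ} {δ : ℝ}

theorem law_extLaw_input (P : O → ℝ) (K : X → S → ℝ) (π : O → X) (a : X) (s : S) :
    law (extLaw P fun o => K (π o)) (fun w => (π w.1, w.2)) (a, s) = law P π a * K a s := by
  simp only [law_eq, extLaw, Fintype.sum_prod_type, Prod.mk.injEq, sum_mul]
  refine sum_congr rfl fun o _ => ?_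
  by_cases h : π o = a <;> simp [h]

/-- The X-sequence is drawn first and the full letters afterwards, independently given X; quantizer
outputs are then constants in the inner mean. -/
theorem sum_piLaw_condition (hP : P ∈ stdSimplex ℝ O) (π : O → X)
    (φ : (Fin n → X) → (Fin n → O) → ℝ) :
    ∑ ω, piLaw (fun _ => P) ω * φ (fun i => π (ω i)) ω =
      ∑ a, piLaw (fun _ => law P π) a * ∑ ω, piLaw (fun i => condLaw P π id (a i)) ω * φ a ω := by
  simp only [mul_sum]
  rw [sum_comm]
  refine sum_congr rfl fun ω _ => ?_
  have h1 : ∀ a : Fin n → X, piLaw (fun _ => law P π) a * piLaw (fun i => condLaw P π id (a i)) ω =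
      ∏ i, law P (fun o => (π o, o)) (a i, ω i) := fun a => by
    rw [piLaw, piLaw, ← prod_mul_distrib]
    exact prod_congr rfl fun i _ => law_mul_condLaw hP π id (a i) (ω i)
  have h2 : ∀ x o, law P (fun o => (π o, o)) (x, o) = if π o = x then P o else 0 := fun x o => by
    rw [law_eq, sum_eq_single o]
    · by_cases h : π o = x <;> simp [h]
    · intro o' _ h
      rw [if_neg fun h' => h (congrArg Prod.snd h')]
    · simp
  rw [sum_eq_single fun i => π (ω i)]
  · rw [← mul_assoc, h1]
    simp only [h2, if_true]
    rfl
  · intro a _ ha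
    rw [← mul_assoc, h1]
    obtain ⟨i, hi⟩ := Function.ne_iff.1 ha
    rw [prod_eq_zero (mem_univ i), zero_mul]
    rw [h2, if_neg fun h => hi h.symm]
  · simp

/-- An upper bound for conditional entropies given a typical quantization of the input. -/
theorem nent_quantized_sub_le (hP : P ∈ stdSimplex ℝ O) (hK : ∀ x, K x ∈ stdSimplex ℝ S) (π : O → X)
    (f : O → F) (g : O → G) (t : (Fin n → X) → T) (σ : T → Option (Fin n → S)) (hδ : 0 ≤ δ)
    (hσ : ∀ a s, σ (t a) = some s →
      Typ (law (extLaw P fun o => K (π o)) fun w => (π w.1, w.2)) δ fun i => (a i, s i))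
    (hnone : prob (piLaw fun _ => law P π) {a | σ (t a) = none} ≤ δ) :
    nent (piLaw fun _ => P) (fun ω => ((fun i => f (ω i)), (fun i => g (ω i)),
        t fun i => π (ω i))) -
      nent (piLaw fun _ => P) (fun ω => ((fun i => g (ω i)), t fun i => π (ω i))) ≤
    n * (δ * Real.log (Fintype.card F) + (1 + δ) *
      (nent (extLaw P fun o => K (π o)) (fun w => (f w.1, g w.1, w.2)) -
        nent (extLaw P fun o => K (π o)) (fun w => (g w.1, w.2)))) := by
  have hPn : piLaw (fun _ : Fin n => P) ∈ stdSimplex ℝ (Fin n → O) := piLaw_mem fun _ => hP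
  have hμ : piLaw (fun _ : Fin n => law P π) ∈ stdSimplex ℝ (Fin n → X) :=
    piLaw_mem fun _ => law_mem hP π
  set E := extLaw P fun o => K (π o) with hE
  have hE' : E ∈ stdSimplex ℝ (O × S) := extLaw_mem hP fun o => hK _
  set κ := condLaw E (fun w => (g w.1, w.2)) (fun w => f w.1) with hκ
  have hκ' : ∀ c, κ c ∈ stdSimplex ℝ F := fun c => condLaw_mem hE' _ _ c
  have hcard : ∀ o : O, (0 : ℝ) < Fintype.card F := fun o => by
    exact_mod_cast Fintype.card_pos_iff.2 ⟨f o⟩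
  obtain ⟨o₀⟩ : Nonempty O := by
    by_contra h
    rw [not_nonempty_iff] at h
    have := hP.2
    simp at this
  have hc := hcard o₀
  have hlogc : 0 ≤ Real.log (Fintype.card F) := Real.log_nonneg (by
    exact_mod_cast Fintype.card_pos_iff.2 ⟨f o₀⟩)
  have hκpos : ∀ o s, 0 < E (o, s) → 0 < law E (fun w => (g w.1, w.2)) (g o, s) ∧
      0 < κ (g o, s) (f o) := fun o s h => by
    have h1 := law_mul_condLaw hE' (fun w => (g w.1, w.2)) (fun w => f w.1) (g o, s) (f o)
    have h2 := h.trans_le (le_law hE'.1 (fun w => ((g w.1, w.2), f w.1)) (o, s))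
    rw [← h1] at h2
    exact ⟨pos_of_mul_pos_left h2 ((hκ' _).1 _), pos_of_mul_pos_right h2 (law_nonneg hE'.1 _ _)⟩
  set ℓ : O → S → ℝ := fun o s => -Real.log (κ (g o, s) (f o)) with hℓ
  have hℓ0 : ∀ o s, 0 ≤ ℓ o s := fun o s => by
    refine neg_nonneg.2 (Real.log_nonpos ((hκ' _).1 _) ?_)
    rw [← (hκ' (g o, s)).2]
    exact single_le_sum (fun b _ => (hκ' _).1 b) (mem_univ _)
  set h := nent E (fun w => (f w.1, g w.1, w.2)) - nent E (fun w => (g w.1, w.2)) with hh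
  have hsum : ∑ w, E w * ℓ w.1 w.2 = h := by
    rw [hh, nent_congr hE'.1 (f := fun w => (f w.1, g w.1, w.2))
      (g := fun w => ((g w.1, w.2), f w.1)) (fun w w' => by simp only [Prod.mk.injEq]; tauto),
      nent_eq, nent_eq, ← sum_sub_distrib]
    refine sum_congr rfl fun w _ => ?_
    rcases (hE'.1 w).eq_or_lt with h0 | h0
    · simp [← h0]
    · obtain ⟨h1, h2⟩ := hκpos w.1 w.2 h0
      rw [← law_mul_condLaw hE' (fun w => (g w.1, w.2)) (fun w => f w.1) (g w.1, w.2) (f w.1),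
        Real.log_mul h1.ne' h2.ne']
      simp only [hℓ, hκ]
      ring
  have hh0 : 0 ≤ h := by
    rw [← hsum]
    exact sum_nonneg fun w _ => mul_nonneg (hE'.1 w) (hℓ0 _ _)
  -- Predictive law for Gibbs' inequality: the product of the single-letter conditional laws if
  -- quantization succeeded, and the uniform law otherwise.
  set q : (Fin n → G) × T → (Fin n → F) → ℝ := fun c b =>
    (σ c.2).elim (∏ _i : Fin n, (Fintype.card F : ℝ)⁻¹) fun s => ∏ i, κ (c.1 i, s i) (b i) with hq
  have hq0 : ∀ c b, 0 ≤ q c b := fun c b => by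
    simp only [hq]
    rcases σ c.2 with _ | s
    · exact prod_nonneg fun i _ => inv_nonneg.2 hc.le
    · exact prod_nonneg fun i _ => (hκ' _).1 _
  have hq1 : ∀ c, ∑ b, q c b ≤ 1 := fun c => by
    simp only [hq]
    rcases σ c.2 with _ | s
    · have := sum_prod_apply fun (_ : Fin n) (_ : F) => (Fintype.card F : ℝ)⁻¹
      refine le_of_eq (this.trans (prod_eq_one fun i _ => ?_))
      rw [sum_const, card_univ, nsmul_eq_mul, mul_inv_cancel₀ hc.ne']
    · have := sum_prod_apply fun (i : Fin n) (b : F) => κ (c.1 i, s i) b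
      exact le_of_eq (this.trans (prod_eq_one fun i _ => (hκ' _).2))
  have hEpos : ∀ (a : Fin n → X) (s : Fin n → S) (o : Fin n → O), σ (t a) = some s →
      (∀ i, π (o i) = a i) → (∀ i, 0 < P (o i)) → ∀ i, 0 < E (o i, s i) :=
    fun a s o hs ha ho i => by
      have h1 := (hσ a s hs).ne_zero i
      rw [law_extLaw_input] at h1
      refine mul_pos (ho i) (((hK _).1 _).lt_of_ne' ?_)
      change K (π (o i)) (s i) ≠ 0
      rw [ha]
      exact right_ne_zero_of_mul h1
  have hgibbs := nent_gibbs hPn.1 (fun ω i => f (ω i))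
    (fun ω => ((fun i => g (ω i)), t fun i => π (ω i))) q hq0 hq1 (fun ω hω => by
      rw [piLaw_pos_iff fun _ => hP.1] at hω
      simp only [hq]
      rcases hs : σ (t fun i => π (ω i)) with _ | s
      · exact prod_pos fun i _ => inv_pos.2 hc
      · exact prod_pos fun i _ =>
          (hκpos _ _ (hEpos _ s ω hs (fun _ => rfl) hω i)).2)
  refine hgibbs.trans ?_
  set φ : (Fin n → X) → (Fin n → O) → ℝ := fun a ω =>
    (σ (t a)).elim (n * Real.log (Fintype.card F)) fun s => ∑ i, ℓ (ω i) (s i) with hφ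
  have hφeq : ∀ ω, piLaw (fun _ => P) ω * -Real.log (q ((fun i => g (ω i)),
      t fun i => π (ω i)) fun i => f (ω i)) =
      piLaw (fun _ => P) ω * φ (fun i => π (ω i)) ω := fun ω => by
    rcases (hPn.1 ω).eq_or_lt with h0 | h0
    · rw [← h0, zero_mul, zero_mul]
    · rw [piLaw_pos_iff fun _ => hP.1] at h0
      congr 1
      simp only [hφ, hq]
      rcases hs : σ (t fun i => π (ω i)) with _ | s
      · simp
      · simp only [Option.elim_some]
        rw [Real.log_prod fun i _ =>
          (hκpos _ _ (hEpos _ s ω hs (fun _ => rfl) h0 i)).2.ne', ← sum_neg_distrib]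
  rw [sum_congr rfl fun ω _ => hφeq ω, sum_piLaw_condition hP π φ]
  have hW : ∀ x, condLaw P π id x ∈ stdSimplex ℝ O := fun x => condLaw_mem hP π id x
  -- The expected log loss given a letter of X and a letter of the codeword. It is nonnegative, so
  -- typicality bounds its sum by `1 + δ` times `n` times the mean.
  set ψ : X × S → ℝ := fun d => ∑ o, condLaw P π id d.1 o * ℓ o d.2 with hψ
  have hψ0 : ∀ d, 0 ≤ ψ d := fun d => sum_nonneg fun o _ => mul_nonneg ((hW _).1 _) (hℓ0 _ _)
  have hψsum : ∑ d, law E (fun w => (π w.1, w.2)) d * ψ d = h := by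
    rw [← hsum, Fintype.sum_prod_type_right, Fintype.sum_prod_type_right]
    refine sum_congr rfl fun s _ => ?_
    have h1 : ∀ x, law E (fun w => (π w.1, w.2)) (x, s) * ψ (x, s) =
        ∑ o, law P (fun o => (π o, id o)) (x, o) * (K x s * ℓ o s) := fun x => by
      rw [law_extLaw_input, hψ, mul_sum]
      refine sum_congr rfl fun o _ => ?_
      rw [← law_mul_condLaw hP π id x o]
      ring
    rw [sum_congr rfl fun x _ => h1 x, ← Fintype.sum_prod_type'
      (f := fun x o => law P (fun o => (π o, id o)) (x, o) * (K x s * ℓ o s))]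
    have h2 := sum_law_mul P (fun o => (π o, id o)) (fun d => K d.1 s * ℓ d.2 s)
    rw [h2]
    refine sum_congr rfl fun o _ => ?_
    simp only [hE, extLaw, id]
    ring
  have hinner : ∀ a, ∑ ω, piLaw (fun i => condLaw P π id (a i)) ω * φ a ω ≤
      (if σ (t a) = none then 1 else 0) * (n * Real.log (Fintype.card F)) + n * ((1 + δ) * h) :=
    fun a => by
      have hnn : 0 ≤ n * ((1 + δ) * h) := by positivity
      simp only [hφ]
      rcases hs : σ (t a) with _ | s
      · simp only [Option.elim_none, ← sum_mul, (piLaw_mem fun i => hW (a i)).2, if_true]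
        linarith
      · simp only [Option.elim_some, mul_sum]
        rw [sum_comm, if_neg (by simp), zero_mul, zero_add]
        have h1 : ∀ i, ∑ ω, piLaw (fun i => condLaw P π id (a i)) ω * ℓ (ω i) (s i) =
            ψ (a i, s i) := fun i => sum_piLaw_apply (fun i => hW (a i)) i fun o => ℓ o (s i)
        rw [sum_congr rfl fun i _ => h1 i]
        have h2 := (le_abs_self _).trans ((hσ a s hs).abs_sum_sub_le ψ)
        simp only [abs_of_nonneg (hψ0 _)] at h2
        rw [hψsum] at h2
        linarith
  refine (sum_le_sum fun a _ => mul_le_mul_of_nonneg_left (hinner a) (hμ.1 a)).trans ?_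
  simp only [mul_add, sum_add_distrib, ← sum_mul, ← mul_assoc]
  rw [hμ.2]
  have h3 : ∑ a, piLaw (fun _ : Fin n => law P π) a * (if σ (t a) = none then 1 else 0) ≤ δ := by
    refine le_trans (le_of_eq ?_) hnone
    rw [prob_eq]
    exact sum_congr rfl fun a _ => by by_cases h : σ (t a) = none <;> simp [h]
  have h4 := mul_le_mul_of_nonneg_right h3 (mul_nonneg n.cast_nonneg hlogc : (0 : ℝ) ≤ n * _)
  linarith

/-- The entropy of a letter sequence together with a quantized input is at most its single-letter
value. -/
theorem nent_quantized_le [DecidableEq T] (hP : P ∈ stdSimplex ℝ O) (hK : ∀ x, K x ∈ stdSimplex ℝ S) (π : O → X)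
    (f : O → F) (t : (Fin n → X) → T) (σ : T → Option (Fin n → S)) (hδ : 0 ≤ δ)
    (hσ : ∀ a s, σ (t a) = some s →
      Typ (law (extLaw P fun o => K (π o)) fun w => (π w.1, w.2)) δ fun i => (a i, s i))
    (hnone : prob (piLaw fun _ => law P π) {a | σ (t a) = none} ≤ δ) {I : ℝ}
    (hcard : Real.log ((univ.image t).card : ℝ) ≤ n * (I + δ)) :
    nent (piLaw fun _ => P) (fun ω => ((t fun i => π (ω i)), fun i => f (ω i))) ≤
      n * (I + nent (extLaw P fun o => K (π o)) (fun w => (f w.1, w.2)) -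
        nent (extLaw P fun o => K (π o)) (fun w => w.2) + δ * (1 + Real.log (Fintype.card F) +
          (nent (extLaw P fun o => K (π o)) (fun w => (f w.1, w.2)) -
            nent (extLaw P fun o => K (π o)) (fun w => w.2)))) := by
  have hPn : piLaw (fun _ : Fin n => P) ∈ stdSimplex ℝ (Fin n → O) := piLaw_mem fun _ => hP
  have hE : extLaw P (fun o => K (π o)) ∈ stdSimplex ℝ (O × S) := extLaw_mem hP fun o => hK _
  have h1 := nent_quantized_sub_le hP hK π f (fun _ => ()) t σ hδ hσ hnone
  have h2 := nent_le_log_card hPn (fun ω => t fun i => π (ω i)) (univ.image t) (by simp)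
  rw [nent_congr hPn.1 (f := fun ω => ((fun i => f (ω i)), (fun _ => ()), t fun i => π (ω i)))
      (g := fun ω => ((t fun i => π (ω i)), fun i => f (ω i)))
      (fun ω ω' => by simp only [Prod.mk.injEq]; tauto),
    nent_congr hPn.1 (f := fun ω => ((fun _ : Fin n => ()), t fun i => π (ω i)))
      (g := fun ω => t fun i => π (ω i)) (fun ω ω' => by simp only [Prod.mk.injEq, true_and]),
    nent_congr hE.1 (f := fun w => (f w.1, (), w.2)) (g := fun w => (f w.1, w.2))
      (fun w w' => by simp only [Prod.mk.injEq, true_and]),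
    nent_congr hE.1 (f := fun w => ((), w.2)) (g := fun w => w.2)
      (fun w w' => by simp only [Prod.mk.injEq, true_and])] at h1
  linarith

/-- The entropy of a letter sequence together with a quantized input is at least its single-letter
value. -/
theorem le_nent_quantized (hP : P ∈ stdSimplex ℝ O) (hK : ∀ x, K x ∈ stdSimplex ℝ S) (π : O → X)
    (g : O → G) (t : (Fin n → X) → T) (σ : T → Option (Fin n → S)) (hδ : 0 ≤ δ)
    (hσ : ∀ a s, σ (t a) = some s →
      Typ (law (extLaw P fun o => K (π o)) fun w => (π w.1, w.2)) δ fun i => (a i, s i))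
    (hnone : prob (piLaw fun _ => law P π) {a | σ (t a) = none} ≤ δ) :
    n * (nent P (fun o => (π o, g o)) -
      nent (extLaw P fun o => K (π o)) (fun w => (π w.1, g w.1, w.2)) +
        nent (extLaw P fun o => K (π o)) (fun w => (g w.1, w.2)) -
        δ * (Real.log (Fintype.card X) +
          (nent (extLaw P fun o => K (π o)) (fun w => (π w.1, g w.1, w.2)) -
            nent (extLaw P fun o => K (π o)) (fun w => (g w.1, w.2))))) ≤
      nent (piLaw fun _ => P) (fun ω => ((t fun i => π (ω i)), fun i => g (ω i))) := by
  have hPn : piLaw (fun _ : Fin n => P) ∈ stdSimplex ℝ (Fin n → O) := piLaw_mem fun _ => hP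
  -- An upper bound on H(Xⁿ | Gⁿ, t) becomes a lower bound on H(t, Gⁿ), since Xⁿ determines `t` and
  -- H(Xⁿ, Gⁿ) is known exactly.
  have h1 := nent_quantized_sub_le hP hK π π g t σ hδ hσ hnone
  have h2 := nent_piLaw (fun _ : Fin n => hP) (fun _ o => (π o, g o))
  rw [sum_const, card_univ, Fintype.card_fin, nsmul_eq_mul] at h2
  rw [nent_congr hPn.1 (f := fun ω => ((fun i => π (ω i)), (fun i => g (ω i)), t fun i => π (ω i)))
      (g := fun ω i => (π (ω i), g (ω i))) (fun ω ω' => by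
        simp only [Prod.mk.injEq, funext_iff]
        refine ⟨fun h => ?_, fun h => ?_⟩
        · have h3 : (fun i => π (ω i)) = fun i => π (ω' i) := funext fun i => (h i).1
          exact ⟨fun i => (h i).1, fun i => (h i).2, by rw [h3]⟩
        · exact fun i => ⟨h.1 i, h.2.1 i⟩),
    nent_congr hPn.1 (f := fun ω => ((fun i => g (ω i)), t fun i => π (ω i)))
      (g := fun ω => ((t fun i => π (ω i)), fun i => g (ω i)))
      (fun ω ω' => by simp only [Prod.mk.injEq]; tauto), h2] at h1
  linarith

end Superletters

/-! ### Superletters for a test channel -/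

section TestChannel

variable {X Y Z U V : Type*} [Fintype X] [Fintype Y] [Fintype Z] [Fintype U] [Fintype V]
  {P : X × Y × Z → ℝ} {PV : X → V → ℝ} {PU : V → U → ℝ}

theorem law_jointLaw_xyzv (hU : ∀ v, PU v ∈ stdSimplex ℝ U) :
    law (jointLaw P PV PU) (fun ω => (rvXYZ ω, rvV ω)) = extLaw P fun o => PV o.1 := by
  rw [law_jointLaw]
  refine (law_extLaw_fst (p := extLaw P fun o => PV o.1)
    (K := fun w : (X × Y × Z) × V => PU w.2) (fun w => hU w.2) (fun w => w)).trans ?_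
  funext w
  rw [law_eq, sum_eq_single w]
  · rw [if_pos rfl]
  · exact fun w' _ h => if_neg h
  · simp

theorem law_jointLaw_xyzu :
    law (jointLaw P PV PU) (fun ω => (rvXYZ ω, rvU ω)) =
      extLaw P fun o u => ∑ v, PV o.1 v * PU v u := by
  rw [law_jointLaw]
  funext w
  obtain ⟨o, u⟩ := w
  refine (law_extLaw (p := extLaw P fun o => PV o.1) (fun w => w.2) PU (fun w => w.1) o u).trans ?_
  simp only [extLaw, mul_sum]
  refine sum_congr rfl fun v _ => ?_
  have : law (extLaw P fun o => PV o.1) (fun w => (w.2, w.1)) (v, o) = P o * PV o.1 v := by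
    rw [law_eq, sum_eq_single (o, v)]
    · simp [extLaw]
    · rintro ⟨o', v'⟩ _ h
      rw [if_neg fun h' => h ?_]
      simp only [Prod.mk.injEq] at h' ⊢
      exact ⟨h'.2, h'.1⟩
    · simp
  rw [← mul_assoc, ← this]

theorem compChannel_mem (hV : ∀ x, PV x ∈ stdSimplex ℝ V) (hU : ∀ v, PU v ∈ stdSimplex ℝ U) (x : X) :
    (fun u => ∑ v, PV x v * PU v u) ∈ stdSimplex ℝ U :=
  ⟨fun u => sum_nonneg fun v _ => mul_nonneg ((hV x).1 v) ((hU v).1 u), by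
    rw [sum_comm]
    simp only [← mul_sum, (hU _).2, mul_one, (hV x).2]⟩

/-- Deterministic superletters whose entropies match those of a test channel. -/
theorem exists_superletter (hP : P ∈ stdSimplex ℝ (X × Y × Z)) (hV : ∀ x, PV x ∈ stdSimplex ℝ V)
    (hU : ∀ v, PU v ∈ stdSimplex ℝ U) {γ : ℝ} (hγ : 0 < γ) :
    ∃ (n : ℕ) (fv : (Fin n → X) → Option ((Fin n → U) × (Fin n → V))), 0 < n ∧
      nent (iidLaw P n) (fun ω => (fv (seqX ω), seqY ω)) ≤
        n * (nent P (fun ω => ω.1) - nent (jointLaw P PV PU) (fun ω => (rvX ω, rvV ω)) +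
          nent (jointLaw P PV PU) (fun ω => (rvY ω, rvV ω)) + γ) ∧
      nent (iidLaw P n) (fun ω => ((fv (seqX ω)).map Prod.fst, seqZ ω)) ≤
        n * (nent P (fun ω => ω.1) - nent (jointLaw P PV PU) (fun ω => (rvX ω, rvU ω)) +
          nent (jointLaw P PV PU) (fun ω => (rvZ ω, rvU ω)) + γ) ∧
      n * (nent P (fun ω => ω.1) - nent (jointLaw P PV PU) (fun ω => (rvX ω, rvU ω)) +
          nent (jointLaw P PV PU) (fun ω => (rvY ω, rvU ω)) - γ) ≤
        nent (iidLaw P n) (fun ω => ((fv (seqX ω)).map Prod.fst, seqY ω)) ∧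
      n * (nent P (fun ω => ω.1) - nent (jointLaw P PV PU) (fun ω => (rvX ω, rvV ω)) +
          nent (jointLaw P PV PU) (fun ω => (rvZ ω, rvV ω)) - γ) ≤
        nent (iidLaw P n) (fun ω => (fv (seqX ω), seqZ ω)) := by
  have hJ := jointLaw_mem hP hV hU
  set J := jointLaw P PV PU with hJdef
  have hLV : law J (fun ω => (rvXYZ ω, rvV ω)) = extLaw P fun o => PV o.1 := law_jointLaw_xyzv hU
  set KU : X → U → ℝ := fun x u => ∑ v, PV x v * PU v u with hKU
  have hKU' : ∀ x, KU x ∈ stdSimplex ℝ U := compChannel_mem hV hU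
  have hLU : law J (fun ω => (rvXYZ ω, rvU ω)) = extLaw P fun o => KU o.1 := law_jointLaw_xyzu
  set c₁ := 1 + Real.log (Fintype.card Y) +
    (nent J (fun ω => (rvY ω, rvV ω)) - nent J (fun ω => rvV ω)) with hc₁
  set c₂ := 1 + Real.log (Fintype.card Z) +
    (nent J (fun ω => (rvZ ω, rvU ω)) - nent J (fun ω => rvU ω)) with hc₂
  set c₃ := Real.log (Fintype.card X) +
    (nent J (fun ω => (rvX ω, rvY ω, rvU ω)) - nent J (fun ω => (rvY ω, rvU ω))) with hc₃
  set c₄ := Real.log (Fintype.card X) +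
    (nent J (fun ω => (rvX ω, rvZ ω, rvV ω)) - nent J (fun ω => (rvZ ω, rvV ω))) with hc₄
  obtain ⟨δ, hδ, h₁, h₂, h₃, h₄⟩ : ∃ δ : ℝ, 0 < δ ∧ δ * c₁ ≤ γ ∧ δ * c₂ ≤ γ ∧ δ * c₃ ≤ γ ∧
      δ * c₄ ≤ γ := by
    have hC : 0 < |c₁| + |c₂| + |c₃| + |c₄| + 1 := by positivity
    refine ⟨γ / (|c₁| + |c₂| + |c₃| + |c₄| + 1), by positivity, ?_, ?_, ?_, ?_⟩ <;>
    · rw [div_mul_eq_mul_div, div_le_iff₀ hC]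
      refine mul_le_mul_of_nonneg_left ?_ hγ.le
      linarith [le_abs_self c₁, le_abs_self c₂, le_abs_self c₃, le_abs_self c₄, abs_nonneg c₁,
        abs_nonneg c₂, abs_nonneg c₃, abs_nonneg c₄]
  obtain ⟨n, ⟨fv, htyp, hnone, hcu, hcv⟩, hn⟩ := ((eventually_exists_quantizer hJ rvX rvU rvV hδ).and
    (Filter.eventually_gt_atTop 0)).exists
  have hXlaw : law J rvX = law P fun o => o.1 := law_jointLaw_source hV hU fun o => o.1
  have hXent : nent J rvX = nent P fun o => o.1 := nent_jointLaw_source hV hU fun o => o.1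
  rw [hXlaw] at hnone
  rw [hXent] at hcu hcv
  have m1 := nent_jointLaw_vbu hP hV hU (fun ω => ω.1)
  have m2 := nent_jointLaw_xbu hP hV hU (fun ω => ω.2.1)
  have m3 := nent_jointLaw_xvb hP hV hU (fun ω => ω.2.2)
  rw [← hJdef] at m1 m2 m3
  change nent J (fun ω => (rvV ω, rvX ω, rvU ω)) = nent J (fun ω => (rvX ω, rvV ω)) + _ at m1
  change nent J (fun ω => (rvX ω, rvY ω, rvU ω)) = _ at m2
  change nent J (fun ω => (rvX ω, rvV ω, rvZ ω)) = _ at m3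
  rw [nent_congr hJ.1 (f := fun ω => (rvX ω, rvV ω, rvZ ω)) (g := fun ω => (rvX ω, rvZ ω, rvV ω))
    (fun ω ω' => by simp only [Prod.mk.injEq]; tauto)] at m3
  rw [nent_congr hJ.1 (f := fun ω => ((rvX ω, rvU ω), rvV ω))
      (g := fun ω => (rvV ω, rvX ω, rvU ω)) (fun ω ω' => by simp only [Prod.mk.injEq]; tauto),
    nent_congr hJ.1 (f := fun ω => (rvU ω, rvV ω)) (g := fun ω => (rvV ω, rvU ω))
      (fun ω ω' => by simp only [Prod.mk.injEq]; tauto), m1] at hcv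
  -- By the chain U - V - X, I(X; U,V) = I(X; V): including the U-codeword in the superletter V
  -- costs no rate.
  have hcv' : Real.log ((univ.image fv).card : ℝ) ≤ n * (nent P (fun o => o.1) +
      nent J (fun ω => rvV ω) - nent J (fun ω => (rvX ω, rvV ω)) + δ) := by
    refine hcv.trans (le_of_eq ?_)
    ring
  have tV : ∀ a s, (fv a).map Prod.snd = some s →
      Typ (law (extLaw P fun o => PV o.1) fun w => (w.1.1, w.2)) δ fun i => (a i, s i) :=
    fun a s h => by
      obtain ⟨w, hw, rfl⟩ := Option.map_eq_some_iff.1 h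
      have h1 := (htyp a w hw).law fun d => (d.1.1, d.2)
      rw [law_law] at h1
      rw [← hLV, law_law]
      exact h1
  have tU : ∀ a s, (fv a).map Prod.fst = some s →
      Typ (law (extLaw P fun o => KU o.1) fun w => (w.1.1, w.2)) δ fun i => (a i, s i) :=
    fun a s h => by
      obtain ⟨w, hw, rfl⟩ := Option.map_eq_some_iff.1 h
      have h1 := (htyp a w hw).law fun d => d.1
      rw [law_law] at h1
      rw [← hLU, law_law]
      exact h1
  have nV : prob (piLaw fun _ : Fin n => law P fun o => o.1) {a | (fv a).map Prod.snd = none} ≤ δ := by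
    simpa only [Option.map_eq_none_iff] using hnone
  have nU : prob (piLaw fun _ : Fin n => law P fun o => o.1) {a | (fv a).map Prod.fst = none} ≤ δ := by
    simpa only [Option.map_eq_none_iff] using hnone
  -- The superletter is the pair of codewords, but only its V-component is used for prediction.
  have q1 := nent_quantized_le hP hV (fun o => o.1) (fun o => o.2.1) fv (Option.map Prod.snd) hδ.le
    tV nV hcv'
  have q2 := nent_quantized_le hP hKU' (fun o => o.1) (fun o => o.2.2)
    (fun a => (fv a).map Prod.fst) (fun s => s) hδ.le tU nU hcu
  have q3 := le_nent_quantized hP hKU' (fun o => o.1) (fun o => o.2.1)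
    (fun a => (fv a).map Prod.fst) (fun s => s) hδ.le tU nU
  have q4 := le_nent_quantized hP hV (fun o => o.1) (fun o => o.2.2) fv (Option.map Prod.snd) hδ.le
    tV nV
  rw [← hLV] at q1 q4
  rw [← hLU] at q2 q3
  simp only [nent_law] at q1 q2 q3 q4
  have hn0 : (0 : ℝ) ≤ n := n.cast_nonneg
  refine ⟨n, fv, hn, q1.trans (mul_le_mul_of_nonneg_left ?_ hn0),
    q2.trans (mul_le_mul_of_nonneg_left ?_ hn0), (mul_le_mul_of_nonneg_left ?_ hn0).trans q3,
    (mul_le_mul_of_nonneg_left ?_ hn0).trans q4⟩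
  · change _ + nent J (fun ω => (rvY ω, rvV ω)) - _ + δ * c₁ ≤ _
    linarith
  · change _ + nent J (fun ω => (rvZ ω, rvU ω)) - nent J (fun ω => rvU ω) + δ * c₂ ≤ _
    linarith
  · change _ ≤ _ - nent J (fun ω => (rvX ω, rvY ω, rvU ω)) + nent J (fun ω => (rvY ω, rvU ω)) - δ * c₃
    linarith
  · change _ ≤ _ - nent J (fun ω => (rvX ω, rvZ ω, rvV ω)) + nent J (fun ω => (rvZ ω, rvV ω)) - δ * c₄
    linarith

end TestChannel

/-! ### Achievability -/

section Achievability

variable {X Y Z U V : Type*} [Fintype X] [Fintype Y] [Fintype Z] [Fintype U] [Fintype V]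
  {P : X × Y × Z → ℝ} {PV : X → V → ℝ} {PU : V → U → ℝ}

/-- Rates of a block code in terms of the entropies of its superletters. -/
theorem code_rate_bounds {n N k l2 lV lZ γ ε δ R L Rs HX HY HXZ HXV HYV HZV HXU HYU HZU Hvy Huz Huy
    Hvz K₁ K₂ K₃ leak key keyleak : ℝ} (hlog2 : 0 < l2) (hR0 : 0 ≤ R) (hL0 : 0 ≤ L) (hRs0 : 0 ≤ Rs)
    (hR : HX - HY - (HXV - HYV) ≤ R * l2)
    (hL : 2 * HX - HXZ - (HXV - HYV) - (HYU - HZU) ≤ L * l2)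
    (hRs : Rs * l2 ≤ HYU - HZU - (HYV - HZV)) (hγ : 0 < γ) (hγδ : 6 * γ ≤ δ * l2) (hk' : 1 ≤ k)
    (hn' : 0 < n) (hN0 : 0 ≤ N) (hNn : N * k ≤ n) (hnN : n - k ≤ N * k)
    (hvy : Hvy ≤ k * (HX - HXV + HYV + γ)) (huz : Huz ≤ k * (HX - HXU + HZU + γ))
    (huy : k * (HX - HXU + HYU - γ) ≤ Huy) (hvz : k * (HX - HXV + HZV - γ) ≤ Hvz)
    (hcZ : 0 ≤ HXZ - HX) (hlV0 : 0 ≤ lV) (hlZ : 0 ≤ lZ) (hε : 0 < ε) (hεγ : ε * (2 + lV) ≤ γ)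
    (hCn : k * lZ + l2 + k * (l2 * Rs) ≤ n * γ) (hk₁ : K₁ ≤ N * (Huy - k * HY + ε))
    (hk₂ : K₂ ≤ N * (Hvy - Huy + ε)) (hk₃ : K₃ ≤ N * (max (Hvz - Huz - (Hvy - Huy)) 0 + ε))
    (hleak : leak ≤ N * Huz + K₂ + k * lZ - n * (HXZ - HX))
    (hkey : N * (Hvz - Huz) - K₂ - (l2 + ε * (N * lV)) ≤ key)
    (hkeyleak : keyleak ≤ K₃ + K₂ - N * (Hvz - Huz) + k * lZ + (l2 + ε * (N * lV))) :
    1 / n * ((K₁ + K₂) / l2) ≤ R + δ ∧ 1 / n * (leak / l2) ≤ L + δ ∧ Rs - δ ≤ 1 / n * (key / l2) ∧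
      1 / n * (keyleak / l2) ≤ δ := by
  have hdiv : ∀ x r : ℝ, x ≤ n * (l2 * r + 6 * γ) → 1 / n * (x / l2) ≤ r + δ := fun x r h => by
    rw [one_div, ← div_eq_inv_mul, div_div, div_le_iff₀ (by positivity)]
    have := mul_le_mul_of_nonneg_left hγδ hn'.le
    linarith
  have hεN : N * (ε * (2 + lV)) ≤ N * k * γ := by
    rw [mul_assoc]
    exact mul_le_mul_of_nonneg_left (hεγ.trans (le_mul_of_one_le_left hγ.le hk')) hN0
  have hεl : 0 ≤ N * (ε * lV) := by positivity
  have hεN0 : 0 ≤ N * ε := by positivity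
  have hNγ : N * k * γ ≤ n * γ := mul_le_mul_of_nonneg_right hNn hγ.le
  have gvy := mul_le_mul_of_nonneg_left hvy hN0
  have guz := mul_le_mul_of_nonneg_left huz hN0
  have guy := mul_le_mul_of_nonneg_left huy hN0
  have gvz := mul_le_mul_of_nonneg_left hvz hN0
  have hk0 : 0 ≤ k := zero_le_one.trans hk'
  have hNk0 : 0 ≤ N * k := mul_nonneg hN0 hk0
  have gR := (mul_le_mul_of_nonneg_left hR hNk0).trans
    (mul_le_mul_of_nonneg_right hNn (mul_nonneg hR0 hlog2.le))
  have gL := (mul_le_mul_of_nonneg_left hL hNk0).trans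
    (mul_le_mul_of_nonneg_right hNn (mul_nonneg hL0 hlog2.le))
  have gRs := mul_le_mul_of_nonneg_left hRs hNk0
  have gRs' := mul_le_mul_of_nonneg_right hnN (mul_nonneg hRs0 hlog2.le)
  have gcZ := mul_le_mul_of_nonneg_right hNn hcZ
  have hkZ : 0 ≤ k * lZ := mul_nonneg hk0 hlZ
  have hkRs : 0 ≤ k * (l2 * Rs) := by positivity
  refine ⟨hdiv _ _ (by linarith), hdiv _ _ (by linarith), ?_, ?_⟩
  · have h1 : -key ≤ n * (l2 * -Rs + 6 * γ) := by linarith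
    have h2 := hdiv _ _ h1
    rw [neg_div, mul_neg] at h2
    linarith
  -- Truncating the key rate at zero is harmless: `0 ≤ Rs` makes the ideal rate nonnegative, and the
  -- four superletter entropies err by at most `γ` per letter each.
  · have hmax : N * max (Hvz - Huz - (Hvy - Huy)) 0 ≤
        N * (Hvz - Huz - (Hvy - Huy)) + N * k * (4 * γ) := by
      rw [mul_assoc, ← mul_add]
      refine mul_le_mul_of_nonneg_left (max_le ?_ ?_) hN0
      · have : 0 ≤ k * (4 * γ) := by positivity
        linarith
      · have h3 := mul_le_mul_of_nonneg_left ((mul_nonneg hRs0 hlog2.le).trans hRs) hk0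
        linarith
    have h1 := hdiv keyleak 0 (by linarith)
    rwa [zero_add] at h1

theorem eventually_exists_code (hP : P ∈ stdSimplex ℝ (X × Y × Z))
    (hV : ∀ x, PV x ∈ stdSimplex ℝ V) (hU : ∀ v, PU v ∈ stdSimplex ℝ U) {R L Rs : ℝ} (hR0 : 0 ≤ R)
    (hL0 : 0 ≤ L) (hRs0 : 0 ≤ Rs) (hR : condMutualInfo (jointLaw P PV PU) rvX rvV rvY ≤ R)
    (hL : mutualInfo (jointLaw P PV PU) rvX (fun ω => (rvV ω, rvY ω))
      - condMutualInfo (jointLaw P PV PU) rvX rvY rvU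
      + condMutualInfo (jointLaw P PV PU) rvX rvZ rvU ≤ L)
    (hRs : Rs ≤ condMutualInfo (jointLaw P PV PU) rvV rvY rvU
      - condMutualInfo (jointLaw P PV PU) rvV rvZ rvU) {δ : ℝ} (hδ : 0 < δ) :
    ∀ᶠ n : ℕ in Filter.atTop, ∃ c : Code X Y n, c.Meets P δ R L Rs := by
  obtain ⟨r1, r2, r3⟩ := single_letter_rates hP hV hU
  have hlog2 : 0 < Real.log 2 := Real.log_pos one_lt_two
  rw [r1, div_le_iff₀ hlog2] at hR
  rw [r2, div_le_iff₀ hlog2] at hL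
  rw [r3, le_div_iff₀ hlog2] at hRs
  -- Of the six units, at most four pay for superletter entropies, one for the hashing and Fano
  -- errors, and one for the terms bounded in `n`.
  obtain ⟨γ, hγ, hγδ⟩ : ∃ γ : ℝ, 0 < γ ∧ 6 * γ ≤ δ * Real.log 2 :=
    ⟨δ * Real.log 2 / 6, by positivity, by linarith⟩
  obtain ⟨k, fv, hk, hvy, huz, huy, hvz⟩ := exists_superletter hP hV hU hγ
  have hP0 := iidLaw_mem hP k
  -- The superletter V contains U, so adding U changes no joint entropy.
  have evy : nent (iidLaw P k) (fun ω => (fv (seqX ω), (fv (seqX ω)).map Prod.fst, seqY ω)) =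
      nent (iidLaw P k) (fun ω => (fv (seqX ω), seqY ω)) :=
    nent_congr hP0.1 fun ω ω' => by
      simp only [Prod.mk.injEq]
      exact ⟨fun h => ⟨h.1, by rw [h.1], h.2⟩, fun h => ⟨h.1, h.2.2⟩⟩
  have evz : nent (iidLaw P k) (fun ω => (fv (seqX ω), (fv (seqX ω)).map Prod.fst, seqZ ω)) =
      nent (iidLaw P k) (fun ω => (fv (seqX ω), seqZ ω)) :=
    nent_congr hP0.1 fun ω ω' => by
      simp only [Prod.mk.injEq]
      exact ⟨fun h => ⟨h.1, by rw [h.1], h.2⟩, fun h => ⟨h.1, h.2.2⟩⟩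
  have ey : nent (iidLaw P k) seqY = k * nent P (fun ω => ω.2.1) := by
    have := nent_piLaw (fun _ : Fin k => hP) (fun _ o => o.2.1)
    rw [sum_const, card_univ, Fintype.card_fin, nsmul_eq_mul] at this
    exact this
  have hcZ : 0 ≤ nent P (fun ω => (ω.1, ω.2.2)) - nent P (fun ω => ω.1) :=
    sub_nonneg.2 (nent_mono hP.1 fun ω ω' h => by simp only [Prod.mk.injEq] at h; exact h.1)
  set lV := Real.log (Fintype.card (Option ((Fin k → U) × (Fin k → V)))) with hlV
  have hlV0 : 0 ≤ lV := Real.log_nonneg (by exact_mod_cast Fintype.card_pos)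
  obtain ⟨ε, hε, hεδ, hεγ⟩ : ∃ ε : ℝ, 0 < ε ∧ ε ≤ δ ∧ ε * (2 + lV) ≤ γ := by
    refine ⟨min δ (γ / (2 + lV)), by positivity, min_le_left _ _, ?_⟩
    rw [← le_div_iff₀ (by positivity)]
    exact min_le_right _ _
  have hev := (Nat.tendsto_div_const_atTop hk.ne').eventually (eventually_exists_hashes hP0
    (fun ω => (fv (seqX ω)).map Prod.fst) (fun ω => fv (seqX ω)) seqY seqZ hε)
  -- Costs that do not grow with `n`: the Z-letters of the incomplete block, Fano's bit, and the key
  -- rate lost on that block.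
  set C := k * Real.log (Fintype.card Z + 1) + Real.log 2 + k * (Real.log 2 * Rs) with hC
  have hlZ : 0 ≤ Real.log (Fintype.card Z + 1) := Real.log_nonneg (by
    have : (0 : ℝ) ≤ Fintype.card Z := Nat.cast_nonneg _
    linarith)
  filter_upwards [hev, Filter.eventually_ge_atTop ⌈C / γ⌉₊, Filter.eventually_gt_atTop 0] with n
    ⟨k₁, k₂, k₃, h₁, h₂, h₃, dec, dec', hk₁, hk₂, hk₃, hdec, hdec'⟩ hnC hn
  obtain ⟨c, herr, hM, hleak, hkey, hkeyleak⟩ := exists_block_code (n := n) hP hk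
    (fun x => (fv x).map Prod.fst) fv h₁ h₂ h₃ dec dec' hdec hdec' (h₁ fun _ => none).pos
    (h₂ fun _ => none).pos
  have hCn : C ≤ n * γ := by
    rw [← div_le_iff₀ hγ]
    exact (Nat.le_ceil _).trans (Nat.cast_le.2 hnC)
  rw [ey] at hk₁
  rw [evy] at hk₂
  rw [evy, evz] at hk₃
  rw [evz] at hkey hkeyleak
  have hnN : (n : ℝ) - k ≤ ((n / k : ℕ) : ℝ) * k := by
    have h1 := Nat.lt_div_mul_add hk (a := n)
    have h2 : (n : ℝ) < (n / k : ℕ) * k + k := by exact_mod_cast h1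
    linarith
  obtain ⟨b1, b2, b3, b4⟩ := code_rate_bounds hlog2 hR0 hL0 hRs0 hR hL hRs hγ hγδ
    (by exact_mod_cast hk) (Nat.cast_pos.2 hn) (Nat.cast_nonneg _)
    (by exact_mod_cast Nat.div_mul_le_self n k) hnN hvy huz huy hvz hcZ hlV0 hlZ hε hεγ hCn hk₁ hk₂
    hk₃ hleak hkey hkeyleak
  exact ⟨c, herr.trans hεδ, by rwa [Real.logb, hM], by rwa [mutualInfo_eq], b3,
    by rwa [mutualInfo_eq]⟩

theorem singleLetterRegion_subset (hP : P ∈ stdSimplex ℝ (X × Y × Z)) :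
    singleLetterRegion P ⊆ keyRateRegion P := by
  rintro ⟨R, L, Rs⟩ ⟨hR0, hL0, hRs0, k, l, -, -, PV, PU, hV, hU, hR, hL, hRs⟩
  exact ⟨hR0, hL0, hRs0, fun δ hδ => eventually_exists_code hP hV hU hR0 hL0 hRs0 hR hL hRs hδ⟩

end Achievability

end SecretKey

/-- For a discrete memoryless source with joint probability mass function `P` on
`X × Y × Z`, the compression-leakage-key rate region equals the single-letter region. -/
theorem theorem2 {X Y Z : Type*} [Fintype X] [Fintype Y] [Fintype Z]
    (P : X × Y × Z → ℝ) (hP : P ∈ stdSimplex ℝ (X × Y × Z)) :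
    SecretKey.keyRateRegion P = SecretKey.singleLetterRegion P :=
  Set.Subset.antisymm (SecretKey.keyRateRegion_subset hP) (SecretKey.singleLetterRegion_subset hP)
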